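/- Let $G$ be a Lie group with Lie algebra $\mathfrak g$ and $P\subset G$ a closed subgroup with Lie algebra $\mathfrak p$ (for instance, $G$ semisimple and $P$ parabolic). Let $\pi:\mathcal G\to M$ with $\omega\in\Omega^1(\mathcal G,\mathfrak g)$ be a smooth Cartan geometry of type $(G,P)$ on a smooth manifold $M$. Let $\mathcal A=\mathcal G\times_P\mathfrak g$ be its adjoint tractor bundle, with the tractor connection $\nabla[u,f]=[u,\,df+[u^*\omega,f]]$ and the canonical projection $\Pi:\mathcal A\to TM$, $\Pi[u,X]=d\pi(\omega_u^{-1}X)$. Each $u\in\mathcal G_x$ gives an isomorphism $\mathfrak g\to\mathcal A_x$, $X\mapsto[u,X]$; two such isomorphisms differ by the Adjoint action of an element of $P$. Let $L\subset G/P$ be a smooth regular curve, parameterised by an open interval, that passes through the base point $eP$, and let $$\mathrm{Sym}\,L=\{X\in\mathfrak g\mid \text{the vector field on } G/P \text{ induced by } X \text{ is tangent to } L \text{ at every point of } L\}.$$ Let $\gamma$ be a smooth regular curve in $M$, parameterised by an open interval $J$. It is called an unparameterised distinguished curve modelled on $L$ if there is a smooth section $s$ of $\mathcal G$ along $\gamma$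 such that $s^*\omega$ takes values in $\mathrm{Sym}\,L$. Theorem. The curve $\gamma$ is an unparameterised distinguished curve modelled on $L$ if and only if there is a smooth vector subbundle $\mathcal S\subset\mathcal A|_\gamma$ along $\gamma$ such that 1. at every point $x$ of $\gamma$ the fibre $\mathcal S_x$ is conjugate to $\mathrm{Sym}\,L$, that is, $\mathcal S_x=\{[u,X]\mid X\in\mathrm{Sym}\,L\}$ for some $u\in\mathcal G_x$; 2. the image of $\mathcal S$ under $\Pi$ is the tangent line of $\gamma$ at every point of $\gamma$; 3. $\mathcal S$ is preserved by the tractor connection along $\gamma$, i.e. the covariant derivative along $\gamma$ of every smooth local section of $\mathcal S$ is again a section of $\mathcal S$. -/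

import Mathlib

open Set Filter Topology
open scoped Manifold ContDiff

noncomputable section

namespace CartanTractor

section LieGroups

variable {EG : Type*} [NormedAddCommGroup EG] [NormedSpace ℝ EG]
  {G : Type*} [TopologicalSpace G] [ChartedSpace EG G] [Group G]

/-- The Adjoint action of `g` on the Lie algebra: the derivative at `1` of `x ↦ g x g⁻¹`. -/
def Ad (g : G) : GroupLieAlgebra 𝓘(ℝ, EG) G →L[ℝ] GroupLieAlgebra 𝓘(ℝ, EG) G :=
  (mfderiv 𝓘(ℝ, EG) 𝓘(ℝ, EG) (fun x : G => g * x * g⁻¹) 1 : EG →L[ℝ] EG)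

/-- The value at `g` of the right-invariant vector field generated by `X`, i.e. the velocity at
time `0` of `exp (t X) * g`. Its projection to `G ⧸ P` is the vector field induced by `X` under
the left action of `G`, at the point `g P`. -/
def infinitesimalAction (g : G) :
    GroupLieAlgebra 𝓘(ℝ, EG) G →L[ℝ] TangentSpace 𝓘(ℝ, EG) g :=
  (mfderiv 𝓘(ℝ, EG) 𝓘(ℝ, EG) (fun x : G => x * g) 1 : EG →L[ℝ] EG)

variable {EP : Type*} [NormedAddCommGroup EP] [NormedSpace ℝ EP]

/-- `P` is a closed Lie subgroup of `G`: with its subspace topology and its own structure of a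
Lie group it is closed in `G`, and the inclusion is a smooth immersion. -/
structure IsClosedLieSubgroup (EG EP : Type*) [NormedAddCommGroup EG] [NormedSpace ℝ EG]
    [NormedAddCommGroup EP] [NormedSpace ℝ EP]
    {G : Type*} [TopologicalSpace G] [ChartedSpace EG G] [Group G]
    (P : Subgroup G) [ChartedSpace EP P] : Prop where
  isClosed : IsClosed (P : Set G)
  contMDiff_subtype : ContMDiff 𝓘(ℝ, EP) 𝓘(ℝ, EG) ∞ (fun p : P => (p : G))
  injective_mfderiv : Function.Injective
    (mfderiv 𝓘(ℝ, EP) 𝓘(ℝ, EG) (fun p : P => (p : G)) 1)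

variable (EP) in
/-- The tangent space at `g` of the coset `g P`. It is the kernel of `T_g G → T_{gP} (G ⧸ P)`, so
that `T_{gP} (G ⧸ P) = T_g G ⧸ cosetTangent EP P g`. -/
def cosetTangent (P : Subgroup G) [ChartedSpace EP P] (g : G) :
    Submodule ℝ (TangentSpace 𝓘(ℝ, EG) g) :=
  LinearMap.range
    (mfderiv 𝓘(ℝ, EP) 𝓘(ℝ, EG) (fun p : P => g * (p : G)) 1).toLinearMap

variable (EG) in
/-- `c` is a lift to `G`, defined near `t` and smooth at `t`, of the curve `ℓ` in `G ⧸ P`. -/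
structure IsLiftAt (P : Subgroup G) (ℓ : ℝ → G ⧸ P) (c : ℝ → G) (t : ℝ) : Prop where
  contMDiffAt : ContMDiffAt 𝓘(ℝ, ℝ) 𝓘(ℝ, EG) ∞ c t
  mk_eq : ∀ᶠ s in 𝓝 t, (QuotientGroup.mk (c s) : G ⧸ P) = ℓ s

/-- The velocity of a curve in a manifold. -/
def velocity (E : Type*) [NormedAddCommGroup E] [NormedSpace ℝ E] {N : Type*}
    [TopologicalSpace N] [ChartedSpace E N] (c : ℝ → N) (t : ℝ) : TangentSpace 𝓘(ℝ, E) (c t) :=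
  mfderiv 𝓘(ℝ, ℝ) 𝓘(ℝ, E) c t (1 : ℝ)

variable (EG EP) in
/-- `ℓ` restricted to the open interval `K` is a smooth curve in the homogeneous space `G ⧸ P`
with nowhere vanishing velocity: locally it lifts to a smooth curve in `G` whose velocity does not
project to zero in `G ⧸ P`. -/
structure IsRegularModelCurve (P : Subgroup G) [ChartedSpace EP P] (ℓ : ℝ → G ⧸ P) (K : Set ℝ) :
    Prop where
  isOpen : IsOpen K
  ordConnected : K.OrdConnected
  exists_lift : ∀ t ∈ K, ∃ c : ℝ → G, IsLiftAt EG P ℓ c t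
  regular : ∀ t ∈ K, ∀ c : ℝ → G, IsLiftAt EG P ℓ c t → velocity EG c t ∉ cosetTangent EP P (c t)

variable (EG EP) in
/-- The symmetry algebra of the curve `L = ℓ '' K` in `G ⧸ P`: all `X` in the Lie algebra of `G`
for which the vector field on `G ⧸ P` induced by `X` is tangent to `L` at every point of `L`.
Tangency at `ℓ t = g P`, `g = c t`, is expressed in
`T_{gP} (G ⧸ P) = T_g G ⧸ T_g (g P)`. -/
def symmetryAlgebra (P : Subgroup G) [ChartedSpace EP P] (ℓ : ℝ → G ⧸ P) (K : Set ℝ) :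
    Submodule ℝ (GroupLieAlgebra 𝓘(ℝ, EG) G) where
  carrier := {X | ∀ t ∈ K, ∀ c : ℝ → G, IsLiftAt EG P ℓ c t →
    infinitesimalAction (c t) X ∈ Submodule.span ℝ {velocity EG c t} ⊔ cosetTangent EP P (c t)}
  add_mem' := by
    intro X Y hX hY t ht c hc
    rw [map_add]
    exact Submodule.add_mem _ (hX t ht c hc) (hY t ht c hc)
  zero_mem' := by
    intro t ht c hc
    rw [map_zero]
    exact Submodule.zero_mem _
  smul_mem' := by
    intro r X hX t ht c hc
    rw [map_smul]
    exact Submodule.smul_mem _ r (hX t ht c hc)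

end LieGroups

/-- A smooth Cartan geometry of type `(G, P)` on `M`: a smooth principal right `P`-bundle
`proj : B → M` with a Cartan connection `form` with values in the Lie algebra of `G`. -/
structure CartanGeometry (EG EP EM EB : Type*)
    [NormedAddCommGroup EG] [NormedSpace ℝ EG] [NormedAddCommGroup EP] [NormedSpace ℝ EP]
    [NormedAddCommGroup EM] [NormedSpace ℝ EM] [NormedAddCommGroup EB] [NormedSpace ℝ EB]
    {G : Type*} [TopologicalSpace G] [ChartedSpace EG G] [Group G]
    (P : Subgroup G) [ChartedSpace EP P]
    (M : Type*) [TopologicalSpace M] [ChartedSpace EM M]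
    (B : Type*) [TopologicalSpace B] [ChartedSpace EB B] [IsManifold 𝓘(ℝ, EB) ∞ B] where
  proj : B → M
  contMDiff_proj : ContMDiff 𝓘(ℝ, EB) 𝓘(ℝ, EM) ∞ proj
  /-- The right action of `P` on `B`. -/
  act : B → P → B
  contMDiff_act : ContMDiff (𝓘(ℝ, EB).prod 𝓘(ℝ, EP)) 𝓘(ℝ, EB) ∞ (fun x : B × P => act x.1 x.2)
  act_one : ∀ u, act u 1 = u
  act_mul : ∀ u p q, act u (p * q) = act (act u p) q
  proj_act : ∀ u p, proj (act u p) = proj u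
  /-- Local triviality: over `U` the maps `(y, p) ↦ act (σ y) p` and `u ↦ (proj u, τ u)` are
  mutually inverse diffeomorphisms between `U × P` and the preimage of `U`. -/
  exists_trivialization : ∀ x : M, ∃ U : Set M, IsOpen U ∧ x ∈ U ∧ ∃ (σ : M → B) (τ : B → P),
    ContMDiffOn 𝓘(ℝ, EM) 𝓘(ℝ, EB) ∞ σ U ∧
    ContMDiffOn 𝓘(ℝ, EB) 𝓘(ℝ, EP) ∞ τ (proj ⁻¹' U) ∧
    (∀ y ∈ U, proj (σ y) = y) ∧
    (∀ y ∈ U, ∀ p, τ (act (σ y) p) = p) ∧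
    (∀ u ∈ proj ⁻¹' U, act (σ (proj u)) (τ u) = u)
  /-- The Cartan connection, a linear isomorphism at every point. -/
  form : ∀ u : B, TangentSpace 𝓘(ℝ, EB) u ≃L[ℝ] GroupLieAlgebra 𝓘(ℝ, EG) G
  contMDiff_form : ContMDiff (M' := EG) 𝓘(ℝ, EB).tangent 𝓘(ℝ, EG) ∞
    (fun ξ : TangentBundle 𝓘(ℝ, EB) B => form ξ.1 ξ.2)
  /-- Equivariance under the right action: pulling back `form` by `p` gives `Ad p⁻¹ ∘ form`. -/
  form_equivariant : ∀ (u : B) (p : P) (ξ : TangentSpace 𝓘(ℝ, EB) u),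
    form (act u p) (mfderiv 𝓘(ℝ, EB) 𝓘(ℝ, EB) (fun v => act v p) u ξ) = Ad ((p : G)⁻¹) (form u ξ)
  /-- `form` reproduces the generators of the fundamental vector fields. -/
  form_fundamental : ∀ (u : B) (X : TangentSpace 𝓘(ℝ, EP) (1 : P)),
    form (act u 1) (mfderiv 𝓘(ℝ, EP) 𝓘(ℝ, EB) (fun p : P => act u p) 1 X) =
      mfderiv 𝓘(ℝ, EP) 𝓘(ℝ, EG) (fun p : P => (p : G)) 1 X

namespace CartanGeometry

variable {EG EP EM EB : Type*}
  [NormedAddCommGroup EG] [NormedSpace ℝ EG] [NormedAddCommGroup EP] [NormedSpace ℝ EP]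
  [NormedAddCommGroup EM] [NormedSpace ℝ EM] [NormedAddCommGroup EB] [NormedSpace ℝ EB]
  {G : Type*} [TopologicalSpace G] [ChartedSpace EG G] [Group G]
  {P : Subgroup G} [ChartedSpace EP P]
  {M : Type*} [TopologicalSpace M] [ChartedSpace EM M]
  {B : Type*} [TopologicalSpace B] [ChartedSpace EB B] [IsManifold 𝓘(ℝ, EB) ∞ B]
  (C : CartanGeometry EG EP EM EB P M B)

/-- The fibre of the Cartan bundle over `x`. -/
def Fiber (x : M) : Type _ := {u : B // C.proj u = x}

/-- The right action of `P` on a fibre of the Cartan bundle. -/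
def fiberAct {x : M} (u : C.Fiber x) (p : P) : C.Fiber x :=
  ⟨C.act u.1 p, (C.proj_act u.1 p).trans u.2⟩

/-- The fibre over `x` of the adjoint tractor bundle, the bundle associated with the Cartan
bundle by the Adjoint representation of `P` on the Lie algebra of `G`. An element is given as the
equivariant function it defines on the fibre of the Cartan bundle: the class `[u, X]` is the
function `a` with `a u = X` and `a (u p) = Ad p⁻¹ X`. -/
def AdjointTractor (x : M) : Submodule ℝ (C.Fiber x → GroupLieAlgebra 𝓘(ℝ, EG) G) where
  carrier := {a | ∀ (u : C.Fiber x) (p : P), a (C.fiberAct u p) = Ad ((p : G)⁻¹) (a u)}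
  add_mem' := by
    intro a b ha hb u p
    simp only [Pi.add_apply, ha u p, hb u p, map_add]
  zero_mem' := by
    intro u p
    simp only [Pi.zero_apply, map_zero]
  smul_mem' := by
    intro r a ha u p
    simp only [Pi.smul_apply, ha u p, map_smul]

/-- The identification of the fibre of the adjoint tractor bundle with the Lie algebra of `G`
defined by the point `u` of the Cartan bundle, `[u, X] ↦ X`. -/
def frame {x : M} (u : C.Fiber x) : C.AdjointTractor x →ₗ[ℝ] GroupLieAlgebra 𝓘(ℝ, EG) G where
  toFun a := a.1 u
  map_add' _ _ := rfl
  map_smul' _ _ := rfl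

/-- The canonical projection of the adjoint tractor bundle to the tangent bundle, `[u, X]` being
sent to the projection of `(form u)⁻¹ X`. It does not depend on `u`. -/
def anchor {x : M} (u : C.Fiber x) : C.AdjointTractor x →ₗ[ℝ] TangentSpace 𝓘(ℝ, EM) x :=
  (mfderiv 𝓘(ℝ, EB) 𝓘(ℝ, EM) C.proj u.1).toLinearMap ∘ₗ
    (C.form u.1).symm.toLinearEquiv.toLinearMap ∘ₗ C.frame u

/-- `u` is a lift of the curve `γ` to the Cartan bundle that is smooth at `t`. -/
def IsSmoothLiftAt {γ : ℝ → M} (u : ∀ t : ℝ, C.Fiber (γ t)) (t : ℝ) : Prop :=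
  ContMDiffAt 𝓘(ℝ, ℝ) 𝓘(ℝ, EB) ∞ (fun s => (u s).1) t

/-- The section `a` along `γ` of the adjoint tractor bundle is smooth over `U`. -/
def IsSmoothSectionOn {γ : ℝ → M} (a : ∀ t : ℝ, C.AdjointTractor (γ t)) (U : Set ℝ) : Prop :=
  ∀ t ∈ U, ∀ u : ∀ s : ℝ, C.Fiber (γ s), C.IsSmoothLiftAt u t →
    ContDiffAt (F := EG) ℝ ∞ (fun s => C.frame (u s) (a s)) t

/-- `b` is the derivative at `t`, with respect to the tractor connection along `γ`, of the section
`a` of the adjoint tractor bundle: if `a = [u, f]` for a lift `u` of `γ`, then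
`b = [u, f' + ⁅form u', f⁆]`. -/
def HasTractorDerivAt {γ : ℝ → M} (a : ∀ t : ℝ, C.AdjointTractor (γ t)) (t : ℝ)
    (b : C.AdjointTractor (γ t)) : Prop :=
  ∀ u : ∀ s : ℝ, C.Fiber (γ s), C.IsSmoothLiftAt u t →
    HasDerivAt (F := EG) (fun s => C.frame (u s) (a s))
      (C.frame (u t) b -
        ⁅C.form (u t).1 (velocity EB (fun s => (u s).1) t), C.frame (u t) (a t)⁆) t

/-- The family `S` of subspaces is a smooth vector subbundle over `J` of the restriction to `γ` of
the adjoint tractor bundle: locally it has a smooth frame. -/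
def IsSmoothSubbundle {γ : ℝ → M} (S : ∀ t : ℝ, Submodule ℝ (C.AdjointTractor (γ t)))
    (J : Set ℝ) : Prop :=
  ∀ t₀ ∈ J, ∃ U : Set ℝ, IsOpen U ∧ t₀ ∈ U ∧ U ⊆ J ∧
    ∃ (k : ℕ) (e : Fin k → ∀ t : ℝ, C.AdjointTractor (γ t)),
      (∀ i, C.IsSmoothSectionOn (e i) U) ∧
      ∀ t ∈ U, LinearIndependent ℝ (fun i => e i t) ∧
        Submodule.span ℝ (Set.range fun i => e i t) = S t

/-- The tractor connection along `γ` preserves `S`: it differentiates smooth local sections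
of `S` to sections of `S`. -/
def IsPreserved {γ : ℝ → M} (S : ∀ t : ℝ, Submodule ℝ (C.AdjointTractor (γ t)))
    (J : Set ℝ) : Prop :=
  ∀ U : Set ℝ, IsOpen U → U ⊆ J → ∀ a : ∀ t : ℝ, C.AdjointTractor (γ t),
    C.IsSmoothSectionOn a U → (∀ t ∈ U, a t ∈ S t) →
      ∀ t ∈ U, ∃ b ∈ S t, C.HasTractorDerivAt a t b

/-- The curve `γ`, parameterised by `J`, is an unparameterised distinguished curve modelled on a
curve with symmetry algebra `𝔥`: there is a smooth section `s` along `γ` of the Cartan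
bundle such that the pull-back of `form` by `s` takes values in `𝔥`. -/
def IsDistinguished (𝔥 : Submodule ℝ (GroupLieAlgebra 𝓘(ℝ, EG) G)) (γ : ℝ → M) (J : Set ℝ) :
    Prop :=
  ∃ s : ℝ → B, ContMDiffOn 𝓘(ℝ, ℝ) 𝓘(ℝ, EB) ∞ s J ∧
    ∀ t ∈ J, C.proj (s t) = γ t ∧ C.form (s t) (velocity EB s t) ∈ 𝔥

end CartanGeometry

end CartanTractor

end

/-! Write 𝔥 for Sym L, 𝔭 for the Lie algebra of P, ω for the Cartan connection. Only two facts about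
L are needed: 𝔥 is closed under the bracket (`adMap_mem_symmetryAlgebra`), and 𝔥 lies in a line plus
𝔭, because L passes through eP (`exists_symmetryAlgebra_le`). The bracket is handled throughout as
the derivative of Ad (`lieBr_eq_adMap`).

Given a lift s with s^*ω in 𝔥, take S = [s, 𝔥]. In the frame s it is constant and the connection is
d + ad(s^*ω), so it is preserved because 𝔥 is a subalgebra. It contains [s, ω(s')], which projects
to γ'; since dπ ∘ ω⁻¹ kills 𝔭, the image of S is no more than a line
(`exists_subbundle_of_isDistinguished`).

Conversely, start from a lift u through a point where S is 𝔥. Condition 2 yields a smooth 𝔭-valued Z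
such that ω(u') + Z lies in S read in the frame u (`exists_smooth_correction`). Solving r⁻¹r' = -Z
in P (`exists_logVel_eq`) and passing to v = u r⁻¹ puts ω(v') itself in S. In the frame v the fibres
of S are subalgebras containing ω(v'), so being preserved by d + ad ω(v') means being preserved by
d, and such a family of subspaces is constant (`eventually_span_eq`). Hence S is 𝔥 in the frame v
near the starting point, and v is an adapted lift (`exists_isAdaptedAt_near`).

To globalise, note that two adapted lifts differ by a curve r in P with Ad(r)𝔥 = 𝔥 and r⁻¹r' in 𝔥.
Both properties survive in r ∘ φ, where φ maps ℝ into a small interval and is the identity near a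
given point. So an adapted germ can be continued as far as any other adapted lift through that
parameter reaches (`exists_prolongation`), and local lifts concatenate along the whole interval
(`exists_global`). -/

set_option linter.unusedSectionVars false

noncomputable section

namespace CartanTractor

/-! ### Manifold derivatives as maps of model spaces. -/

section Derivative

variable {E E₁ E₂ E₃ : Type*} [NormedAddCommGroup E] [NormedSpace ℝ E]
  [NormedAddCommGroup E₁] [NormedSpace ℝ E₁] [NormedAddCommGroup E₂] [NormedSpace ℝ E₂]
  [NormedAddCommGroup E₃] [NormedSpace ℝ E₃]
  {N : Type*} [TopologicalSpace N] [ChartedSpace E N]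
  {N₁ : Type*} [TopologicalSpace N₁] [ChartedSpace E₁ N₁]
  {N₂ : Type*} [TopologicalSpace N₂] [ChartedSpace E₂ N₂]
  {N₃ : Type*} [TopologicalSpace N₃] [ChartedSpace E₃ N₃]

variable (E E₁) in
/-- The manifold derivative, as a continuous linear map between the model vector spaces. -/
def der (f : N → N₁) (x : N) : E →L[ℝ] E₁ :=
  mfderiv 𝓘(ℝ, E) 𝓘(ℝ, E₁) f x

/-- The base point `y` is separate from `f x`, so that it can be given in simplified form, such as
`1` for `g⁻¹ * g`, with no transport between tangent spaces. -/
lemma der_comp {g : N₁ → N₂} {f : N → N₁} {x : N} {y : N₁}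
    (hg : MDifferentiableAt 𝓘(ℝ, E₁) 𝓘(ℝ, E₂) g y)
    (hf : MDifferentiableAt 𝓘(ℝ, E) 𝓘(ℝ, E₁) f x) (hy : f x = y) :
    der E E₂ (fun z => g (f z)) x = (der E₁ E₂ g y).comp (der E E₁ f x) := by
  subst hy
  exact mfderiv_comp x hg hf

lemma der_comp_apply {g : N₁ → N₂} {f : N → N₁} {x : N} {y : N₁}
    (hg : MDifferentiableAt 𝓘(ℝ, E₁) 𝓘(ℝ, E₂) g y)
    (hf : MDifferentiableAt 𝓘(ℝ, E) 𝓘(ℝ, E₁) f x) (hy : f x = y) (v : E) :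
    der E E₂ (fun z => g (f z)) x v = der E₁ E₂ g y (der E E₁ f x v) := by
  rw [der_comp hg hf hy]; rfl

lemma der_congr {f g : N → N₁} {x : N} (h : f =ᶠ[𝓝 x] g) : der E E₁ f x = der E E₁ g x :=
  h.mfderiv_eq

lemma der_id (x : N) : der E E (fun z : N => z) x = ContinuousLinearMap.id ℝ E :=
  mfderiv_id

lemma der_const (x : N) (y : N₁) : der E E₁ (fun _ : N => y) x = 0 :=
  mfderiv_const

lemma der_binary {F : N₁ → N₂ → N₃} {f : N → N₁} {g : N → N₂} {x : N} {a : N₁} {b : N₂}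
    (hF : MDifferentiableAt (𝓘(ℝ, E₁).prod 𝓘(ℝ, E₂)) 𝓘(ℝ, E₃) (fun p : N₁ × N₂ => F p.1 p.2) (a, b))
    (hf : MDifferentiableAt 𝓘(ℝ, E) 𝓘(ℝ, E₁) f x) (hg : MDifferentiableAt 𝓘(ℝ, E) 𝓘(ℝ, E₂) g x)
    (ha : f x = a) (hb : g x = b) (v : E) :
    der E E₃ (fun z => F (f z) (g z)) x v =
      der E₁ E₃ (fun y => F y b) a (der E E₁ f x v) +
        der E₂ E₃ (fun z => F a z) b (der E E₂ g x v) := by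
  subst ha hb
  have h := mfderiv_comp (I' := 𝓘(ℝ, E₁).prod 𝓘(ℝ, E₂)) x
    (g := fun p : N₁ × N₂ => F p.1 p.2) (f := fun z => (f z, g z)) hF (hf.prodMk hg)
  have h2 : mfderiv 𝓘(ℝ, E) 𝓘(ℝ, E₃) (fun z => F (f z) (g z)) x v =
      mfderiv (𝓘(ℝ, E₁).prod 𝓘(ℝ, E₂)) 𝓘(ℝ, E₃) (fun p : N₁ × N₂ => F p.1 p.2) (f x, g x)
        (mfderiv 𝓘(ℝ, E) (𝓘(ℝ, E₁).prod 𝓘(ℝ, E₂)) (fun z => (f z, g z)) x v) :=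
    congrArg (fun T => T v) h
  have h3 := mfderiv_prod_eq_add_apply (I := 𝓘(ℝ, E₁)) (I' := 𝓘(ℝ, E₂)) (I'' := 𝓘(ℝ, E₃))
    (f := fun p : N₁ × N₂ => F p.1 p.2) (p := (f x, g x))
    (v := mfderiv 𝓘(ℝ, E) (𝓘(ℝ, E₁).prod 𝓘(ℝ, E₂)) (fun z => (f z, g z)) x v) hF
  rw [hf.mfderiv_prod hg] at h2 h3
  exact h2.trans h3

lemma der_eq_fderiv (f : E → E₁) (x : E) : der E E₁ f x = fderiv ℝ f x :=
  mfderiv_eq_fderiv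

lemma hasFDerivAt_der {f : E → E₁} {x : E} (h : MDifferentiableAt 𝓘(ℝ, E) 𝓘(ℝ, E₁) f x) :
    HasFDerivAt f (der E E₁ f x) x := by
  rw [der_eq_fderiv]
  exact h.differentiableAt.hasFDerivAt

lemma hasDerivAt_der {f : ℝ → E₁} {t : ℝ} (h : MDifferentiableAt 𝓘(ℝ, ℝ) 𝓘(ℝ, E₁) f t) :
    HasDerivAt f (der ℝ E₁ f t 1) t :=
  (hasFDerivAt_der h).hasDerivAt

lemma _root_.HasDerivAt.der_apply {f : ℝ → E₁} {t : ℝ} {v : E₁} (h : HasDerivAt f v t) (r : ℝ) :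
    der ℝ E₁ f t r = r • v := by
  rw [der_eq_fderiv, h.hasFDerivAt.fderiv]
  simp

lemma der_extChartAt_self (x : N) [IsManifold 𝓘(ℝ, E) 1 N] :
    der E E (extChartAt 𝓘(ℝ, E) x) x = ContinuousLinearMap.id ℝ E :=
  mfderiv_extChartAt_self

lemma der_extChartAt_symm_self (x : N) [IsManifold 𝓘(ℝ, E) 1 N] :
    der E E (extChartAt 𝓘(ℝ, E) x).symm (extChartAt 𝓘(ℝ, E) x x) =
      ContinuousLinearMap.id ℝ E := by
  have h := mfderivWithin_range_extChartAt_symm (I := 𝓘(ℝ, E)) (x := x)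
  rw [ModelWithCorners.range_eq_univ, mfderivWithin_univ] at h
  exact h

lemma velocity_eq_der (c : ℝ → N) (t : ℝ) : velocity E c t = der ℝ E c t 1 := rfl

end Derivative

end CartanTractor
end

noncomputable section

namespace CartanTractor

/-! ### Smoothness of the Adjoint action. -/

section LieGroup

variable {E : Type*} [NormedAddCommGroup E] [NormedSpace ℝ E]
  {G : Type*} [TopologicalSpace G] [ChartedSpace E G] [Group G] [LieGroup 𝓘(ℝ, E) ∞ G]

lemma mdiff_mul (x : G × G) :
    MDifferentiableAt (𝓘(ℝ, E).prod 𝓘(ℝ, E)) 𝓘(ℝ, E) (fun p : G × G => p.1 * p.2) x :=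
  (contMDiff_mul 𝓘(ℝ, E) ∞).mdifferentiable (by simp) x

lemma mdiff_mul_left (g x : G) : MDifferentiableAt 𝓘(ℝ, E) 𝓘(ℝ, E) (fun y : G => g * y) x :=
  (contMDiff_mul_left (I := 𝓘(ℝ, E)) (n := ∞)).mdifferentiable (by simp) x

lemma mdiff_mul_right (g x : G) : MDifferentiableAt 𝓘(ℝ, E) 𝓘(ℝ, E) (fun y : G => y * g) x :=
  (contMDiff_mul_right (I := 𝓘(ℝ, E)) (n := ∞)).mdifferentiable (by simp) x

lemma contMDiff_conj (g : G) :
    ContMDiff 𝓘(ℝ, E) 𝓘(ℝ, E) ∞ (fun y : G => g * y * g⁻¹) :=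
  (contMDiff_mul_right (I := 𝓘(ℝ, E)) (n := ∞) (a := g⁻¹)).comp
    (contMDiff_mul_left (I := 𝓘(ℝ, E)) (n := ∞) (a := g))

lemma mdiff_conj (g x : G) :
    MDifferentiableAt 𝓘(ℝ, E) 𝓘(ℝ, E) (fun y : G => g * y * g⁻¹) x :=
  (contMDiff_conj g).mdifferentiable (by simp) x

/-- The Adjoint action, as a continuous linear endomorphism of the model vector space. -/
def adjointMap (E : Type*) [NormedAddCommGroup E] [NormedSpace ℝ E]
    {G : Type*} [TopologicalSpace G] [ChartedSpace E G] [Group G] (g : G) : E →L[ℝ] E :=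
  der E E (fun x : G => g * x * g⁻¹) 1

lemma adjointMap_one : adjointMap E (1 : G) = ContinuousLinearMap.id ℝ E := by
  have : (fun x : G => (1 : G) * x * 1⁻¹) = fun x => x := by ext; simp
  rw [adjointMap, this, der_id]

lemma adjointMap_mul (g h : G) : adjointMap E (g * h) = (adjointMap E g).comp (adjointMap E h) := by
  have : (fun x : G => (g * h) * x * (g * h)⁻¹) = fun x => g * (h * x * h⁻¹) * g⁻¹ := by
    ext; group
  rw [adjointMap, this]
  exact der_comp (mdiff_conj g 1) (mdiff_conj h 1) (by group)

lemma adjointMap_mul_apply (g h : G) (X : E) :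
    adjointMap E (g * h) X = adjointMap E g (adjointMap E h X) := by
  rw [adjointMap_mul]; rfl

lemma adjointMap_inv_apply_self (g : G) (X : E) : adjointMap E g⁻¹ (adjointMap E g X) = X := by
  rw [← adjointMap_mul_apply, inv_mul_cancel, adjointMap_one]; rfl

lemma adjointMap_apply_inv_self (g : G) (X : E) : adjointMap E g (adjointMap E g⁻¹ X) = X := by
  rw [← adjointMap_mul_apply, mul_inv_cancel, adjointMap_one]; rfl

lemma contMDiffAt_chart_symm (x : G) :
    ContMDiffAt 𝓘(ℝ, E) 𝓘(ℝ, E) ∞ (extChartAt 𝓘(ℝ, E) x).symm (extChartAt 𝓘(ℝ, E) x x) :=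
  (contMDiffOn_extChartAt_symm x).contMDiffAt (extChartAt_target_mem_nhds x)

/-- Multiplication in the chart at the identity. -/
def chartMul (E G : Type*) [NormedAddCommGroup E] [NormedSpace ℝ E]
    [TopologicalSpace G] [ChartedSpace E G] [Group G] (p : E × E) : E :=
  extChartAt 𝓘(ℝ, E) (1 : G)
    ((extChartAt 𝓘(ℝ, E) (1 : G)).symm p.1 * (extChartAt 𝓘(ℝ, E) (1 : G)).symm p.2)

lemma contDiffAt_chartMul :
    ContDiffAt ℝ ∞ (chartMul E G) (extChartAt 𝓘(ℝ, E) (1 : G) 1, extChartAt 𝓘(ℝ, E) (1 : G) 1) := by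
  rw [← contMDiffAt_iff_contDiffAt]
  have h1 : ContMDiffAt 𝓘(ℝ, E × E) 𝓘(ℝ, E) ∞
      (fun p : E × E => (extChartAt 𝓘(ℝ, E) (1 : G)).symm p.1)
      (extChartAt 𝓘(ℝ, E) (1 : G) 1, extChartAt 𝓘(ℝ, E) (1 : G) 1) :=
    ContMDiffAt.comp (x := (extChartAt 𝓘(ℝ, E) (1 : G) 1, extChartAt 𝓘(ℝ, E) (1 : G) 1))
      (g := (extChartAt 𝓘(ℝ, E) (1 : G)).symm) (f := Prod.fst) (contMDiffAt_chart_symm (1 : G))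
      contDiff_fst.contMDiff.contMDiffAt
  have h2 : ContMDiffAt 𝓘(ℝ, E × E) 𝓘(ℝ, E) ∞
      (fun p : E × E => (extChartAt 𝓘(ℝ, E) (1 : G)).symm p.2)
      (extChartAt 𝓘(ℝ, E) (1 : G) 1, extChartAt 𝓘(ℝ, E) (1 : G) 1) :=
    ContMDiffAt.comp (x := (extChartAt 𝓘(ℝ, E) (1 : G) 1, extChartAt 𝓘(ℝ, E) (1 : G) 1))
      (g := (extChartAt 𝓘(ℝ, E) (1 : G)).symm) (f := Prod.snd) (contMDiffAt_chart_symm (1 : G))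
      contDiff_snd.contMDiff.contMDiffAt
  refine ContMDiffAt.comp_of_eq (g := extChartAt 𝓘(ℝ, E) (1 : G)) (y := 1) contMDiffAt_extChartAt
    (h1.mul h2) ?_
  simp

/-- Conjugation in the chart at the identity. -/
def chartConj (E G : Type*) [NormedAddCommGroup E] [NormedSpace ℝ E]
    [TopologicalSpace G] [ChartedSpace E G] [Group G] (a b : E) : E :=
  extChartAt 𝓘(ℝ, E) (1 : G)
    ((extChartAt 𝓘(ℝ, E) (1 : G)).symm a * (extChartAt 𝓘(ℝ, E) (1 : G)).symm b *
      ((extChartAt 𝓘(ℝ, E) (1 : G)).symm a)⁻¹)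

lemma contDiffAt_chartConj :
    ContDiffAt ℝ ∞ (Function.uncurry (chartConj E G))
      (extChartAt 𝓘(ℝ, E) (1 : G) 1, extChartAt 𝓘(ℝ, E) (1 : G) 1) := by
  rw [← contMDiffAt_iff_contDiffAt]
  have h1 : ContMDiffAt 𝓘(ℝ, E × E) 𝓘(ℝ, E) ∞
      (fun p : E × E => (extChartAt 𝓘(ℝ, E) (1 : G)).symm p.1)
      (extChartAt 𝓘(ℝ, E) (1 : G) 1, extChartAt 𝓘(ℝ, E) (1 : G) 1) :=
    ContMDiffAt.comp (x := (extChartAt 𝓘(ℝ, E) (1 : G) 1, extChartAt 𝓘(ℝ, E) (1 : G) 1))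
      (g := (extChartAt 𝓘(ℝ, E) (1 : G)).symm) (f := Prod.fst) (contMDiffAt_chart_symm (1 : G))
      contDiff_fst.contMDiff.contMDiffAt
  have h2 : ContMDiffAt 𝓘(ℝ, E × E) 𝓘(ℝ, E) ∞
      (fun p : E × E => (extChartAt 𝓘(ℝ, E) (1 : G)).symm p.2)
      (extChartAt 𝓘(ℝ, E) (1 : G) 1, extChartAt 𝓘(ℝ, E) (1 : G) 1) :=
    ContMDiffAt.comp (x := (extChartAt 𝓘(ℝ, E) (1 : G) 1, extChartAt 𝓘(ℝ, E) (1 : G) 1))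
      (g := (extChartAt 𝓘(ℝ, E) (1 : G)).symm) (f := Prod.snd) (contMDiffAt_chart_symm (1 : G))
      contDiff_snd.contMDiff.contMDiffAt
  refine ContMDiffAt.comp_of_eq (g := extChartAt 𝓘(ℝ, E) (1 : G)) (y := 1) contMDiffAt_extChartAt
    ((h1.mul h2).mul h1.inv) ?_
  simp

lemma adjointMap_chart_symm (a : E) :
    adjointMap E ((extChartAt 𝓘(ℝ, E) (1 : G)).symm a) =
      fderiv ℝ (chartConj E G a) (extChartAt 𝓘(ℝ, E) (1 : G) 1) := by
  rw [← der_eq_fderiv]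
  unfold chartConj
  have h1 : MDifferentiableAt 𝓘(ℝ, E) 𝓘(ℝ, E) (extChartAt 𝓘(ℝ, E) (1 : G)) 1 :=
    (contMDiffAt_extChartAt (n := ∞)).mdifferentiableAt (by simp)
  have h2 : MDifferentiableAt 𝓘(ℝ, E) 𝓘(ℝ, E) (extChartAt 𝓘(ℝ, E) (1 : G)).symm
      (extChartAt 𝓘(ℝ, E) (1 : G) 1) :=
    (contMDiffAt_chart_symm (1 : G)).mdifferentiableAt (by simp)
  set g := (extChartAt 𝓘(ℝ, E) (1 : G)).symm a
  have h3 := mdiff_conj (E := E) g 1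
  rw [der_comp (y := (1 : G)) (f := fun b => g * (extChartAt 𝓘(ℝ, E) (1 : G)).symm b * g⁻¹) h1 ?_
    (by simp), der_comp (f := (extChartAt 𝓘(ℝ, E) (1 : G)).symm) h3 h2 (by simp),
    der_extChartAt_self, der_extChartAt_symm_self]
  · rfl
  · exact (mdiff_conj (E := E) g _).comp (extChartAt 𝓘(ℝ, E) (1 : G) 1) h2

lemma contDiffAt_adjointMap_chart :
    ContDiffAt ℝ ∞ (fun a => adjointMap E ((extChartAt 𝓘(ℝ, E) (1 : G)).symm a))
      (extChartAt 𝓘(ℝ, E) (1 : G) 1) := by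
  simp_rw [adjointMap_chart_symm]
  exact contDiffAt_chartConj.fderiv contDiffAt_const (by simp)

/-- Near `1` the Adjoint action is a partial derivative of conjugation in the chart, a smooth
function of two variables. Multiplicativity, Ad(x) = Ad(g) Ad(g⁻¹x), carries smoothness from `1` to
any `g`. -/
lemma contMDiff_adjointMap : ContMDiff 𝓘(ℝ, E) 𝓘(ℝ, E →L[ℝ] E) ∞ (adjointMap E (G := G)) := by
  have h1 : ContMDiffAt 𝓘(ℝ, E) 𝓘(ℝ, E →L[ℝ] E) ∞ (adjointMap E (G := G)) 1 := by
    have h := contDiffAt_adjointMap_chart (E := E) (G := G).contMDiffAt.comp (1 : G)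
      (contMDiffAt_extChartAt (I := 𝓘(ℝ, E)))
    refine h.congr_of_eventuallyEq ?_
    filter_upwards [extChartAt_source_mem_nhds (I := 𝓘(ℝ, E)) (1 : G)] with g hg
    simp only [Function.comp_apply, (extChartAt 𝓘(ℝ, E) (1 : G)).left_inv hg]
  intro g
  have h2 : adjointMap E (G := G) = fun x => (adjointMap E g).comp (adjointMap E (g⁻¹ * x)) := by
    ext x : 1
    rw [← adjointMap_mul, mul_inv_cancel_left]
  rw [h2]
  have h3 : ContMDiffAt 𝓘(ℝ, E) 𝓘(ℝ, E →L[ℝ] E) ∞ (fun x => adjointMap E (g⁻¹ * x)) g :=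
    ContMDiffAt.comp_of_eq (g := adjointMap E (G := G)) h1
      (contMDiff_mul_left (I := 𝓘(ℝ, E)) (n := ∞) (a := g⁻¹)).contMDiffAt (by simp)
  exact contMDiffAt_const.clm_comp h3

lemma contMDiff_adjointMap_apply (Y : E) :
    ContMDiff 𝓘(ℝ, E) 𝓘(ℝ, E) ∞ (fun g : G => adjointMap E g Y) :=
  contMDiff_adjointMap.clm_apply contMDiff_const

/-- The derivative of the Adjoint action at the identity. -/
def adMap (E G : Type*) [NormedAddCommGroup E] [NormedSpace ℝ E]
    [TopologicalSpace G] [ChartedSpace E G] [Group G] : E →L[ℝ] E →L[ℝ] E :=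
  der E (E →L[ℝ] E) (adjointMap E (G := G)) 1

lemma adMap_apply (X Y : E) :
    adMap E G X Y = der E E (fun g : G => adjointMap E g Y) 1 X := by
  have h := der_comp_apply (g := fun T : E →L[ℝ] E => T Y) (f := adjointMap E (G := G)) (x := 1)
    (y := adjointMap E 1) (E := E) (E₁ := E →L[ℝ] E) (E₂ := E)
    ((ContinuousLinearMap.apply ℝ E Y).differentiable.mdifferentiable _)
    (contMDiff_adjointMap.mdifferentiable (by simp) 1) rfl X
  rw [h, adMap, der_eq_fderiv]
  have : fderiv ℝ (fun T : E →L[ℝ] E => T Y) (adjointMap E (1 : G)) =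
      ContinuousLinearMap.apply ℝ E Y := (ContinuousLinearMap.apply ℝ E Y).fderiv
  rw [this]; rfl

end LieGroup

end CartanTractor
end

noncomputable section

namespace CartanTractor

lemma two_le_infty : (2 : WithTop ℕ∞) ≤ ∞ := WithTop.coe_le_coe.2 le_top

/-! ### The bracket is the derivative of the Adjoint action. -/

section LieBracket

variable {E : Type*} [NormedAddCommGroup E] [NormedSpace ℝ E]
  {G : Type*} [TopologicalSpace G] [ChartedSpace E G] [Group G] [LieGroup 𝓘(ℝ, E) ∞ G]

/-- The Lie bracket of the Lie algebra of `G`, on the model vector space. -/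
def lieBr (G : Type*) [TopologicalSpace G] [ChartedSpace E G] [Group G] (X Y : E) : E :=
  Bracket.bracket (L := GroupLieAlgebra 𝓘(ℝ, E) G) (M := GroupLieAlgebra 𝓘(ℝ, E) G) X Y

/-- A left-invariant vector field in the chart at the identity. -/
def chartField (G : Type*) [TopologicalSpace G] [ChartedSpace E G] [Group G] (X : E) (a : E) : E :=
  VectorField.mpullbackWithin 𝓘(ℝ, E) 𝓘(ℝ, E) (extChartAt 𝓘(ℝ, E) (1 : G)).symm
      (mulInvariantVectorField (G := G) (I := 𝓘(ℝ, E)) X) (range 𝓘(ℝ, E)) a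

/-- The chart at `1` has the identity as its derivative there, so the bracket of left-invariant
fields at `1` is the flat bracket of their chart expressions. -/
lemma lieBr_eq_chart (X Y : E) :
    lieBr G X Y = fderiv ℝ (chartField G Y) (extChartAt 𝓘(ℝ, E) (1 : G) 1)
        (chartField G X (extChartAt 𝓘(ℝ, E) (1 : G) 1)) -
      fderiv ℝ (chartField G X) (extChartAt 𝓘(ℝ, E) (1 : G) 1)
        (chartField G Y (extChartAt 𝓘(ℝ, E) (1 : G) 1)) := by
  have h1 : mfderiv 𝓘(ℝ, E) 𝓘(ℝ, E) (extChartAt 𝓘(ℝ, E) (1 : G)) 1 =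
    ContinuousLinearMap.id ℝ _ := mfderiv_extChartAt_self
  have h2 : lieBr G X Y = (mfderiv 𝓘(ℝ, E) 𝓘(ℝ, E) (extChartAt 𝓘(ℝ, E) (1 : G)) 1).inverse
    (VectorField.lieBracketWithin ℝ (E := E) (chartField G X) (chartField G Y)
      ((extChartAt 𝓘(ℝ, E) (1 : G)).symm ⁻¹' univ ∩ range 𝓘(ℝ, E))
      (extChartAt 𝓘(ℝ, E) (1 : G) 1)) := rfl
  rw [h2, h1, preimage_univ, univ_inter,
    ModelWithCorners.range_eq_univ, VectorField.lieBracketWithin_univ]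
  exact congrArg (fun T : E →L[ℝ] E => T _) (ContinuousLinearMap.inverse_id (R := ℝ) (M := E))

lemma chartField_eq {a : E} (ha : a ∈ (extChartAt 𝓘(ℝ, E) (1 : G)).target) (X : E) :
    chartField G X a =
      der E E (extChartAt 𝓘(ℝ, E) (1 : G)) ((extChartAt 𝓘(ℝ, E) (1 : G)).symm a)
        (der E E (fun h : G => (extChartAt 𝓘(ℝ, E) (1 : G)).symm a * h) 1 X) := by
  have h := ContinuousLinearMap.inverse_eq
    (mfderivWithin_extChartAt_symm_comp_mfderiv_extChartAt (I := 𝓘(ℝ, E)) ha)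
    (mfderiv_extChartAt_comp_mfderivWithin_extChartAt_symm (I := 𝓘(ℝ, E)) ha)
  exact congrArg (fun T : E →L[ℝ] E => T _) h

/-- Since gh = (g h g⁻¹) g, a left-invariant field at `g` is the right-invariant field of Ad(g)X. -/
lemma der_mul_left_eq (g : G) (X : E) :
    der E E (fun h : G => g * h) 1 X = der E E (fun h : G => h * g) 1 (adjointMap E g X) := by
  have h : (fun h : G => g * h) = fun h => (g * h * g⁻¹) * g := by ext; group
  rw [h, der_comp_apply (g := fun h : G => h * g) (f := fun h => g * h * g⁻¹)
    (mdiff_mul_right g 1) (mdiff_conj g 1) (by group)]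
  rfl

lemma eventually_chartMul : ∀ᶠ a in 𝓝 (extChartAt 𝓘(ℝ, E) (1 : G) 1),
    a ∈ (extChartAt 𝓘(ℝ, E) (1 : G)).target ∧
    DifferentiableAt ℝ (chartMul E G) (a, extChartAt 𝓘(ℝ, E) (1 : G) 1) ∧
    DifferentiableAt ℝ (chartMul E G) (extChartAt 𝓘(ℝ, E) (1 : G) 1, a) := by
  have h := ((contDiffAt_chartMul (E := E) (G := G)).of_le
    (m := 1) (by exact_mod_cast le_top)).eventually (by simp)
  set e := extChartAt 𝓘(ℝ, E) (1 : G) 1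
  have c1 : Tendsto (fun a : E => (a, e)) (𝓝 e) (𝓝 (e, e)) :=
    Continuous.tendsto (by fun_prop) e
  have c2 : Tendsto (fun a : E => (e, a)) (𝓝 e) (𝓝 (e, e)) :=
    Continuous.tendsto (by fun_prop) e
  filter_upwards [extChartAt_target_mem_nhds (1 : G), c1.eventually h, c2.eventually h]
    with a h1 h2 h3
  exact ⟨h1, h2.differentiableAt (by simp), h3.differentiableAt (by simp)⟩

lemma fderiv_partial_snd {F₁ F₂ F₃ : Type*} [NormedAddCommGroup F₁] [NormedSpace ℝ F₁]
    [NormedAddCommGroup F₂] [NormedSpace ℝ F₂] [NormedAddCommGroup F₃] [NormedSpace ℝ F₃]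
    {f : F₁ × F₂ → F₃} {a : F₁} {b : F₂} (h : DifferentiableAt ℝ f (a, b)) (v : F₂) :
    fderiv ℝ (fun y => f (a, y)) b v = fderiv ℝ f (a, b) (0, v) := by
  have := h.hasFDerivAt.comp b (hasFDerivAt_prodMk_right a b)
  rw [show (fun y => f (a, y)) = f ∘ (fun y => (a, y)) from rfl, this.fderiv]
  simp

lemma fderiv_partial_fst {F₁ F₂ F₃ : Type*} [NormedAddCommGroup F₁] [NormedSpace ℝ F₁]
    [NormedAddCommGroup F₂] [NormedSpace ℝ F₂] [NormedAddCommGroup F₃] [NormedSpace ℝ F₃]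
    {f : F₁ × F₂ → F₃} {a : F₁} {b : F₂} (h : DifferentiableAt ℝ f (a, b)) (v : F₁) :
    fderiv ℝ (fun x => f (x, b)) a v = fderiv ℝ f (a, b) (v, 0) := by
  have := HasFDerivAt.comp (f := fun x : F₁ => (x, b)) a h.hasFDerivAt (hasFDerivAt_prodMk_left a b)
  rw [show (fun x => f (x, b)) = f ∘ (fun x => (x, b)) from rfl, this.fderiv]
  simp

lemma mdiff_chart {x : G} (hx : x ∈ (extChartAt 𝓘(ℝ, E) (1 : G)).source) :
    MDifferentiableAt 𝓘(ℝ, E) 𝓘(ℝ, E) (extChartAt 𝓘(ℝ, E) (1 : G)) x :=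
  mdifferentiableAt_extChartAt (by simpa using hx)

lemma mdiff_chart_symm_self :
    MDifferentiableAt 𝓘(ℝ, E) 𝓘(ℝ, E) (extChartAt 𝓘(ℝ, E) (1 : G)).symm
      (extChartAt 𝓘(ℝ, E) (1 : G) 1) :=
  (contMDiffAt_chart_symm (1 : G)).mdifferentiableAt (by simp)

lemma fderiv_chartMul_snd {a : E} (ha : a ∈ (extChartAt 𝓘(ℝ, E) (1 : G)).target)
    (hd : DifferentiableAt ℝ (chartMul E G) (a, extChartAt 𝓘(ℝ, E) (1 : G) 1)) (X : E) :
    fderiv ℝ (chartMul E G) (a, extChartAt 𝓘(ℝ, E) (1 : G) 1) (0, X) =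
      der E E (extChartAt 𝓘(ℝ, E) (1 : G)) ((extChartAt 𝓘(ℝ, E) (1 : G)).symm a)
        (der E E (fun h : G => (extChartAt 𝓘(ℝ, E) (1 : G)).symm a * h) 1 X) := by
  rw [← fderiv_partial_snd hd, ← der_eq_fderiv]
  unfold chartMul
  have hs := (extChartAt 𝓘(ℝ, E) (1 : G)).map_target ha
  set g := (extChartAt 𝓘(ℝ, E) (1 : G)).symm a
  have h1 : MDifferentiableAt 𝓘(ℝ, E) 𝓘(ℝ, E)
      (fun y => g * (extChartAt 𝓘(ℝ, E) (1 : G)).symm y) (extChartAt 𝓘(ℝ, E) (1 : G) 1) :=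
    (mdiff_mul_left (E := E) g _).comp (extChartAt 𝓘(ℝ, E) (1 : G) 1) mdiff_chart_symm_self
  rw [der_comp_apply (y := g) (f := fun y => g * (extChartAt 𝓘(ℝ, E) (1 : G)).symm y)
    (mdiff_chart hs) h1 (by simp), der_comp_apply (f := (extChartAt 𝓘(ℝ, E) (1 : G)).symm)
    (mdiff_mul_left g 1) mdiff_chart_symm_self (by simp), der_extChartAt_symm_self]
  rfl

lemma fderiv_chartMul_fst {a : E} (ha : a ∈ (extChartAt 𝓘(ℝ, E) (1 : G)).target)
    (hd : DifferentiableAt ℝ (chartMul E G) (extChartAt 𝓘(ℝ, E) (1 : G) 1, a)) (X : E) :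
    fderiv ℝ (chartMul E G) (extChartAt 𝓘(ℝ, E) (1 : G) 1, a) (X, 0) =
      der E E (extChartAt 𝓘(ℝ, E) (1 : G)) ((extChartAt 𝓘(ℝ, E) (1 : G)).symm a)
        (der E E (fun h : G => h * (extChartAt 𝓘(ℝ, E) (1 : G)).symm a) 1 X) := by
  rw [← fderiv_partial_fst hd, ← der_eq_fderiv]
  unfold chartMul
  have hs := (extChartAt 𝓘(ℝ, E) (1 : G)).map_target ha
  set g := (extChartAt 𝓘(ℝ, E) (1 : G)).symm a
  have h1 : MDifferentiableAt 𝓘(ℝ, E) 𝓘(ℝ, E)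
      (fun y => (extChartAt 𝓘(ℝ, E) (1 : G)).symm y * g) (extChartAt 𝓘(ℝ, E) (1 : G) 1) :=
    (mdiff_mul_right (E := E) g _).comp (extChartAt 𝓘(ℝ, E) (1 : G) 1) mdiff_chart_symm_self
  rw [der_comp_apply (y := g) (f := fun y => (extChartAt 𝓘(ℝ, E) (1 : G)).symm y * g)
    (mdiff_chart hs) h1 (by simp), der_comp_apply (f := (extChartAt 𝓘(ℝ, E) (1 : G)).symm)
    (mdiff_mul_right g 1) mdiff_chart_symm_self (by simp), der_extChartAt_symm_self]
  rfl

lemma chartField_self (X : E) :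
    chartField G X (extChartAt 𝓘(ℝ, E) (1 : G) 1) = X := by
  rw [chartField_eq (mem_extChartAt_target 1), extChartAt_to_inv, der_extChartAt_self]
  simp only [one_mul, der_id]
  rfl

/-- With m the multiplication in the chart, the field is a ↦ ∂₂m(a, e) Y near e; only the base point
varies. -/
lemma fderiv_chartField_left (X Y : E) :
    fderiv ℝ (chartField G Y) (extChartAt 𝓘(ℝ, E) (1 : G) 1) X =
      fderiv ℝ (fderiv ℝ (chartMul E G))
        (extChartAt 𝓘(ℝ, E) (1 : G) 1, extChartAt 𝓘(ℝ, E) (1 : G) 1) (X, 0) (0, Y) := by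
  set e := extChartAt 𝓘(ℝ, E) (1 : G) 1 with he
  have h1 : chartField G Y =ᶠ[𝓝 e] fun a => fderiv ℝ (chartMul E G) (a, e) (0, Y) := by
    filter_upwards [eventually_chartMul (E := E) (G := G)] with a ha
    rw [chartField_eq ha.1, fderiv_chartMul_snd ha.1 ha.2.1]
  have h2 : DifferentiableAt ℝ (fderiv ℝ (chartMul E G)) (e, e) :=
    ((contDiffAt_chartMul (E := E) (G := G)).fderiv_right (m := 1)
      (by rw [one_add_one_eq_two]; exact two_le_infty)).differentiableAt (by simp)
  rw [h1.fderiv_eq]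
  have h3 := (HasFDerivAt.comp (f := fun x : E => (x, e)) e h2.hasFDerivAt
    (hasFDerivAt_prodMk_left e e)).clm_apply
    (hasFDerivAt_const ((0, Y) : E × E) e)
  have h4 := h3.fderiv
  simp only [Function.comp_def] at h4
  rw [h4]
  simp

/-- The same field is also a ↦ ∂₁m(e, a) (Ad(a)Y), by `der_mul_left_eq`; the product rule adds the
derivative of Ad. -/
lemma fderiv_chartField_right (X Y : E) :
    fderiv ℝ (chartField G Y) (extChartAt 𝓘(ℝ, E) (1 : G) 1) X =
      fderiv ℝ (fderiv ℝ (chartMul E G))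
        (extChartAt 𝓘(ℝ, E) (1 : G) 1, extChartAt 𝓘(ℝ, E) (1 : G) 1) (0, X) (Y, 0) +
        adMap E G X Y := by
  set e := extChartAt 𝓘(ℝ, E) (1 : G) 1 with he
  set A : E → E := fun a => adjointMap E ((extChartAt 𝓘(ℝ, E) (1 : G)).symm a) Y
  have h1 : chartField G Y =ᶠ[𝓝 e] fun a => fderiv ℝ (chartMul E G) (e, a) (A a, 0) := by
    filter_upwards [eventually_chartMul (E := E) (G := G)] with a ha
    rw [chartField_eq ha.1, fderiv_chartMul_fst ha.1 ha.2.2, der_mul_left_eq]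
  have h2 : DifferentiableAt ℝ (fderiv ℝ (chartMul E G)) (e, e) :=
    ((contDiffAt_chartMul (E := E) (G := G)).fderiv_right (m := 1)
      (by rw [one_add_one_eq_two]; exact two_le_infty)).differentiableAt (by simp)
  have hA : MDifferentiableAt 𝓘(ℝ, E) 𝓘(ℝ, E) A e :=
    ((contMDiff_adjointMap_apply (G := G) Y).mdifferentiable (by simp) _).comp e
      mdiff_chart_symm_self
  have hA' : HasFDerivAt A (adMap E G |>.flip Y) e := by
    have := hasFDerivAt_der hA
    convert! this using 1
    ext v
    rw [der_comp_apply (g := fun g : G => adjointMap E g Y)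
      (f := (extChartAt 𝓘(ℝ, E) (1 : G)).symm) (y := 1)
      ((contMDiff_adjointMap_apply (G := G) Y).mdifferentiable (by simp) _)
      mdiff_chart_symm_self (by simp), der_extChartAt_symm_self, ← adMap_apply]
    rfl
  have hA1 : A e = Y := by
    simp only [A, he, extChartAt_to_inv, adjointMap_one]
    rfl
  rw [h1.fderiv_eq]
  have h3 := (h2.hasFDerivAt.comp e (hasFDerivAt_prodMk_right e e)).clm_apply
    (hA'.prodMk (hasFDerivAt_const (0 : E) e))
  have h4 := h3.fderiv
  simp only [Function.comp_def] at h4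
  rw [h4]
  have h5 := fderiv_chartMul_fst (G := G) (mem_extChartAt_target (I := 𝓘(ℝ, E)) (1 : G))
    (contDiffAt_chartMul.differentiableAt (by simp)) (adMap E G X Y)
  rw [extChartAt_to_inv, der_extChartAt_self, ← he] at h5
  simp only [mul_one, der_id, ContinuousLinearMap.id_apply] at h5
  simp [hA1, h5, add_comm]

/-- One field is differentiated in its left and the other in its right form. The second derivatives
of multiplication then cancel by symmetry, and only the derivative of Ad remains. -/
lemma lieBr_eq_adMap (X Y : E) : lieBr G X Y = adMap E G X Y := by
  rw [lieBr_eq_chart, chartField_self, chartField_self, fderiv_chartField_right X Y,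
    fderiv_chartField_left Y X]
  have hs : IsSymmSndFDerivAt ℝ (chartMul E G)
      (extChartAt 𝓘(ℝ, E) (1 : G) 1, extChartAt 𝓘(ℝ, E) (1 : G) 1) :=
    contDiffAt_chartMul.isSymmSndFDerivAt (by simpa using two_le_infty)
  rw [hs.eq (Y, 0) (0, X)]
  abel

lemma adMap_swap (X Y : E) : adMap E G X Y = - adMap E G Y X := by
  rw [← lieBr_eq_adMap, ← lieBr_eq_adMap, lieBr_eq_chart, lieBr_eq_chart, neg_sub]

lemma adMap_self (X : E) : adMap E G X X = 0 := by
  rw [← lieBr_eq_adMap, lieBr_eq_chart, sub_self]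

/-- Differentiate Ad(g) Ad(h) Y = Ad(g h g⁻¹) Ad(g) Y in `h` at `1`. -/
lemma adjointMap_adMap (g : G) (X Y : E) :
    adjointMap E g (adMap E G X Y) = adMap E G (adjointMap E g X) (adjointMap E g Y) := by
  rw [adMap_apply, adMap_apply]
  have hAd := fun Y : E => (contMDiff_adjointMap_apply (G := G) Y).mdifferentiable (by simp)
  have h1 := der_comp_apply (g := fun Z : E => adjointMap E g Z)
    (f := fun h : G => adjointMap E h Y) (x := 1) (y := adjointMap E 1 Y)
    (E := E) (E₁ := E) (E₂ := E) ((adjointMap E g).differentiable.mdifferentiable _)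
    (hAd Y 1) rfl X
  have h2 := der_comp_apply (g := fun h : G => adjointMap E h (adjointMap E g Y))
    (f := fun h : G => g * h * g⁻¹) (x := 1) (y := 1)
    (E := E) (E₁ := E) (E₂ := E) (hAd _ 1) (mdiff_conj g 1) (by simp) X
  rw [der_eq_fderiv (fun Z : E => adjointMap E g Z), ContinuousLinearMap.fderiv] at h1
  rw [← h1, show adjointMap E g X = der E E (fun h : G => g * h * g⁻¹) 1 X from rfl, ← h2]
  congr 2
  ext h
  rw [adjointMap_mul_apply, adjointMap_mul_apply, adjointMap_inv_apply_self]

end LieBracket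

end CartanTractor
end

noncomputable section

namespace CartanTractor

/-! ### Calculus of the left logarithmic derivative. -/

section LogVelocity

variable {E : Type*} [NormedAddCommGroup E] [NormedSpace ℝ E]
  {G : Type*} [TopologicalSpace G] [ChartedSpace E G] [Group G] [LieGroup 𝓘(ℝ, E) ∞ G]

/-- The left logarithmic derivative of a curve in a Lie group. -/
def logVel (E : Type*) [NormedAddCommGroup E] [NormedSpace ℝ E]
    {G : Type*} [TopologicalSpace G] [ChartedSpace E G] [Group G] (c : ℝ → G) (t : ℝ) : E :=
  der ℝ E (fun s => (c t)⁻¹ * c s) t 1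

lemma mdiff_translate {c : ℝ → G} {t : ℝ} (hc : MDifferentiableAt 𝓘(ℝ, ℝ) 𝓘(ℝ, E) c t) (g : G) :
    MDifferentiableAt 𝓘(ℝ, ℝ) 𝓘(ℝ, E) (fun s => g * c s) t :=
  (mdiff_mul_left (E := E) g (c t)).comp t hc

lemma der_eq_logVel {c : ℝ → G} {t : ℝ} (hc : MDifferentiableAt 𝓘(ℝ, ℝ) 𝓘(ℝ, E) c t) :
    der ℝ E c t 1 = der E E (fun h : G => c t * h) 1 (logVel E c t) := by
  have h : c = fun s => c t * ((c t)⁻¹ * c s) := by ext; simp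
  conv_lhs => rw [h]
  exact der_comp_apply (mdiff_mul_left (c t) 1) (mdiff_translate hc _) (by simp) 1

lemma logVel_eq {c : ℝ → G} {t : ℝ} (hc : MDifferentiableAt 𝓘(ℝ, ℝ) 𝓘(ℝ, E) c t) :
    logVel E c t = der E E (fun h : G => (c t)⁻¹ * h) (c t) (der ℝ E c t 1) :=
  der_comp_apply (mdiff_mul_left _ _) hc rfl 1

/-- Writing Ad(c(s)) = Ad(c(t)) Ad(c(t)⁻¹c(s)) reduces the derivative to that of Ad at the identity.
-/
lemma hasDerivAt_adjointMap {c : ℝ → G} {t : ℝ} (hc : MDifferentiableAt 𝓘(ℝ, ℝ) 𝓘(ℝ, E) c t)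
    (Y : E) :
    HasDerivAt (fun s => adjointMap E (c s) Y)
      (adjointMap E (c t) (adMap E G (logVel E c t) Y)) t := by
  have h1 : MDifferentiableAt 𝓘(ℝ, ℝ) 𝓘(ℝ, E) (fun s => adjointMap E ((c t)⁻¹ * c s) Y) t :=
    ((contMDiff_adjointMap_apply (G := G) Y).mdifferentiable (by simp) _).comp t
      (mdiff_translate hc _)
  have h2 := hasDerivAt_der h1
  rw [der_comp_apply (g := fun g : G => adjointMap E g Y) (y := 1)
    ((contMDiff_adjointMap_apply (G := G) Y).mdifferentiable (by simp) _)
      (mdiff_translate hc _) (by simp), ← adMap_apply] at h2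
  refine (((adjointMap E (c t)).hasFDerivAt.comp_hasDerivAt t h2)).congr_of_eventuallyEq ?_
  refine Eventually.of_forall fun s => ?_
  simp only [Function.comp_apply]
  rw [← adjointMap_mul_apply, mul_inv_cancel_left]

lemma hasDerivAt_adjointMap_clm {c : ℝ → G} {t : ℝ}
    (hc : MDifferentiableAt 𝓘(ℝ, ℝ) 𝓘(ℝ, E) c t) :
    HasDerivAt (fun s => adjointMap E (c s))
      (deriv (fun s => adjointMap E (c s)) t) t := by
  have h1 : MDifferentiableAt 𝓘(ℝ, ℝ) 𝓘(ℝ, E →L[ℝ] E) (fun s => adjointMap E (c s)) t :=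
    (contMDiff_adjointMap.mdifferentiable (by simp) _).comp t hc
  exact h1.differentiableAt.hasDerivAt

lemma hasDerivAt_adjointMap_apply {c : ℝ → G} {t : ℝ}
    (hc : MDifferentiableAt 𝓘(ℝ, ℝ) 𝓘(ℝ, E) c t) {f : ℝ → E} {f' : E} (hf : HasDerivAt f f' t) :
    HasDerivAt (fun s => adjointMap E (c s) (f s))
      (adjointMap E (c t) (f' + adMap E G (logVel E c t) (f t))) t := by
  have h := (hasDerivAt_adjointMap_clm hc).clm_apply hf
  have h2 := (hasDerivAt_adjointMap_clm hc).clm_apply (hasDerivAt_const t (f t))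
  -- The operator derivative is only an abstract `deriv`; uniqueness of derivatives evaluates it at
  -- the vector needed.
  have h3 := h2.unique (hasDerivAt_adjointMap hc (f t))
  simp only [map_zero, add_zero] at h3
  rw [h3] at h
  rwa [map_add, add_comm]

lemma mdiff_inv {c : ℝ → G} {t : ℝ} (hc : MDifferentiableAt 𝓘(ℝ, ℝ) 𝓘(ℝ, E) c t) :
    MDifferentiableAt 𝓘(ℝ, ℝ) 𝓘(ℝ, E) (fun s => (c s)⁻¹) t :=
  ((contMDiff_inv 𝓘(ℝ, E) ∞).mdifferentiable (by simp) (c t)).comp t hc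

lemma logVel_inv {c : ℝ → G} {t : ℝ} (hc : MDifferentiableAt 𝓘(ℝ, ℝ) 𝓘(ℝ, E) c t) :
    logVel E (fun s => (c s)⁻¹) t = - adjointMap E (c t) (logVel E c t) := by
  have hi := mdiff_inv hc
  -- differentiate `c t * (c t)⁻¹ = 1`
  have h0 : der ℝ E (fun s => ((c t)⁻¹ * c s) * ((c s)⁻¹ * c t)) t 1 = 0 := by
    have : (fun s => ((c t)⁻¹ * c s) * ((c s)⁻¹ * c t)) = fun _ => (1 : G) := by
      ext; group
    rw [this, der_const]; rfl
  have hr : MDifferentiableAt 𝓘(ℝ, ℝ) 𝓘(ℝ, E) (fun s => (c s)⁻¹ * c t) t :=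
    (mdiff_mul_right (E := E) (c t) (c t)⁻¹).comp t hi
  rw [der_binary (F := fun a b : G => a * b) (f := fun s => (c t)⁻¹ * c s)
    (g := fun s => (c s)⁻¹ * c t) (a := 1) (b := 1) (mdiff_mul _) (mdiff_translate hc _) hr
    (by simp) (by simp)] at h0
  simp only [mul_one, one_mul, der_id, ContinuousLinearMap.id_apply] at h0
  have h1 : der ℝ E (fun s => ((c t)⁻¹)⁻¹ * (c s)⁻¹) t 1 =
      adjointMap E (c t) (der ℝ E (fun s => (c s)⁻¹ * c t) t 1) := by
    have : (fun s => ((c t)⁻¹)⁻¹ * (c s)⁻¹) = fun s => c t * ((c s)⁻¹ * c t) * (c t)⁻¹ := by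
      ext; group
    rw [this]
    exact der_comp_apply (g := fun x => c t * x * (c t)⁻¹) (mdiff_conj _ 1) hr (by simp) 1
  have h2 : logVel E (fun s => (c s)⁻¹) t = der ℝ E (fun s => ((c t)⁻¹)⁻¹ * (c s)⁻¹) t 1 := rfl
  rw [h2, h1, ← map_neg]
  congr 1
  exact (neg_eq_of_add_eq_zero_right h0).symm

lemma hasDerivAt_adjointMap_inv_apply {c : ℝ → G} {t : ℝ}
    (hc : MDifferentiableAt 𝓘(ℝ, ℝ) 𝓘(ℝ, E) c t) {f : ℝ → E} {f' : E} (hf : HasDerivAt f f' t) :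
    HasDerivAt (fun s => adjointMap E (c s)⁻¹ (f s))
      (adjointMap E (c t)⁻¹ f' - adMap E G (logVel E c t) (adjointMap E (c t)⁻¹ (f t))) t := by
  have h := hasDerivAt_adjointMap_apply (mdiff_inv hc) hf
  convert h using 1
  rw [map_add, adjointMap_adMap, logVel_inv hc, map_neg, adjointMap_inv_apply_self, map_neg,
    neg_apply, sub_eq_add_neg]

lemma logVel_comp {c : ℝ → G} {φ : ℝ → ℝ} {t : ℝ}
    (hc : MDifferentiableAt 𝓘(ℝ, ℝ) 𝓘(ℝ, E) c (φ t)) (hφ : DifferentiableAt ℝ φ t) :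
    logVel E (fun s => c (φ s)) t = deriv φ t • logVel E c (φ t) := by
  unfold logVel
  rw [der_comp_apply (g := fun s => (c (φ t))⁻¹ * c s) (y := φ t) (mdiff_translate hc _)
    hφ.mdifferentiableAt rfl, hφ.hasDerivAt.der_apply, one_smul, ← map_smul, smul_eq_mul, mul_one]

/-- With both factors translated to pass through `1` at time t, the derivative of the product is the
sum of the derivatives; moving the first factor past d(t) conjugates it. -/
lemma logVel_mul {c d : ℝ → G} {t : ℝ} (hc : MDifferentiableAt 𝓘(ℝ, ℝ) 𝓘(ℝ, E) c t)
    (hd : MDifferentiableAt 𝓘(ℝ, ℝ) 𝓘(ℝ, E) d t) :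
    logVel E (fun s => c s * d s) t = adjointMap E (d t)⁻¹ (logVel E c t) + logVel E d t := by
  unfold logVel
  have h : (fun s => (c t * d t)⁻¹ * (c s * d s)) =
      fun s => ((d t)⁻¹ * ((c t)⁻¹ * c s) * ((d t)⁻¹)⁻¹) * ((d t)⁻¹ * d s) := by
    ext; group
  have h1 : MDifferentiableAt 𝓘(ℝ, ℝ) 𝓘(ℝ, E)
      (fun s => (d t)⁻¹ * ((c t)⁻¹ * c s) * ((d t)⁻¹)⁻¹) t :=
    (mdiff_conj (E := E) (d t)⁻¹ _).comp t (mdiff_translate hc _)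
  rw [h, der_binary (F := fun a b : G => a * b)
    (f := fun s => (d t)⁻¹ * ((c t)⁻¹ * c s) * ((d t)⁻¹)⁻¹)
    (g := fun s => (d t)⁻¹ * d s) (a := 1) (b := 1) (mdiff_mul _) h1 (mdiff_translate hd _)
    (by simp) (by simp)]
  simp only [mul_one, one_mul, der_id, ContinuousLinearMap.id_apply]
  congr 1
  exact der_comp_apply (g := fun x => (d t)⁻¹ * x * ((d t)⁻¹)⁻¹) (mdiff_conj _ 1)
    (mdiff_translate hc _) (by simp) 1

end LogVelocity

/-! ### The Lie algebra of a closed subgroup. -/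

section Subgroup

variable {EG EP : Type*} [NormedAddCommGroup EG] [NormedSpace ℝ EG]
  [NormedAddCommGroup EP] [NormedSpace ℝ EP] [FiniteDimensional ℝ EG] [FiniteDimensional ℝ EP]
  {G : Type*} [TopologicalSpace G] [ChartedSpace EG G] [Group G] [LieGroup 𝓘(ℝ, EG) ∞ G]
  {P : Subgroup G} [ChartedSpace EP P] [LieGroup 𝓘(ℝ, EP) ∞ P]

/-- The differential at the identity of the inclusion of a subgroup. -/
def inclMap (EG EP : Type*) [NormedAddCommGroup EG] [NormedSpace ℝ EG]
    [NormedAddCommGroup EP] [NormedSpace ℝ EP]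
    {G : Type*} [TopologicalSpace G] [ChartedSpace EG G] [Group G]
    (P : Subgroup G) [ChartedSpace EP P] : EP →L[ℝ] EG :=
  der EP EG (fun p : P => (p : G)) 1

/-- The Lie algebra of a subgroup. -/
def subLie (EG EP : Type*) [NormedAddCommGroup EG] [NormedSpace ℝ EG]
    [NormedAddCommGroup EP] [NormedSpace ℝ EP]
    {G : Type*} [TopologicalSpace G] [ChartedSpace EG G] [Group G]
    (P : Subgroup G) [ChartedSpace EP P] : Submodule ℝ EG :=
  LinearMap.range (inclMap EG EP P).toLinearMap

namespace IsClosedLieSubgroup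

variable (hP : IsClosedLieSubgroup EG EP P)
include hP

lemma mdiff (p : P) : MDifferentiableAt 𝓘(ℝ, EP) 𝓘(ℝ, EG) (fun p : P => (p : G)) p :=
  hP.contMDiff_subtype.mdifferentiable (by simp) p

lemma adjointMap_inclMap (p : P) (X : EP) :
    adjointMap EG (p : G) (inclMap EG EP P X) = inclMap EG EP P (adjointMap EP p X) := by
  have h1 := der_comp_apply (g := fun x : G => (p : G) * x * (p : G)⁻¹)
    (f := fun q : P => (q : G)) (x := 1) (y := 1) (mdiff_conj _ 1) (hP.mdiff 1) rfl X
  have h2 := der_comp_apply (g := fun q : P => (q : G)) (f := fun q : P => p * q * p⁻¹)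
    (x := 1) (y := 1) (hP.mdiff 1) (mdiff_conj p 1) (by simp) X
  exact h1.symm.trans h2

lemma adjointMap_mem (p : P) {X : EG} (hX : X ∈ subLie EG EP P) :
    adjointMap EG (p : G) X ∈ subLie EG EP P := by
  obtain ⟨Y, rfl⟩ := hX
  exact ⟨_, (hP.adjointMap_inclMap p Y).symm⟩

/-- For q in P, Ad(q) applied to an element of 𝔭 is the inclusion of a smooth curve in the model
space of P; its derivative at `1` is again in the image of the inclusion. -/
lemma adMap_mem {X Y : EG} (hX : X ∈ subLie EG EP P) (hY : Y ∈ subLie EG EP P) :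
    adMap EG G X Y ∈ subLie EG EP P := by
  obtain ⟨X, rfl⟩ := hX
  obtain ⟨Y, rfl⟩ := hY
  change adMap EG G (inclMap EG EP P X) (inclMap EG EP P Y) ∈ _
  rw [adMap_apply]
  have h1 := der_comp_apply (g := fun g : G => adjointMap EG g (inclMap EG EP P Y))
    (f := fun q : P => (q : G)) (x := 1) (y := 1)
    ((contMDiff_adjointMap_apply _).mdifferentiable (by simp) _) (hP.mdiff 1) rfl X
  rw [show inclMap EG EP P X = der EP EG (fun q : P => (q : G)) 1 X from rfl, ← h1]
  simp only [hP.adjointMap_inclMap]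
  have h2 := der_comp_apply (g := fun Z : EP => inclMap EG EP P Z)
    (f := fun q : P => adjointMap EP q Y) (x := 1) (y := adjointMap EP 1 Y)
    ((inclMap EG EP P).differentiable.mdifferentiable _)
    ((contMDiff_adjointMap_apply (G := P) _).mdifferentiable (by simp) _) rfl X
  rw [h2, der_eq_fderiv, ContinuousLinearMap.fderiv]
  exact ⟨_, rfl⟩

lemma logVel_coe {p : ℝ → P} {t : ℝ} (hp : MDifferentiableAt 𝓘(ℝ, ℝ) 𝓘(ℝ, EP) p t) :
    logVel EG (fun s => (p s : G)) t = inclMap EG EP P (logVel EP p t) :=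
  der_comp_apply (g := fun q : P => (q : G)) (f := fun s => (p t)⁻¹ * p s)
    (hP.mdiff 1) (mdiff_translate hp _) (by simp) 1

lemma exists_leftInverse : ∃ L : EG →L[ℝ] EP, ∀ X, L (inclMap EG EP P X) = X := by
  obtain ⟨L, hL⟩ := (inclMap EG EP P).toLinearMap.exists_leftInverse_of_injective
    (LinearMap.ker_eq_bot.2 hP.injective_mfderiv)
  exact ⟨LinearMap.toContinuousLinearMap L, fun X => LinearMap.congr_fun hL X⟩

/-- Near the identity the chart of `P` extends to a smooth function on `G`. -/
lemma exists_retraction : ∃ r : G → EP, ContMDiffAt 𝓘(ℝ, EG) 𝓘(ℝ, EP) ∞ r 1 ∧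
    ∀ᶠ p : P in 𝓝 1, r p = extChartAt 𝓘(ℝ, EP) (1 : P) p := by
  obtain ⟨L, hL⟩ := hP.exists_leftInverse
  set e := extChartAt 𝓘(ℝ, EP) (1 : P) 1 with he
  -- The inclusion in charts, followed by a left inverse of its differential, has derivative the
  -- identity. Its local inverse, composed with `L` and the chart of G, is the retraction.
  set h : EP → EP := fun y =>
    L (extChartAt 𝓘(ℝ, EG) (1 : G) ((extChartAt 𝓘(ℝ, EP) (1 : P)).symm y : P)) with hh
  have hi : ContMDiffAt 𝓘(ℝ, EP) 𝓘(ℝ, EG) ∞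
      (fun y => (((extChartAt 𝓘(ℝ, EP) (1 : P)).symm y : P) : G)) e :=
    ContMDiffAt.comp (g := fun p : P => (p : G)) e hP.contMDiff_subtype.contMDiffAt
      (contMDiffAt_chart_symm (1 : P))
  have hc : ContMDiffAt 𝓘(ℝ, EP) 𝓘(ℝ, EG) ∞ (fun y =>
      extChartAt 𝓘(ℝ, EG) (1 : G) ((extChartAt 𝓘(ℝ, EP) (1 : P)).symm y : P)) e :=
    ContMDiffAt.comp_of_eq (g := extChartAt 𝓘(ℝ, EG) (1 : G)) (y := 1) contMDiffAt_extChartAt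
      hi (by simp [he])
  have hs : ContDiffAt ℝ ∞ h e := (L.contMDiff.contMDiffAt.comp e hc).contDiffAt
  have hd : HasFDerivAt h ((ContinuousLinearEquiv.refl ℝ EP : EP ≃L[ℝ] EP) : EP →L[ℝ] EP) e := by
    have h1 := hasFDerivAt_der (hs.contMDiffAt.mdifferentiableAt (by simp))
    convert! h1 using 1
    ext v
    rw [der_comp_apply (g := fun Z => L Z) (y := extChartAt 𝓘(ℝ, EG) (1 : G) 1)
      (L.differentiable.mdifferentiable _) (hc.mdifferentiableAt (by simp)) (by simp [he]),
      der_comp_apply (g := extChartAt 𝓘(ℝ, EG) (1 : G)) (y := 1)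
      (mdiff_chart (mem_extChartAt_source _)) (hi.mdifferentiableAt (by simp)) (by simp [he]),
      der_comp_apply (g := fun p : P => (p : G)) (y := 1) (hP.mdiff 1)
      mdiff_chart_symm_self (by simp), der_extChartAt_self, der_extChartAt_symm_self,
      der_eq_fderiv, ContinuousLinearMap.fderiv]
    exact (hL v).symm
  set k := hs.localInverse hd (by simp) with hk
  have hk1 : ContDiffAt ℝ ∞ k (h e) := hs.to_localInverse hd (by simp)
  have hk2 : ∀ᶠ y in 𝓝 e, k (h y) = y :=
    (hs.hasStrictFDerivAt' hd (by simp)).eventually_left_inverse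
  have hhe : h e = L (extChartAt 𝓘(ℝ, EG) (1 : G) 1) := by simp [hh, he]
  refine ⟨fun g => k (L (extChartAt 𝓘(ℝ, EG) (1 : G) g)), ?_, ?_⟩
  · refine ContMDiffAt.comp_of_eq (g := k) (y := h e) hk1.contMDiffAt ?_ hhe.symm
    exact L.contMDiff.contMDiffAt.comp (1 : G) contMDiffAt_extChartAt
  · have hcont : Tendsto (extChartAt 𝓘(ℝ, EP) (1 : P)) (𝓝 1) (𝓝 e) :=
      (continuousAt_extChartAt (I := 𝓘(ℝ, EP)) (1 : P))
    filter_upwards [hcont.eventually hk2, extChartAt_source_mem_nhds (I := 𝓘(ℝ, EP)) (1 : P)]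
      with p hp hp'
    simpa only [hh, (extChartAt 𝓘(ℝ, EP) (1 : P)).left_inv hp'] using hp

/-- A differentiable curve in `G` with values in `P` has its logarithmic derivative in the Lie
algebra of `P`. -/
lemma logVel_mem {c : ℝ → G} {t : ℝ} (hc : MDifferentiableAt 𝓘(ℝ, ℝ) 𝓘(ℝ, EG) c t)
    (hcP : ∀ᶠ s in 𝓝 t, c s ∈ P) : logVel EG c t ∈ subLie EG EP P := by
  classical
  obtain ⟨r, hr, hr'⟩ := hP.exists_retraction
  have ht := hcP.self_of_nhds
  set d : ℝ → P := fun s => if h : c s ∈ P then ⟨(c t)⁻¹ * c s, P.mul_mem (P.inv_mem ht) h⟩ else 1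
  have hd : ∀ᶠ s in 𝓝 t, (c t)⁻¹ * c s = d s := by
    filter_upwards [hcP] with s hs
    simp [d, hs]
  have hdt : d t = 1 := by
    have := hd.self_of_nhds
    ext; rw [← this]; simp
  have hmd := mdiff_translate hc (c t)⁻¹
  -- P has the subspace topology, so `d` tends to `1` inside P. Near `t` it is therefore recovered
  -- from its image in G by the retraction, which makes it differentiable as a curve in P.
  have hcont : Tendsto d (𝓝 t) (𝓝 1) := by
    rw [IsInducing.subtypeVal.tendsto_nhds_iff]
    have h1 : Tendsto (fun s => (c t)⁻¹ * c s) (𝓝 t) (𝓝 1) := by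
      simpa using hmd.continuousAt.tendsto
    exact h1.congr' hd
  have hd' : d =ᶠ[𝓝 t] fun s => (extChartAt 𝓘(ℝ, EP) (1 : P)).symm (r ((c t)⁻¹ * c s)) := by
    filter_upwards [hd, hcont.eventually hr', hcont.eventually
      (extChartAt_source_mem_nhds (I := 𝓘(ℝ, EP)) (1 : P))] with s h1 h2 h3
    rw [h1, h2, (extChartAt 𝓘(ℝ, EP) (1 : P)).left_inv h3]
  have hr1 : r 1 = extChartAt 𝓘(ℝ, EP) (1 : P) 1 := hr'.self_of_nhds
  have hdm : MDifferentiableAt 𝓘(ℝ, ℝ) 𝓘(ℝ, EP) d t := by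
    refine MDifferentiableAt.congr_of_eventuallyEq ?_ hd'
    have h1 : MDifferentiableAt 𝓘(ℝ, ℝ) 𝓘(ℝ, EP) (fun s => r ((c t)⁻¹ * c s)) t := by
      refine MDifferentiableAt.comp (I' := 𝓘(ℝ, EG)) (g := r) t ?_ hmd
      simpa using hr.mdifferentiableAt (by simp)
    refine MDifferentiableAt.comp (I' := 𝓘(ℝ, EP)) (g := (extChartAt 𝓘(ℝ, EP) (1 : P)).symm) t
      ?_ h1
    have : r ((c t)⁻¹ * c t) = extChartAt 𝓘(ℝ, EP) (1 : P) 1 := by simpa using hr1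
    rw [this]
    exact mdiff_chart_symm_self
  refine ⟨der ℝ EP d t 1, ?_⟩
  have h2 := der_comp_apply (g := fun q : P => (q : G)) (y := 1) (hP.mdiff 1) hdm hdt 1
  refine h2.symm.trans ?_
  rw [← der_congr hd]
  rfl

end IsClosedLieSubgroup

end Subgroup

end CartanTractor
end

noncomputable section

namespace CartanTractor

/-! ### Smoothness of the logarithmic derivative. -/

section LogVelocitySmooth

variable {E : Type*} [NormedAddCommGroup E] [NormedSpace ℝ E]
  {G : Type*} [TopologicalSpace G] [ChartedSpace E G] [Group G] [LieGroup 𝓘(ℝ, E) ∞ G]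

lemma eventually_mdiff {E' N : Type*} [NormedAddCommGroup E'] [NormedSpace ℝ E']
    [TopologicalSpace N] [ChartedSpace E' N] [IsManifold 𝓘(ℝ, E') ∞ N] {c : ℝ → N} {t : ℝ}
    (hc : ContMDiffAt 𝓘(ℝ, ℝ) 𝓘(ℝ, E') ∞ c t) :
    ∀ᶠ s in 𝓝 t, MDifferentiableAt 𝓘(ℝ, ℝ) 𝓘(ℝ, E') c s := by
  have h := (contMDiffAt_iff_contMDiffAt_nhds (n := 1) (by simp)).1 (hc.of_le (by simp))
  exact h.mono fun s hs => hs.mdifferentiableAt (by simp)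

/-- The logarithmic derivative is the second partial derivative, on the diagonal, of (s, s') ↦
c(s)⁻¹c(s'), which near (t, t) stays in the single chart at `1`. -/
lemma contDiffAt_logVel {c : ℝ → G} {t : ℝ} (hc : ContMDiffAt 𝓘(ℝ, ℝ) 𝓘(ℝ, E) ∞ c t) :
    ContDiffAt ℝ ∞ (logVel E c) t := by
  set ψ : ℝ → ℝ → E := fun s s' => extChartAt 𝓘(ℝ, E) (1 : G) ((c s)⁻¹ * c s')
  have hψ : ContDiffAt ℝ ∞ (Function.uncurry ψ) (t, t) := by
    rw [← contMDiffAt_iff_contDiffAt]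
    have h1 : ContMDiffAt 𝓘(ℝ, ℝ × ℝ) 𝓘(ℝ, E) ∞ (fun p : ℝ × ℝ => c p.1) (t, t) :=
      ContMDiffAt.comp (x := (t, t)) (g := c) (f := Prod.fst) hc
        contDiff_fst.contMDiff.contMDiffAt
    have h2 : ContMDiffAt 𝓘(ℝ, ℝ × ℝ) 𝓘(ℝ, E) ∞ (fun p : ℝ × ℝ => c p.2) (t, t) :=
      ContMDiffAt.comp (x := (t, t)) (g := c) (f := Prod.snd) hc
        contDiff_snd.contMDiff.contMDiffAt
    exact ContMDiffAt.comp_of_eq (g := extChartAt 𝓘(ℝ, E) (1 : G)) (y := 1)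
      contMDiffAt_extChartAt (h1.inv.mul h2) (by simp)
  have h1 : ContDiffAt ℝ ∞ (fun s => fderiv ℝ (ψ s) s 1) t :=
    (hψ.fderiv contDiffAt_id (by simp)).clm_apply contDiffAt_const
  refine h1.congr_of_eventuallyEq ?_
  filter_upwards [eventually_mdiff hc] with s hs
  rw [← der_eq_fderiv, der_comp_apply (g := extChartAt 𝓘(ℝ, E) (1 : G)) (y := 1)
    (mdiff_chart (mem_extChartAt_source _)) (mdiff_translate hs _)
    (by simp), der_extChartAt_self]
  rfl

end LogVelocitySmooth

/-! ### Linear algebra of a line plus a subspace. -/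

section Linear

lemma exists_clm_of_notMem {E : Type*} [NormedAddCommGroup E] [NormedSpace ℝ E]
    [FiniteDimensional ℝ E] {S : Submodule ℝ E} {x : E} (hx : x ∉ S) :
    ∃ f : E →L[ℝ] ℝ, f x ≠ 0 ∧ ∀ y ∈ S, f y = 0 := by
  obtain ⟨f, hf, hS⟩ := Submodule.exists_dual_map_eq_bot_of_notMem hx inferInstance
  refine ⟨LinearMap.toContinuousLinearMap f, hf, fun y hy => ?_⟩
  have : f y ∈ S.map f := ⟨y, hy, rfl⟩
  simpa [hS] using this

/-- A functional vanishing on `S` reads off the coefficient of `ξ`. The resulting formula can be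
differentiated along curves, unlike a mere choice of coefficients. -/
lemma sub_smul_mem_of_mem_span_sup {E : Type*} [AddCommGroup E] [Module ℝ E]
    {S : Submodule ℝ E} {x ξ : E} {f : E →ₗ[ℝ] ℝ} (hS : ∀ y ∈ S, f y = 0) (hξ : f ξ ≠ 0)
    (hx : x ∈ Submodule.span ℝ {ξ} ⊔ S) : x - (f x / f ξ) • ξ ∈ S := by
  obtain ⟨y, hy, z, hz, rfl⟩ := Submodule.mem_sup.1 hx
  obtain ⟨a, rfl⟩ := Submodule.mem_span_singleton.1 hy
  rw [map_add, hS z hz, add_zero, map_smul, smul_eq_mul, mul_div_assoc, div_self hξ, mul_one,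
    add_sub_cancel_left]
  exact hz

lemma mem_map_iff_of_injective {E F : Type*} [AddCommGroup E] [Module ℝ E] [AddCommGroup F]
    [Module ℝ F] {T : E →ₗ[ℝ] F} (hT : Function.Injective T) {x : E} {S : Submodule ℝ E} :
    T x ∈ S.map T ↔ x ∈ S :=
  hT.mem_set_image (s := (S : Set E))

/-- Difference quotients stay in the subspace, which is closed in finite dimension. -/
lemma _root_.HasDerivAt.mem_submodule {E : Type*} [NormedAddCommGroup E] [NormedSpace ℝ E]
    [FiniteDimensional ℝ E] {S : Submodule ℝ E} {f : ℝ → E} {f' : E} {t : ℝ}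
    (hf : HasDerivAt f f' t) (h : ∀ᶠ s in 𝓝 t, f s ∈ S) : f' ∈ S := by
  refine S.closed_of_finiteDimensional.mem_of_tendsto hf.tendsto_slope ?_
  filter_upwards [h.filter_mono nhdsWithin_le_nhds] with s hs
  exact S.smul_mem _ (S.sub_mem hs h.self_of_nhds)

lemma map_mem_span_sup_map_iff {E F : Type*} [AddCommGroup E] [Module ℝ E] [AddCommGroup F]
    [Module ℝ F] {T : E →ₗ[ℝ] F} (hT : Function.Injective T) {x v : E} {S : Submodule ℝ E} :
    T x ∈ Submodule.span ℝ {T v} ⊔ S.map T ↔ x ∈ Submodule.span ℝ {v} ⊔ S := by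
  rw [← Set.image_singleton, ← Submodule.map_span, ← Submodule.map_sup]
  exact mem_map_iff_of_injective hT

end Linear

/-! ### The symmetry algebra of the model curve. -/

section SymmetryAlgebra

variable {EG EP : Type*} [NormedAddCommGroup EG] [NormedSpace ℝ EG]
  [NormedAddCommGroup EP] [NormedSpace ℝ EP] [FiniteDimensional ℝ EG] [FiniteDimensional ℝ EP]
  {G : Type*} [TopologicalSpace G] [ChartedSpace EG G] [Group G] [LieGroup 𝓘(ℝ, EG) ∞ G]
  {P : Subgroup G} [ChartedSpace EP P] [LieGroup 𝓘(ℝ, EP) ∞ P]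

lemma der_mul_left_injective (g : G) :
    Function.Injective (der EG EG (fun h : G => g * h) 1) := by
  refine Function.LeftInverse.injective (g := der EG EG (fun h : G => g⁻¹ * h) g) fun X => ?_
  rw [← der_comp_apply (g := fun h : G => g⁻¹ * h) (mdiff_mul_left _ _) (mdiff_mul_left _ _)
    (by simp)]
  simp only [inv_mul_cancel_left, der_id]
  rfl

lemma infinitesimalAction_eq (g : G) (X : EG) :
    infinitesimalAction (EG := EG) g X = der EG EG (fun h : G => g * h) 1 (adjointMap EG g⁻¹ X) := by
  rw [der_mul_left_eq, adjointMap_apply_inv_self]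
  rfl

variable (EG EP) in
/-- The symmetry algebra, as a subspace of the model vector space. -/
def symAlg (P : Subgroup G) [ChartedSpace EP P] (ℓ : ℝ → G ⧸ P) (K : Set ℝ) : Submodule ℝ EG :=
  symmetryAlgebra EG EP P ℓ K

variable (hP : IsClosedLieSubgroup EG EP P)
include hP

lemma cosetTangent_eq (g : G) : (cosetTangent EP P g : Submodule ℝ EG) =
    (subLie EG EP P).map (der EG EG (fun h : G => g * h) 1).toLinearMap := by
  rw [subLie, ← LinearMap.range_comp]
  have h := der_comp (g := fun h : G => g * h) (f := fun p : P => (p : G)) (x := 1) (y := 1)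
    (mdiff_mul_left g 1) (hP.mdiff 1) rfl
  exact congrArg (fun T : EP →L[ℝ] EG => LinearMap.range T.toLinearMap) h

/-- Left translation by c(t)⁻¹ moves the tangency condition to the identity: Ad(c⁻¹)X lies in the
line of c⁻¹c' plus 𝔭. -/
lemma mem_symmetryAlgebra_iff {ℓ : ℝ → G ⧸ P} {K : Set ℝ} {X : EG} :
    X ∈ symAlg EG EP P ℓ K ↔ ∀ t ∈ K, ∀ c : ℝ → G, IsLiftAt EG P ℓ c t →
      adjointMap EG (c t)⁻¹ X ∈ Submodule.span ℝ {logVel EG c t} ⊔ subLie EG EP P := by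
  refine forall₄_congr fun t _ c hc => ?_
  rw [← map_mem_span_sup_map_iff (T := (der EG EG (fun h : G => c t * h) 1).toLinearMap)
    (der_mul_left_injective (c t)), ← cosetTangent_eq hP]
  rw [infinitesimalAction_eq]
  have := der_eq_logVel (hc.contMDiffAt.mdifferentiableAt (by simp))
  rw [velocity_eq_der, this]
  rfl

lemma velocity_mem_cosetTangent_iff {c : ℝ → G} {t : ℝ}
    (hc : MDifferentiableAt 𝓘(ℝ, ℝ) 𝓘(ℝ, EG) c t) :
    velocity EG c t ∈ cosetTangent EP P (c t) ↔ logVel EG c t ∈ subLie EG EP P := by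
  rw [velocity_eq_der, der_eq_logVel hc]
  rw [cosetTangent_eq hP]
  exact mem_map_iff_of_injective
    (T := (der EG EG (fun h : G => c t * h) 1).toLinearMap) (der_mul_left_injective (c t))

/-- The condition defining the symmetry algebra does not depend on the lift. -/
lemma adjointMap_inv_mem_of_lift {c d : ℝ → G} {t : ℝ} {X : EG}
    (hc : MDifferentiableAt 𝓘(ℝ, ℝ) 𝓘(ℝ, EG) c t) (hd : MDifferentiableAt 𝓘(ℝ, ℝ) 𝓘(ℝ, EG) d t)
    (h : ∀ᶠ s in 𝓝 t, (QuotientGroup.mk (c s) : G ⧸ P) = QuotientGroup.mk (d s))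
    (hX : adjointMap EG (c t)⁻¹ X ∈ Submodule.span ℝ {logVel EG c t} ⊔ subLie EG EP P) :
    adjointMap EG (d t)⁻¹ X ∈ Submodule.span ℝ {logVel EG d t} ⊔ subLie EG EP P := by
  -- Since d = cq with q in P, the logarithmic derivative of d is Ad(q⁻¹) of that of c, up to an
  -- element of 𝔭.
  set q : ℝ → G := fun s => (c s)⁻¹ * d s with hq
  have hqP : ∀ᶠ s in 𝓝 t, q s ∈ P := h.mono fun s hs => QuotientGroup.eq.1 hs
  have hqm : MDifferentiableAt 𝓘(ℝ, ℝ) 𝓘(ℝ, EG) q t :=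
    (mdiff_mul (E := EG) ((c t)⁻¹, d t)).comp t ((mdiff_inv hc).prodMk hd)
  have hdq : d = fun s => c s * q s := by ext; simp [hq]
  have hv : logVel EG d t = adjointMap EG (q t)⁻¹ (logVel EG c t) + logVel EG q t := by
    conv_lhs => rw [hdq]
    exact logVel_mul hc hqm
  have hqv := hP.logVel_mem hqm hqP
  obtain ⟨y, hy, z, hz, hyz⟩ := Submodule.mem_sup.1 hX
  obtain ⟨a, rfl⟩ := Submodule.mem_span_singleton.1 hy
  have hX' : adjointMap EG (d t)⁻¹ X = a • logVel EG d t +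
      (adjointMap EG (q t)⁻¹ z - a • logVel EG q t) := by
    have : (d t)⁻¹ = (q t)⁻¹ * (c t)⁻¹ := by simp [hq]
    rw [this, adjointMap_mul_apply, ← hyz, map_add, map_smul, hv, smul_add]
    abel
  rw [hX']
  refine Submodule.add_mem_sup (Submodule.smul_mem _ _ (Submodule.mem_span_singleton_self _)) ?_
  refine Submodule.sub_mem _ ?_ (Submodule.smul_mem _ _ hqv)
  exact hP.adjointMap_mem (⟨q t, hqP.self_of_nhds⟩⁻¹ : P) hz

/-- Smoothness of `c` at `t` gives only differentiability at nearby points, where `c` need not be an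
admissible lift. The condition is taken there from another lift and carried over to `c`. -/
lemma eventually_mem_span_sup {ℓ : ℝ → G ⧸ P} {K : Set ℝ}
    (hℓ : IsRegularModelCurve EG EP P ℓ K) {t : ℝ} (ht : t ∈ K) {c : ℝ → G}
    (hc : IsLiftAt EG P ℓ c t) {X : EG}
    (hX : X ∈ symAlg EG EP P ℓ K) :
    ∀ᶠ s in 𝓝 t, adjointMap EG (c s)⁻¹ X ∈
      Submodule.span ℝ {logVel EG c s} ⊔ subLie EG EP P := by
  rw [mem_symmetryAlgebra_iff hP] at hX
  filter_upwards [eventually_mdiff hc.contMDiffAt,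
    hℓ.isOpen.mem_nhds ht, hc.mk_eq.eventually_nhds] with s h1 h2 h3
  obtain ⟨d, hd⟩ := hℓ.exists_lift s h2
  refine adjointMap_inv_mem_of_lift hP (hd.contMDiffAt.mdifferentiableAt (by simp))
    h1 ?_ (hX s h2 d hd)
  filter_upwards [h3, hd.mk_eq] with s' h4 h5
  rw [h4, h5]

/-- Put ξ = c⁻¹c', Ad(c⁻¹)X = aξ + x and Ad(c⁻¹)Y = bξ + y. Since the derivative of Ad(c⁻¹)X is -[ξ,
Ad(c⁻¹)X], differentiating gives -[ξ, x] = a'ξ + aξ' + x' with x' in 𝔭, and likewise for Y. In [aξ +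
x, bξ + y] the two terms abξ' then cancel, leaving a multiple of ξ plus an element of 𝔭. -/
lemma adMap_mem_symmetryAlgebra {ℓ : ℝ → G ⧸ P} {K : Set ℝ}
    (hℓ : IsRegularModelCurve EG EP P ℓ K) {X Y : EG}
    (hX : X ∈ symAlg EG EP P ℓ K)
    (hY : Y ∈ symAlg EG EP P ℓ K) :
    adMap EG G X Y ∈ symAlg EG EP P ℓ K := by
  rw [mem_symmetryAlgebra_iff hP]
  intro t ht c hc
  have hcm := hc.contMDiffAt.mdifferentiableAt (by simp)
  set ξ := logVel EG c
  have hξ : HasDerivAt ξ (deriv ξ t) t :=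
    ((contDiffAt_logVel hc.contMDiffAt).differentiableAt (by simp)).hasDerivAt
  have hξt : ξ t ∉ subLie EG EP P := fun h =>
    hℓ.regular t ht c hc ((velocity_mem_cosetTangent_iff hP hcm).2 h)
  obtain ⟨f, hf, hf0⟩ := exists_clm_of_notMem hξt
  have hfξ : HasDerivAt (fun s => f (ξ s)) (f (deriv ξ t)) t := f.hasFDerivAt.comp_hasDerivAt t hξ
  have hfne : ∀ᶠ s in 𝓝 t, f (ξ s) ≠ 0 := hfξ.continuousAt.eventually_ne hf
  -- decompose `Ad (c s)⁻¹ Z = α s • ξ s + z s` with `z s` in the Lie algebra of `P`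
  have key : ∀ Z : EG, Z ∈ symAlg EG EP P ℓ K →
      ∃ (a a' : ℝ) (z z' : EG), z ∈ subLie EG EP P ∧ z' ∈ subLie EG EP P ∧
        adjointMap EG (c t)⁻¹ Z = a • ξ t + z ∧
        - adMap EG G (ξ t) z = a' • ξ t + a • deriv ξ t + z' := by
    intro Z hZ
    have h1 := hasDerivAt_adjointMap_inv_apply hcm (hasDerivAt_const t Z)
    rw [map_zero, zero_sub] at h1
    have h2 : HasDerivAt (fun s => f (adjointMap EG (c s)⁻¹ Z) / f (ξ s)) _ t :=
      (f.hasFDerivAt.comp_hasDerivAt t h1).div hfξ hf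
    set a' := deriv (fun s => f (adjointMap EG (c s)⁻¹ Z) / f (ξ s)) t
    replace h2 : HasDerivAt (fun s => f (adjointMap EG (c s)⁻¹ Z) / f (ξ s)) a' t :=
      h2.differentiableAt.hasDerivAt
    have h3 := h1.sub (h2.smul hξ)
    have h4 : ∀ᶠ s in 𝓝 t, adjointMap EG (c s)⁻¹ Z -
        (f (adjointMap EG (c s)⁻¹ Z) / f (ξ s)) • ξ s ∈ subLie EG EP P := by
      filter_upwards [eventually_mem_span_sup hP hℓ ht hc hZ, hfne] with s hs hs'
      exact sub_smul_mem_of_mem_span_sup (f := f.toLinearMap) hf0 hs' hs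
    have h5 := h3.mem_submodule h4
    set a := f (adjointMap EG (c t)⁻¹ Z) / f (ξ t)
    refine ⟨a, a', _, _, h4.self_of_nhds, h5, by abel, ?_⟩
    rw [map_sub, map_smul, adMap_self, smul_zero, sub_zero]
    abel
  obtain ⟨a, a', x, x', hx, hx', hXx, hxd⟩ := key X hX
  obtain ⟨b, b', y, y', hy, hy', hYy, hyd⟩ := key Y hY
  have h1 : adMap EG G (adjointMap EG (c t)⁻¹ X) (adjointMap EG (c t)⁻¹ Y) =
      (b * a' - a * b') • ξ t + (b • x' - a • y' + adMap EG G x y) := by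
    have e1 : adMap EG G (ξ t) y = -(b' • ξ t + b • deriv ξ t + y') := by rw [← hyd, neg_neg]
    have e2 : adMap EG G x (ξ t) = a' • ξ t + a • deriv ξ t + x' := by rw [adMap_swap, hxd]
    rw [hXx, hYy]
    simp only [map_add, map_smul, add_apply, smul_apply,
      adMap_self, e1, e2]
    module
  rw [adjointMap_adMap, h1]
  refine Submodule.add_mem_sup (Submodule.smul_mem _ _ (Submodule.mem_span_singleton_self _)) ?_
  exact Submodule.add_mem _ (Submodule.sub_mem _ (Submodule.smul_mem _ _ hx')
    (Submodule.smul_mem _ _ hy')) (hP.adMap_mem hx hy)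

/-- At the base point the lift lies in P, so Ad of it preserves 𝔭 and the tangency condition there
bounds the whole algebra. -/
lemma exists_symmetryAlgebra_le {ℓ : ℝ → G ⧸ P} {K : Set ℝ}
    (hℓ : IsRegularModelCurve EG EP P ℓ K) (hbase : ∃ t ∈ K, ℓ t = QuotientGroup.mk (1 : G)) :
    ∃ v : EG, symAlg EG EP P ℓ K ≤
      Submodule.span ℝ {v} ⊔ subLie EG EP P := by
  obtain ⟨t, ht, h1⟩ := hbase
  obtain ⟨c, hc⟩ := hℓ.exists_lift t ht
  have hcP : c t ∈ P := by
    have := hc.mk_eq.self_of_nhds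
    rw [h1, eq_comm, QuotientGroup.eq] at this
    simpa using this
  refine ⟨adjointMap EG (c t) (logVel EG c t), fun (X : EG) hX => ?_⟩
  have h := (mem_symmetryAlgebra_iff hP).1 hX t ht c hc
  obtain ⟨y, hy, z, hz, hyz⟩ := Submodule.mem_sup.1 h
  obtain ⟨a, rfl⟩ := Submodule.mem_span_singleton.1 hy
  have : X = a • adjointMap EG (c t) (logVel EG c t) + adjointMap EG (c t) z := by
    rw [← map_smul, ← map_add, hyz, adjointMap_apply_inv_self]
  rw [this]
  exact Submodule.add_mem_sup (Submodule.smul_mem _ _ (Submodule.mem_span_singleton_self _))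
    (hP.adjointMap_mem ⟨c t, hcP⟩ hz)

end SymmetryAlgebra

end CartanTractor
end

noncomputable section

namespace CartanTractor

/-! ### The Cartan bundle and its connection. -/

namespace CartanGeometry

variable {EG EP EM EB : Type*}
  [NormedAddCommGroup EG] [NormedSpace ℝ EG] [FiniteDimensional ℝ EG]
  [NormedAddCommGroup EP] [NormedSpace ℝ EP] [FiniteDimensional ℝ EP]
  [NormedAddCommGroup EM] [NormedSpace ℝ EM] [NormedAddCommGroup EB] [NormedSpace ℝ EB]
  {G : Type*} [TopologicalSpace G] [ChartedSpace EG G] [Group G] [LieGroup 𝓘(ℝ, EG) ∞ G]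
  {P : Subgroup G} [ChartedSpace EP P] [LieGroup 𝓘(ℝ, EP) ∞ P]
  {M : Type*} [TopologicalSpace M] [ChartedSpace EM M] [IsManifold 𝓘(ℝ, EM) ∞ M]
  {B : Type*} [TopologicalSpace B] [ChartedSpace EB B] [IsManifold 𝓘(ℝ, EB) ∞ B]
  (C : CartanGeometry EG EP EM EB P M B)

/-- The Cartan connection, as a continuous linear map between the model vector spaces. -/
def conn (u : B) : EB →L[ℝ] EG := (C.form u).toContinuousLinearMap

lemma conn_injective (u : B) : Function.Injective (C.conn u) := (C.form u).injective

/-- The inverse of the Cartan connection. -/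
def connInv (u : B) : EG →L[ℝ] EB := (C.form u).symm.toContinuousLinearMap

lemma connInv_conn (u : B) (ξ : EB) : C.connInv u (C.conn u ξ) = ξ := (C.form u).symm_apply_apply ξ

lemma conn_connInv (u : B) (X : EG) : C.conn u (C.connInv u X) = X := (C.form u).apply_symm_apply X

lemma mdiff_act (x : B × P) : MDifferentiableAt (𝓘(ℝ, EB).prod 𝓘(ℝ, EP)) 𝓘(ℝ, EB)
    (fun x : B × P => C.act x.1 x.2) x :=
  C.contMDiff_act.mdifferentiable (by simp) x

lemma mdiff_act_left (p : P) (u : B) :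
    MDifferentiableAt 𝓘(ℝ, EB) 𝓘(ℝ, EB) (fun v => C.act v p) u :=
  (C.mdiff_act (u, p)).comp (I' := 𝓘(ℝ, EB).prod 𝓘(ℝ, EP)) (f := fun v => (v, p)) u
    (mdifferentiableAt_id.prodMk mdifferentiableAt_const)

lemma mdiff_act_right (u : B) (p : P) :
    MDifferentiableAt 𝓘(ℝ, EP) 𝓘(ℝ, EB) (fun q => C.act u q) p :=
  (C.mdiff_act (u, p)).comp (I' := 𝓘(ℝ, EB).prod 𝓘(ℝ, EP)) (f := fun q => (u, q)) p
    (mdifferentiableAt_const.prodMk mdifferentiableAt_id)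

lemma mdiff_proj (u : B) : MDifferentiableAt 𝓘(ℝ, EB) 𝓘(ℝ, EM) C.proj u :=
  C.contMDiff_proj.mdifferentiable (by simp) u

lemma conn_der_act_left (u : B) (p : P) (ξ : EB) :
    C.conn (C.act u p) (der EB EB (fun v => C.act v p) u ξ) =
      adjointMap EG (p : G)⁻¹ (C.conn u ξ) :=
  C.form_equivariant u p ξ

lemma conn_der_act_right (u : B) (X : EP) :
    C.conn u (der EP EB (fun p : P => C.act u p) 1 X) = inclMap EG EP P X := by
  have h : C.conn (C.act u 1) (der EP EB (fun p : P => C.act u p) 1 X) = inclMap EG EP P X :=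
    C.form_fundamental u X
  rwa [C.act_one] at h

lemma contMDiffAt_act_curve {u : ℝ → B} {p : ℝ → P} {t : ℝ}
    (hu : ContMDiffAt 𝓘(ℝ, ℝ) 𝓘(ℝ, EB) ∞ u t) (hp : ContMDiffAt 𝓘(ℝ, ℝ) 𝓘(ℝ, EP) ∞ p t) :
    ContMDiffAt 𝓘(ℝ, ℝ) 𝓘(ℝ, EB) ∞ (fun s => C.act (u s) (p s)) t :=
  (C.contMDiff_act (u t, p t)).comp (I' := 𝓘(ℝ, EB).prod 𝓘(ℝ, EP)) t (hu.prodMk hp)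

/-- The gauge rule ω((up)') = Ad(p⁻¹)ω(u') + p⁻¹p': equivariance gives the first term, fundamental
fields the second. -/
lemma conn_velocity_act {u : ℝ → B} {p : ℝ → P} {t : ℝ}
    (hu : MDifferentiableAt 𝓘(ℝ, ℝ) 𝓘(ℝ, EB) u t) (hp : MDifferentiableAt 𝓘(ℝ, ℝ) 𝓘(ℝ, EP) p t) :
    C.conn (C.act (u t) (p t)) (der ℝ EB (fun s => C.act (u s) (p s)) t 1) =
      adjointMap EG (p t : G)⁻¹ (C.conn (u t) (der ℝ EB u t 1)) +
        inclMap EG EP P (logVel EP p t) := by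
  rw [der_binary (F := C.act) (a := u t) (b := p t) (C.mdiff_act _) hu hp rfl rfl, map_add,
    conn_der_act_left]
  congr 1
  have h : (fun q => C.act (u t) q) = fun q => C.act (C.act (u t) (p t)) ((p t)⁻¹ * q) := by
    ext q; rw [← C.act_mul, mul_inv_cancel_left]
  rw [h, der_comp_apply (g := fun q => C.act (C.act (u t) (p t)) q)
    (f := fun q => (p t)⁻¹ * q) (y := 1) (C.mdiff_act_right _ _) (mdiff_mul_left _ _) (by simp),
    conn_der_act_right, logVel_eq hp]

lemma exists_act_eq {u v : B} (h : C.proj u = C.proj v) : ∃ p, C.act u p = v := by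
  obtain ⟨U, -, hx, σ, τ, -, -, -, -, hτ⟩ := C.exists_trivialization (C.proj u)
  refine ⟨(τ u)⁻¹ * τ v, ?_⟩
  have h1 := hτ u hx
  have h2 := hτ v (show C.proj v ∈ U from h ▸ hx)
  rw [← h] at h2
  have h3 := C.act_mul (σ (C.proj u)) (τ u) ((τ u)⁻¹ * τ v)
  rw [mul_inv_cancel_left, h1, h2] at h3
  exact h3.symm

lemma act_right_injective (u : B) : Function.Injective (C.act u) := by
  intro p q h
  obtain ⟨U, -, hx, σ, τ, -, -, -, h2, hτ⟩ := C.exists_trivialization (C.proj u)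
  have h1 := hτ u hx
  rw [← h1, ← C.act_mul, ← C.act_mul] at h
  have h3 := congrArg τ h
  rw [h2 _ hx, h2 _ hx] at h3
  exact mul_left_cancel h3

lemma exists_lift_near {γ : ℝ → M} {t : ℝ} {J : Set ℝ} (hJ : IsOpen J) (ht : t ∈ J)
    (hγ : ContMDiffOn 𝓘(ℝ, ℝ) 𝓘(ℝ, EM) ∞ γ J) :
    ∃ u : ℝ → B, ∀ᶠ s in 𝓝 t, C.proj (u s) = γ s ∧ ContMDiffAt 𝓘(ℝ, ℝ) 𝓘(ℝ, EB) ∞ u s := by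
  obtain ⟨U, hU, hx, σ, τ, hσ, -, h1, -, -⟩ := C.exists_trivialization (γ t)
  refine ⟨fun s => σ (γ s), ?_⟩
  have hγt := hγ.contMDiffAt (hJ.mem_nhds ht)
  filter_upwards [hγt.continuousAt.preimage_mem_nhds (hU.mem_nhds hx), hJ.mem_nhds ht] with s hs hsJ
  exact ⟨h1 _ hs, (hσ.contMDiffAt (hU.mem_nhds hs)).comp s (hγ.contMDiffAt (hJ.mem_nhds hsJ))⟩

lemma proj_surjective : Function.Surjective C.proj := fun x => by
  obtain ⟨U, -, hx, σ, -, -, -, h1, -, -⟩ := C.exists_trivialization x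
  exact ⟨σ x, h1 x hx⟩

instance (x : M) : Nonempty (C.Fiber x) :=
  let ⟨u, hu⟩ := C.proj_surjective x
  ⟨⟨u, hu⟩⟩

/-- The difference of two smooth lifts is a smooth curve in the structure group. -/
lemma exists_difference {u v : ℝ → B} {t : ℝ} (hu : ContMDiffAt 𝓘(ℝ, ℝ) 𝓘(ℝ, EB) ∞ u t)
    (hv : ContMDiffAt 𝓘(ℝ, ℝ) 𝓘(ℝ, EB) ∞ v t) (h : ∀ᶠ s in 𝓝 t, C.proj (u s) = C.proj (v s)) :
    ∃ p : ℝ → P, ContMDiffAt 𝓘(ℝ, ℝ) 𝓘(ℝ, EP) ∞ p t ∧ ∀ᶠ s in 𝓝 t, v s = C.act (u s) (p s) := by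
  obtain ⟨U, hU, hx, σ, τ, -, hτs, -, -, hτ⟩ := C.exists_trivialization (C.proj (u t))
  have hV : IsOpen (C.proj ⁻¹' U) := hU.preimage C.contMDiff_proj.continuous
  have hvt : v t ∈ C.proj ⁻¹' U := show C.proj (v t) ∈ U from h.self_of_nhds ▸ hx
  have hτu : ContMDiffAt 𝓘(ℝ, ℝ) 𝓘(ℝ, EP) ∞ (fun s => τ (u s)) t :=
    (hτs.contMDiffAt (hV.mem_nhds hx)).comp t hu
  have hτv : ContMDiffAt 𝓘(ℝ, ℝ) 𝓘(ℝ, EP) ∞ (fun s => τ (v s)) t :=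
    (hτs.contMDiffAt (hV.mem_nhds hvt)).comp t hv
  refine ⟨fun s => (τ (u s))⁻¹ * τ (v s), hτu.inv.mul hτv, ?_⟩
  filter_upwards [h, hu.continuousAt.preimage_mem_nhds (hV.mem_nhds hx),
    hv.continuousAt.preimage_mem_nhds (hV.mem_nhds hvt)] with s h1 h2 h3
  have h4 := hτ _ h2
  have h5 := hτ _ h3
  rw [← h1] at h5
  have h6 := C.act_mul (σ (C.proj (u s))) (τ (u s)) ((τ (u s))⁻¹ * τ (v s))
  rwa [mul_inv_cancel_left, h4, h5] at h6

lemma der_proj_act_left (u : B) (p : P) (ξ : EB) :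
    der EB EM C.proj (C.act u p) (der EB EB (fun v => C.act v p) u ξ) = der EB EM C.proj u ξ := by
  rw [← der_comp_apply (C.mdiff_proj _) (C.mdiff_act_left p u) rfl]
  simp only [C.proj_act]

lemma der_proj_act_right (u : B) (X : EP) :
    der EB EM C.proj u (der EP EB (fun p : P => C.act u p) 1 X) = 0 := by
  rw [← der_comp_apply (C.mdiff_proj _) (C.mdiff_act_right u 1) (C.act_one u)]
  simp only [C.proj_act, der_const]
  rfl

lemma der_proj_connInv_eq_zero {u : B} {X : EG} (hX : X ∈ subLie EG EP P) :
    der EB EM C.proj u (C.connInv u X) = 0 := by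
  obtain ⟨Y, rfl⟩ := hX
  change der EB EM C.proj u (C.connInv u (inclMap EG EP P Y)) = 0
  rw [← C.conn_der_act_right u Y, connInv_conn, der_proj_act_right]

/-- Differentiate v = σ(π v)·τ(v) in a trivialisation. A vertical vector moves only the factor τ, so
it is fundamental and ω sends it to 𝔭. -/
lemma conn_mem_of_der_proj_eq_zero {u : B} {ξ : EB} (h : der EB EM C.proj u ξ = 0) :
    C.conn u ξ ∈ subLie EG EP P := by
  obtain ⟨U, hU, hx, σ, τ, hσ, hτs, -, -, hτ⟩ := C.exists_trivialization (C.proj u)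
  have hV : IsOpen (C.proj ⁻¹' U) := hU.preimage C.contMDiff_proj.continuous
  have hτu : MDifferentiableAt 𝓘(ℝ, EB) 𝓘(ℝ, EP) τ u :=
    (hτs.contMDiffAt (hV.mem_nhds hx)).mdifferentiableAt (by simp)
  have hσu : MDifferentiableAt 𝓘(ℝ, EM) 𝓘(ℝ, EB) σ (C.proj u) :=
    (hσ.contMDiffAt (hU.mem_nhds hx)).mdifferentiableAt (by simp)
  have h1 : der EB EB (fun v => C.act (σ (C.proj v)) (τ v)) u ξ = ξ := by
    rw [der_congr (g := fun v => v), der_id]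
    · rfl
    · filter_upwards [hV.mem_nhds hx] with v hv using hτ v hv
  have hσp : MDifferentiableAt 𝓘(ℝ, EB) 𝓘(ℝ, EB) (fun v => σ (C.proj v)) u :=
    hσu.comp u (C.mdiff_proj u)
  rw [der_binary (F := C.act) (a := σ (C.proj u)) (b := τ u) (C.mdiff_act _) hσp hτu rfl rfl,
    der_comp_apply hσu (C.mdiff_proj u) rfl, h, map_zero, map_zero, zero_add] at h1
  have h2 : (fun q => C.act (σ (C.proj u)) q) = fun q => C.act u ((τ u)⁻¹ * q) := by
    ext q
    have h3 := C.act_mul (σ (C.proj u)) (τ u) ((τ u)⁻¹ * q)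
    rwa [mul_inv_cancel_left, hτ u hx] at h3
  rw [h2, der_comp_apply (g := fun q => C.act u q) (f := fun q => (τ u)⁻¹ * q) (y := 1)
    (C.mdiff_act_right _ _) (mdiff_mul_left _ _) (by simp)] at h1
  rw [← h1, conn_der_act_right]
  exact ⟨_, rfl⟩

/-- The velocity is the tangent map applied to the constant field 1, and ω is smooth on the tangent
bundle. The tangent map is formed on an open set on which `u` is smooth, hence the hypothesis at
nearby points. -/
lemma contDiffAt_conn_velocity {u : ℝ → B} {t : ℝ}
    (hu : ∀ᶠ s in 𝓝 t, ContMDiffAt 𝓘(ℝ, ℝ) 𝓘(ℝ, EB) ∞ u s) :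
    ContDiffAt ℝ ∞ (fun s => C.conn (u s) (der ℝ EB u s 1)) t := by
  obtain ⟨U, hU, hUo, ht⟩ := eventually_nhds_iff.1 hu
  have h1 : ContMDiffOn 𝓘(ℝ, ℝ) 𝓘(ℝ, EB) ∞ u U := fun s hs => (hU s hs).contMDiffWithinAt
  have h2 := h1.contMDiffOn_tangentMapWithin (m := ∞) (by simp) hUo.uniqueMDiffOn
  have h3 : ContMDiffAt 𝓘(ℝ, ℝ) 𝓘(ℝ, ℝ).tangent ∞
      (fun s : ℝ => (⟨s, (1 : ℝ)⟩ : TangentBundle 𝓘(ℝ, ℝ) ℝ)) t :=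
    contMDiffAt_vectorSpace_iff_contDiffAt.2 contDiffAt_const
  have h4 := ContMDiffAt.comp t (h2.contMDiffAt (x := ⟨t, 1⟩) ?_) h3
  · have h5 := (C.contMDiff_form _).comp t h4
    rw [← contMDiffAt_iff_contDiffAt]
    refine h5.congr_of_eventuallyEq ?_
    filter_upwards [hUo.mem_nhds ht] with s hs
    have h6 : mfderivWithin 𝓘(ℝ, ℝ) 𝓘(ℝ, EB) u U s = mfderiv 𝓘(ℝ, ℝ) 𝓘(ℝ, EB) u s := mfderivWithin_of_isOpen (I := 𝓘(ℝ, ℝ)) (I' := 𝓘(ℝ, EB)) (f := u) hUo hs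
    exact congrArg (fun T : ℝ →L[ℝ] EB => C.conn (u s) (T 1)) h6.symm
  · exact (hUo.preimage (FiberBundle.continuous_proj _ _)).mem_nhds ht

/-! ### Frames of the adjoint tractor bundle. -/

section Frame

variable {x : M}

/-- The frame defined by a point of the Cartan bundle, with values in the model vector space. -/
def coord (u : C.Fiber x) : C.AdjointTractor x →ₗ[ℝ] EG := C.frame u

lemma coord_of_act {u v : C.Fiber x} {p : P} (h : v.1 = C.act u.1 p) (a : C.AdjointTractor x) :
    C.coord v a = adjointMap EG (p : G)⁻¹ (C.coord u a) := by
  have hv : v = C.fiberAct u p := Subtype.ext h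
  rw [hv]
  exact a.2 u p

lemma exists_fiber_act (u v : C.Fiber x) : ∃ p, v.1 = C.act u.1 p := by
  obtain ⟨p, hp⟩ := C.exists_act_eq (u.2.trans v.2.symm)
  exact ⟨p, hp.symm⟩

lemma coord_injective (u : C.Fiber x) : Function.Injective (C.coord u) := by
  intro a b h
  refine Subtype.ext (funext fun v => ?_)
  obtain ⟨p, hp⟩ := C.exists_fiber_act u v
  have h1 := C.coord_of_act hp a
  rw [h, ← C.coord_of_act hp b] at h1
  exact h1

/-- The element `[u, X]` of the adjoint tractor bundle. -/
def tractor (u : C.Fiber x) (X : EG) : C.AdjointTractor x :=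
  ⟨fun v => adjointMap EG ((C.exists_fiber_act u v).choose : G)⁻¹ X, fun v p => by
    have h1 := (C.exists_fiber_act u v).choose_spec
    have h2 := (C.exists_fiber_act u (C.fiberAct v p)).choose_spec
    set q := (C.exists_fiber_act u v).choose
    set r := (C.exists_fiber_act u (C.fiberAct v p)).choose
    have h3 : r = q * p := by
      apply C.act_right_injective u.1
      rw [← h2, C.act_mul, ← h1]
      rfl
    change adjointMap EG (r : G)⁻¹ X = adjointMap EG (p : G)⁻¹ (adjointMap EG (q : G)⁻¹ X)
    rw [← adjointMap_mul_apply, h3, Subgroup.coe_mul, mul_inv_rev]⟩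

lemma coord_tractor (u : C.Fiber x) (X : EG) : C.coord u (C.tractor u X) = X := by
  have h := (C.exists_fiber_act u u).choose_spec
  have h1 : (C.exists_fiber_act u u).choose = 1 := by
    apply C.act_right_injective u.1
    rw [← h, C.act_one]
  change adjointMap EG ((C.exists_fiber_act u u).choose : G)⁻¹ X = X
  rw [h1, Subgroup.coe_one, inv_one, adjointMap_one]
  rfl

lemma tractor_coord (u : C.Fiber x) (a : C.AdjointTractor x) : C.tractor u (C.coord u a) = a :=
  C.coord_injective u (C.coord_tractor u _)

/-- The frame as a linear equivalence. -/
def coordEquiv (u : C.Fiber x) : C.AdjointTractor x ≃ₗ[ℝ] EG :=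
  { C.coord u with
    invFun := C.tractor u
    left_inv := C.tractor_coord u
    right_inv := C.coord_tractor u }

lemma anchor_eq (u : C.Fiber x) (a : C.AdjointTractor x) :
    (C.anchor u a : EM) = der EB EM C.proj u.1 (C.connInv u.1 (C.coord u a)) := rfl

lemma anchor_eq_anchor (u v : C.Fiber x) (a : C.AdjointTractor x) :
    C.anchor u a = C.anchor v a := by
  obtain ⟨p, hp⟩ := C.exists_fiber_act u v
  refine (C.anchor_eq u a).trans (Eq.trans ?_ (C.anchor_eq v a).symm)
  rw [C.coord_of_act hp, ← C.der_proj_act_left u.1 p, hp]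
  congr 1
  apply C.conn_injective (C.act u.1 p)
  rw [conn_der_act_left, conn_connInv, conn_connInv]

end Frame

end CartanGeometry

end CartanTractor
end

noncomputable section

namespace CartanTractor

namespace CartanGeometry

variable {EG EP EM EB : Type*}
  [NormedAddCommGroup EG] [NormedSpace ℝ EG] [FiniteDimensional ℝ EG]
  [NormedAddCommGroup EP] [NormedSpace ℝ EP] [FiniteDimensional ℝ EP]
  [NormedAddCommGroup EM] [NormedSpace ℝ EM] [NormedAddCommGroup EB] [NormedSpace ℝ EB]
  {G : Type*} [TopologicalSpace G] [ChartedSpace EG G] [Group G] [LieGroup 𝓘(ℝ, EG) ∞ G]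
  {P : Subgroup G} [ChartedSpace EP P] [LieGroup 𝓘(ℝ, EP) ∞ P]
  {M : Type*} [TopologicalSpace M] [ChartedSpace EM M] [IsManifold 𝓘(ℝ, EM) ∞ M]
  {B : Type*} [TopologicalSpace B] [ChartedSpace EB B] [IsManifold 𝓘(ℝ, EB) ∞ B]
  (C : CartanGeometry EG EP EM EB P M B)

/-! ### Independence of the chosen lift. -/

section Sections

variable {γ : ℝ → M}

lemma exists_difference_of_lifts {u v : ∀ t, C.Fiber (γ t)} {t : ℝ} (hu : C.IsSmoothLiftAt u t)
    (hv : C.IsSmoothLiftAt v t) :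
    ∃ p : ℝ → P, ContMDiffAt 𝓘(ℝ, ℝ) 𝓘(ℝ, EP) ∞ p t ∧
      ∀ᶠ s in 𝓝 t, (v s).1 = C.act (u s).1 (p s) :=
  C.exists_difference hu hv (Eventually.of_forall fun s => (u s).2.trans (v s).2.symm)

variable (hP : IsClosedLieSubgroup EG EP P)
include hP

lemma contDiffAt_coord_of_lift {u v : ∀ t, C.Fiber (γ t)} {t : ℝ} (hu : C.IsSmoothLiftAt u t)
    (hv : C.IsSmoothLiftAt v t) {a : ∀ t, C.AdjointTractor (γ t)}
    (ha : ContDiffAt ℝ ∞ (fun s => C.coord (u s) (a s)) t) :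
    ContDiffAt ℝ ∞ (fun s => C.coord (v s) (a s)) t := by
  obtain ⟨p, hp, hpe⟩ := C.exists_difference_of_lifts hu hv
  have h1 : ContMDiffAt 𝓘(ℝ, ℝ) 𝓘(ℝ, EG) ∞ (fun s => ((p s : G))⁻¹) t :=
    (hP.contMDiff_subtype.contMDiffAt.comp t hp).inv
  have h2 : ContDiffAt ℝ ∞ (fun s => adjointMap EG (p s : G)⁻¹) t :=
    (contMDiff_adjointMap.contMDiffAt.comp t h1).contDiffAt
  refine (h2.clm_apply ha).congr_of_eventuallyEq ?_
  filter_upwards [hpe] with s hs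
  exact C.coord_of_act hs _

/-- One lift suffices: for v = up, the term -[p⁻¹p', ·] from differentiating Ad(p⁻¹) is absorbed by
the term p⁻¹p' of ω(v'). -/
lemma hasTractorDerivAt_of_lift {u : ∀ t, C.Fiber (γ t)} {t : ℝ} (hu : C.IsSmoothLiftAt u t)
    {a : ∀ t, C.AdjointTractor (γ t)} {b : C.AdjointTractor (γ t)}
    (h : HasDerivAt (fun s => C.coord (u s) (a s)) (C.coord (u t) b -
      adMap EG G (C.conn (u t).1 (der ℝ EB (fun s => (u s).1) t 1)) (C.coord (u t) (a t))) t) :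
    C.HasTractorDerivAt a t b := by
  intro v hv
  obtain ⟨p, hp, hpe⟩ := C.exists_difference_of_lifts hu hv
  have hpm := hp.mdifferentiableAt (by simp)
  have hpG : MDifferentiableAt 𝓘(ℝ, ℝ) 𝓘(ℝ, EG) (fun s => (p s : G)) t := (hP.mdiff _).comp t hpm
  have h1 := hasDerivAt_adjointMap_inv_apply hpG h
  have h2 : HasDerivAt (fun s => C.coord (v s) (a s)) (C.coord (v t) b -
      adMap EG G (C.conn (v t).1 (der ℝ EB (fun s => (v s).1) t 1)) (C.coord (v t) (a t))) t := by
    refine (h1.congr_of_eventuallyEq ?_).congr_deriv ?_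
    · filter_upwards [hpe] with s hs
      exact C.coord_of_act hs _
    · rw [C.coord_of_act hpe.self_of_nhds, C.coord_of_act hpe.self_of_nhds, der_congr hpe,
        hpe.self_of_nhds, C.conn_velocity_act (hu.mdifferentiableAt (by simp)) hpm,
        ← hP.logVel_coe hpm, map_sub, adjointMap_adMap, map_add, add_apply]
      abel
  refine h2.congr_deriv ?_
  rw [← lieBr_eq_adMap]
  rfl

end Sections

/-! ### From a distinguished curve to a parallel subbundle. -/

section Distinguished

variable {γ : ℝ → M} {𝔥 : Submodule ℝ EG}

lemma map_coord_comap {x : M} (u : C.Fiber x) : (𝔥.comap (C.coord u)).map (C.coord u) = 𝔥 :=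
  Submodule.map_comap_eq_of_surjective (C.coordEquiv u).surjective _

lemma der_proj_lift {u : ℝ → B} {t : ℝ} (hu : MDifferentiableAt 𝓘(ℝ, ℝ) 𝓘(ℝ, EB) u t)
    (h : ∀ᶠ s in 𝓝 t, C.proj (u s) = γ s) :
    der EB EM C.proj (u t) (der ℝ EB u t 1) = der ℝ EM γ t 1 := by
  rw [← der_comp_apply (C.mdiff_proj _) hu rfl, der_congr h]

variable (hP : IsClosedLieSubgroup EG EP P)
include hP

lemma exists_subbundle_of_isDistinguished
    (hLie : ∀ X ∈ 𝔥, ∀ Y ∈ 𝔥, adMap EG G X Y ∈ 𝔥)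
    (hline : ∃ v, 𝔥 ≤ Submodule.span ℝ {v} ⊔ subLie EG EP P)
    {J : Set ℝ} (hJ : IsOpen J) (hγ' : ∀ t ∈ J, velocity EM γ t ≠ 0)
    (h : C.IsDistinguished 𝔥 γ J) :
    ∃ S : ∀ t : ℝ, Submodule ℝ (C.AdjointTractor (γ t)),
        C.IsSmoothSubbundle S J ∧
        (∀ t ∈ J, ∃ u : C.Fiber (γ t), (S t).map (C.coord u) = 𝔥) ∧
        (∀ t ∈ J, ∀ u : C.Fiber (γ t),
          (S t).map (C.anchor u) = Submodule.span ℝ {velocity EM γ t}) ∧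
        C.IsPreserved S J := by
  classical
  obtain ⟨σ, hσ, hσJ⟩ := h
  -- Off `J` the lift is arbitrary; only germs at points of the open set `J` matter.
  set u : ∀ t, C.Fiber (γ t) := fun t =>
    if ht : t ∈ J then ⟨σ t, (hσJ t ht).1⟩ else Classical.arbitrary _ with hu_def
  have huσ : ∀ t ∈ J, (u t).1 = σ t := fun t ht => by simp [hu_def, ht]
  have hue : ∀ t ∈ J, (fun s => (u s).1) =ᶠ[𝓝 t] σ := fun t ht => by
    filter_upwards [hJ.mem_nhds ht] with s hs using huσ s hs
  have hu : ∀ t ∈ J, C.IsSmoothLiftAt u t := fun t ht =>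
    (hσ.contMDiffAt (hJ.mem_nhds ht)).congr_of_eventuallyEq (hue t ht)
  have hξ : ∀ t ∈ J, C.conn (u t).1 (der ℝ EB (fun s => (u s).1) t 1) ∈ 𝔥 := fun t ht => by
    rw [der_congr (hue t ht), huσ t ht]
    exact (hσJ t ht).2
  refine ⟨fun t => 𝔥.comap (C.coord (u t)), ?_, fun t _ => ⟨u t, C.map_coord_comap _⟩, ?_, ?_⟩
  · intro t₀ ht₀
    let bas := Module.finBasis ℝ 𝔥
    refine ⟨J, hJ, ht₀, subset_rfl, _, fun i t => C.tractor (u t) (bas i), ?_, ?_⟩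
    · intro i t ht v hv
      refine C.contDiffAt_coord_of_lift hP (hu t ht) hv (a := fun t => C.tractor (u t) (bas i)) ?_
      simp only [C.coord_tractor]
      exact contDiffAt_const
    · intro t ht
      have h1 : LinearIndependent ℝ fun i => (bas i : EG) :=
        bas.linearIndependent.map' 𝔥.subtype (Submodule.ker_subtype _)
      have h2 : Submodule.span ℝ (range fun i => (bas i : EG)) = 𝔥 := by
        have := congrArg (Submodule.map 𝔥.subtype) bas.span_eq
        rw [Submodule.map_span, ← range_comp, Submodule.map_top, Submodule.range_subtype] at this
        exact this
      constructor
      · exact h1.map' (C.coordEquiv (u t)).symm.toLinearMap (LinearEquiv.ker _)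
      · have h3 : (range fun i => C.tractor (u t) (bas i)) =
            (C.coordEquiv (u t)).symm '' (range fun i => (bas i : EG)) := by
          rw [← range_comp]; rfl
        rw [h3]
        have h4 := Submodule.map_span (C.coordEquiv (u t)).symm.toLinearMap
          (range fun i => (bas i : EG))
        refine h4.symm.trans ?_
        rw [h2]
        exact Submodule.map_equiv_eq_comap_symm _ _
  · intro t ht v
    have h1 : ∀ a : C.AdjointTractor (γ t), C.anchor v a = C.anchor (u t) a :=
      fun a => C.anchor_eq_anchor v (u t) a
    obtain ⟨w, hw⟩ := hline
    have hγu : der EB EM C.proj (u t).1 (der ℝ EB (fun s => (u s).1) t 1) = der ℝ EM γ t 1 :=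
      C.der_proj_lift (u := fun s => (u s).1) ((hu t ht).mdifferentiableAt (by simp))
        (Eventually.of_forall fun s => (u s).2)
    set ξ := C.conn (u t).1 (der ℝ EB (fun s => (u s).1) t 1) with hξ_def
    set D : EG → EM := fun X => der EB EM C.proj (u t).1 (C.connInv (u t).1 X) with hD
    have hDξ : D ξ = der ℝ EM γ t 1 := by rw [hD, hξ_def]; simp only [connInv_conn, hγu]
    -- `D` kills 𝔭, so its image of 𝔥 lies in the line of `D w`. That line is the tangent line,
    -- since `D ξ` is the nonzero velocity.
    have hDX : ∀ X ∈ 𝔥, ∃ r : ℝ, D X = r • D w := by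
      intro X hX
      obtain ⟨y, hy, z, hz, rfl⟩ := Submodule.mem_sup.1 (hw hX)
      obtain ⟨r, rfl⟩ := Submodule.mem_span_singleton.1 hy
      refine ⟨r, ?_⟩
      simp only [hD, map_add, C.der_proj_connInv_eq_zero hz, add_zero, map_smul]
    obtain ⟨r, hr⟩ := hDX ξ (hξ t ht)
    have hr0 : r ≠ 0 := by
      rintro rfl
      rw [zero_smul, hDξ] at hr
      exact hγ' t ht hr
    apply le_antisymm
    · rintro _ ⟨a, ha, rfl⟩
      obtain ⟨q, hq⟩ := hDX _ ha
      refine Submodule.mem_span_singleton.2 ⟨q / r, ?_⟩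
      refine Eq.trans ?_ (h1 a).symm
      change (q / r) • (der ℝ EM γ t 1) = D (C.coord (u t) a)
      rw [hq, ← hDξ, hr, smul_smul, div_mul_cancel₀ _ hr0]
    · rw [Submodule.span_singleton_le_iff_mem]
      refine ⟨C.tractor (u t) ξ, ?_, ?_⟩
      · change C.coord (u t) _ ∈ 𝔥
        rw [coord_tractor]; exact hξ t ht
      · refine (h1 _).trans ?_
        change D (C.coord (u t) _) = _
        rw [coord_tractor, hDξ]
        rfl
  · intro U hU hUJ a ha haS t ht
    have htJ := hUJ ht
    have hf : HasDerivAt (fun s => C.coord (u s) (a s))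
        (deriv (fun s => C.coord (u s) (a s)) t) t :=
      (ContDiffAt.differentiableAt (ha t ht u (hu t htJ)) (by simp)).hasDerivAt
    have hf' := hf.mem_submodule (S := 𝔥) (by
      filter_upwards [hU.mem_nhds ht] with s hs using haS s hs)
    -- Both summands lie in 𝔥: the first is the derivative of an 𝔥-valued curve, the second a
    -- bracket in 𝔥.
    refine ⟨C.tractor (u t) (deriv (fun s => C.coord (u s) (a s)) t +
      adMap EG G (C.conn (u t).1 (der ℝ EB (fun s => (u s).1) t 1)) (C.coord (u t) (a t))), ?_, ?_⟩
    · change C.coord (u t) _ ∈ 𝔥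
      rw [coord_tractor]
      exact 𝔥.add_mem hf' (hLie _ (hξ t htJ) _ (haS t ht))
    · refine C.hasTractorDerivAt_of_lift hP (hu t htJ) ?_
      rw [coord_tractor, add_sub_cancel_right]
      exact hf

end Distinguished

end CartanGeometry

end CartanTractor
end

noncomputable section

namespace CartanTractor

/-! ### Subspaces preserved by differentiation are constant. -/

section SpanConst

variable {E : Type*} [NormedAddCommGroup E] [NormedSpace ℝ E]

/-- The linear map `v ↦ ∑ v j • g j`. -/
def frameMap {k : ℕ} : (Fin k → E) →L[ℝ] ((Fin k → ℝ) →L[ℝ] E) :=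
  ∑ j, (ContinuousLinearMap.smulRightL ℝ (Fin k → ℝ) E (ContinuousLinearMap.proj j)).comp
    (ContinuousLinearMap.proj j)

lemma frameMap_apply {k : ℕ} (g : Fin k → E) (v : Fin k → ℝ) :
    frameMap g v = ∑ j, v j • g j := by
  simp [frameMap]

lemma range_frameMap {k : ℕ} (g : Fin k → E) :
    LinearMap.range (frameMap g).toLinearMap = Submodule.span ℝ (range g) := by
  ext x
  rw [Submodule.mem_span_range_iff_exists_fun]
  exact exists_congr fun v => by rw [← frameMap_apply]; rfl

lemma frameMap_injective {k : ℕ} {g : Fin k → E} (h : LinearIndependent ℝ g) :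
    Function.Injective (frameMap g) := by
  refine (injective_iff_map_eq_zero _).2 fun v hv => ?_
  rw [frameMap_apply] at hv
  exact funext (Fintype.linearIndependent_iff.1 h v hv)

/-- A frame whose derivatives lie in its span spans a constant subspace. -/
lemma eventually_span_eq [FiniteDimensional ℝ E] {k : ℕ} {g g' : ℝ → Fin k → E} {t₀ : ℝ}
    (hd : ∀ᶠ s in 𝓝 t₀, HasDerivAt g (g' s) s) (hc : ContinuousAt g' t₀)
    (hs : ∀ᶠ s in 𝓝 t₀, ∀ j, g' s j ∈ Submodule.span ℝ (range (g s)))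
    (hi : LinearIndependent ℝ (g t₀)) :
    ∀ᶠ s in 𝓝 t₀, Submodule.span ℝ (range (g s)) = Submodule.span ℝ (range (g t₀)) := by
  obtain ⟨L₀, hL₀⟩ := (frameMap (g t₀)).toLinearMap.exists_leftInverse_of_injective
    (LinearMap.ker_eq_bot.2 (frameMap_injective hi))
  set L : E →L[ℝ] (Fin k → ℝ) := LinearMap.toContinuousLinearMap L₀
  have hL : L.comp (frameMap (g t₀)) = 1 := by
    ext1 v; exact LinearMap.congr_fun hL₀ v
  set A : ℝ → ((Fin k → ℝ) →L[ℝ] (Fin k → ℝ)) := fun s => L.comp (frameMap (g s))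
  -- The coefficients expressing g' in terms of g. The explicit formula makes them continuous at t₀,
  -- hence bounded nearby, which supplies a Lipschitz constant.
  set m : ℝ → ((Fin k → ℝ) →L[ℝ] (Fin k → ℝ)) := fun s =>
    Ring.inverse (A s) * L.comp (frameMap (g' s))
  have hgc : ContinuousAt g t₀ := hd.self_of_nhds.continuousAt
  have hAc : ContinuousAt A t₀ :=
    ((ContinuousLinearMap.compL ℝ (Fin k → ℝ) E (Fin k → ℝ) L).continuous.comp
      frameMap.continuous).continuousAt.comp hgc
  have hA0 : A t₀ = ((1 : ((Fin k → ℝ) →L[ℝ] (Fin k → ℝ))ˣ) : _) := hL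
  have hAu : ∀ᶠ s in 𝓝 t₀, IsUnit (A s) := by
    refine hAc.eventually (Units.isOpen.mem_nhds ?_)
    rw [hA0]; exact Units.isUnit _
  have hmc : ContinuousAt m t₀ := by
    refine ContinuousAt.mul ?_ ?_
    · refine ContinuousAt.comp (g := Ring.inverse) ?_ hAc
      rw [hA0]
      exact NormedRing.inverse_continuousAt _
    · exact ((ContinuousLinearMap.compL ℝ (Fin k → ℝ) E (Fin k → ℝ) L).continuous.comp
        frameMap.continuous).continuousAt.comp hc
  have hmb : ∀ᶠ s in 𝓝 t₀, ‖m s‖ < ‖m t₀‖ + 1 :=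
    hmc.norm.eventually (gt_mem_nhds (lt_add_one _))
  have hfac : ∀ᶠ s in 𝓝 t₀, frameMap (g' s) = (frameMap (g s)).comp (m s) := by
    filter_upwards [hs, hAu] with s h1 h2
    have h3 : ∀ j, ∃ w : Fin k → ℝ, frameMap (g s) w = g' s j := fun j => by
      have := h1 j
      rw [← range_frameMap] at this
      exact this
    choose w hw using h3
    have h4 : frameMap (g' s) = (frameMap (g s)).comp (frameMap w) := by
      ext1 v
      rw [ContinuousLinearMap.comp_apply, frameMap_apply (g' s), frameMap_apply w, map_sum]
      simp only [map_smul, hw]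
    have h5 : m s = frameMap w := by
      change Ring.inverse (A s) * L.comp (frameMap (g' s)) = _
      rw [h4, ← ContinuousLinearMap.comp_assoc]
      change Ring.inverse (A s) * (A s * frameMap w) = _
      rw [← mul_assoc, Ring.inverse_mul_cancel _ h2, one_mul]
    rw [h5, h4]
  -- `T` vanishes exactly on the span at `t₀`
  set T : E →L[ℝ] E := ContinuousLinearMap.id ℝ E - (frameMap (g t₀)).comp L
  have hT : T.comp (frameMap (g t₀)) = 0 := by
    ext1 v
    have : L (frameMap (g t₀) v) = v := LinearMap.congr_fun hL₀ v
    simp [T, this]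
  obtain ⟨a, b, hab, hI⟩ := mem_nhds_iff_exists_Ioo_subset.1
    (hd.and (hmb.and (hfac.and hAu)))
  have hF : ∀ s ∈ Ioo a b, HasDerivAt (fun s => T.comp (frameMap (g s)))
      ((T.comp (frameMap (g s))).comp (m s)) s := by
    intro s hs
    obtain ⟨h1, -, h3, -⟩ := hI hs
    have h4 := ((ContinuousLinearMap.compL ℝ (Fin k → ℝ) E E T).comp
      (frameMap (E := E) (k := k))).hasFDerivAt.comp_hasDerivAt s h1
    refine h4.congr_deriv ?_
    change T.comp (frameMap (g' s)) = _
    rw [h3]; rfl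
  -- The frame modulo the span at t₀ solves the linear equation F' = F ∘ m with F(t₀) = 0, so it
  -- vanishes. This gives one inclusion of spans; equal dimension gives the other.
  have hzero := ODE_solution_unique_of_mem_Ioo (K := (‖m t₀‖ + 1).toNNReal)
    (v := fun s X => X.comp (m s)) (s := fun _ => univ) (a := a) (b := b) (t₀ := t₀)
    (f := fun s => T.comp (frameMap (g s))) (g := fun _ => 0) ?_ hab
    (fun s hs => ⟨hF s hs, mem_univ _⟩)
    (fun s _ => ⟨by simpa using hasDerivAt_const s _, mem_univ _⟩) hT
  · filter_upwards [Ioo_mem_nhds hab.1 hab.2] with s hs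
    have h1 : T.comp (frameMap (g s)) = 0 := hzero hs
    have hle : Submodule.span ℝ (range (g s)) ≤ Submodule.span ℝ (range (g t₀)) := by
      rw [← range_frameMap, ← range_frameMap]
      rintro _ ⟨v, rfl⟩
      have h2 : T (frameMap (g s) v) = 0 := congrArg (fun R : (Fin k → ℝ) →L[ℝ] E => R v) h1
      exact ⟨L (frameMap (g s) v), (sub_eq_zero.1 h2).symm⟩
    refine Submodule.eq_of_le_of_finrank_eq hle ?_
    have hinj : Function.Injective (frameMap (g s)) := by
      obtain ⟨U, hU⟩ := (hI hs).2.2.2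
      have : Function.Injective (A s) := by
        refine Function.LeftInverse.injective (g := (U⁻¹ : ((Fin k → ℝ) →L[ℝ] (Fin k → ℝ))ˣ).val)
          fun v => ?_
        rw [← hU]
        exact congrArg (fun R : (Fin k → ℝ) →L[ℝ] (Fin k → ℝ) => R v) U.inv_mul
      exact Function.Injective.of_comp (f := L) this
    rw [← range_frameMap, ← range_frameMap,
      LinearMap.finrank_range_of_inj (f := (frameMap (g s)).toLinearMap) hinj,
      LinearMap.finrank_range_of_inj (f := (frameMap (g t₀)).toLinearMap) (frameMap_injective hi)]
  · intro s hs
    refine LipschitzOnWith.of_dist_le_mul fun X _ Y _ => ?_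
    rw [dist_eq_norm, dist_eq_norm, ← ContinuousLinearMap.sub_comp,
      Real.coe_toNNReal _ (by positivity), mul_comm]
    refine (ContinuousLinearMap.opNorm_comp_le _ _).trans ?_
    gcongr
    exact (hI hs).2.1.le

end SpanConst

/-! ### Smooth solutions of differential equations in a Lie group. -/

section ODE

variable {E : Type*} [NormedAddCommGroup E] [NormedSpace ℝ E] [CompleteSpace E]

/-- Local smooth solutions of a smooth time-dependent ordinary differential equation. -/
lemma exists_smooth_solution {f : ℝ × E → E} {t₀ : ℝ} {x₀ : E}
    (hf : ∀ᶠ z in 𝓝 (t₀, x₀), ContDiffAt ℝ ∞ f z) :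
    ∃ y : ℝ → E, y t₀ = x₀ ∧ ∀ᶠ s in 𝓝 t₀, HasDerivAt y (f (s, y s)) s ∧ ContDiffAt ℝ ∞ y s := by
  -- Adjoining time as a coordinate makes the equation autonomous.
  set F : ℝ × E → ℝ × E := fun z => (1, f z)
  have hF : ∀ᶠ z in 𝓝 (t₀, x₀), ContDiffAt ℝ ∞ F z := hf.mono fun z hz =>
    contDiffAt_const.prodMk hz
  obtain ⟨α, hα0, ε, hε, hα⟩ :=
    (hF.self_of_nhds.of_le (show (1 : WithTop ℕ∞) ≤ ∞ by simp)).exists_forall_mem_closedBall_exists_eq_forall_mem_Ioo_hasDerivAt₀ t₀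
  have ht₀ : t₀ ∈ Ioo (t₀ - ε) (t₀ + ε) := ⟨by linarith, by linarith⟩
  have hfst : ∀ s ∈ Ioo (t₀ - ε) (t₀ + ε), (α s).1 = s := by
    have h1 : ∀ s ∈ Ioo (t₀ - ε) (t₀ + ε), HasDerivAt (fun s => (α s).1 - s) 0 s := fun s hs => by
      have h0 : HasDerivAt (fun s => (α s).1) (F (α s)).1 s :=
        (ContinuousLinearMap.fst ℝ ℝ E).hasFDerivAt.comp_hasDerivAt s (hα s hs)
      have : HasDerivAt (fun s => (α s).1 - s) ((F (α s)).1 - 1) s := h0.sub (hasDerivAt_id s)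
      exact this.congr_deriv (sub_self 1)
    intro s hs
    have h2 := isOpen_Ioo.is_const_of_deriv_eq_zero (isPreconnected_Ioo)
      (fun s hs => (h1 s hs).differentiableAt.differentiableWithinAt)
      (fun s hs => (h1 s hs).deriv) hs ht₀
    simp only [hα0, sub_self] at h2
    linarith
  have hcont : ContinuousAt α t₀ := (hα t₀ ht₀).continuousAt
  have hev : ∀ᶠ s in 𝓝 t₀, ContDiffAt ℝ ∞ F (α s) :=
    hcont.eventually (by rw [hα0]; exact hF)
  obtain ⟨a, b, hab, hI⟩ := mem_nhds_iff_exists_Ioo_subset.1 (hev.and (Ioo_mem_nhds ht₀.1 ht₀.2))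
  refine ⟨fun s => (α s).2, by simp [hα0], ?_⟩
  filter_upwards [Ioo_mem_nhds hab.1 hab.2] with s hs
  constructor
  · have := hasFDerivAt_snd.comp_hasDerivAt s (hα s (hI hs).2)
    have h3 : α s = (s, (α s).2) := Prod.ext (hfst s (hI hs).2) rfl
    rw [← h3]
    exact this
  · obtain ⟨c, hac, hcs⟩ := exists_between hs.1
    obtain ⟨d, hsd, hdb⟩ := exists_between hs.2
    have hsub : Icc c d ⊆ Ioo a b := fun r hr => ⟨hac.trans_le hr.1, hr.2.trans_lt hdb⟩
    have h1 := ODE.contDiffOn_enat_Icc_of_hasDerivWithinAt (n := ⊤) (f := fun _ => F) (α := α)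
      (u := {z | ContDiffAt ℝ ∞ F z}) (tmin := c) (tmax := d)
      (fun z hz => (ContDiffAt.comp (g := F) (f := Prod.snd) z (show ContDiffAt ℝ ∞ F z.2 from hz.2)
        contDiffAt_snd).contDiffWithinAt)
      (fun r hr => (hα r (hI (hsub hr)).2).hasDerivWithinAt)
      (fun r hr => (hI (hsub hr)).1)
    exact (h1.contDiffAt (Icc_mem_nhds hcs hsd)).snd

variable {G : Type*} [TopologicalSpace G] [ChartedSpace E G] [Group G] [LieGroup 𝓘(ℝ, E) ∞ G]

lemma contDiffAt_chartMul_left {a : E} (ha : a ∈ (extChartAt 𝓘(ℝ, E) (1 : G)).target) :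
    ContDiffAt ℝ ∞ (chartMul E G) (a, extChartAt 𝓘(ℝ, E) (1 : G) 1) := by
  rw [← contMDiffAt_iff_contDiffAt]
  have h1 : ContMDiffAt 𝓘(ℝ, E × E) 𝓘(ℝ, E) ∞
      (fun p : E × E => (extChartAt 𝓘(ℝ, E) (1 : G)).symm p.1)
      (a, extChartAt 𝓘(ℝ, E) (1 : G) 1) :=
    ContMDiffAt.comp (x := (a, extChartAt 𝓘(ℝ, E) (1 : G) 1))
      (g := (extChartAt 𝓘(ℝ, E) (1 : G)).symm) (f := Prod.fst)
      ((contMDiffOn_extChartAt_symm (1 : G)).contMDiffAt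
        ((isOpen_extChartAt_target (1 : G)).mem_nhds ha)) contDiff_fst.contMDiff.contMDiffAt
  have h2 : ContMDiffAt 𝓘(ℝ, E × E) 𝓘(ℝ, E) ∞
      (fun p : E × E => (extChartAt 𝓘(ℝ, E) (1 : G)).symm p.2)
      (a, extChartAt 𝓘(ℝ, E) (1 : G) 1) :=
    ContMDiffAt.comp (x := (a, extChartAt 𝓘(ℝ, E) (1 : G) 1))
      (g := (extChartAt 𝓘(ℝ, E) (1 : G)).symm) (f := Prod.snd) (contMDiffAt_chart_symm (1 : G))
      contDiff_snd.contMDiff.contMDiffAt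
  have hs := (extChartAt 𝓘(ℝ, E) (1 : G)).map_target ha
  refine ContMDiffAt.comp_of_eq (g := extChartAt 𝓘(ℝ, E) (1 : G))
    (y := (extChartAt 𝓘(ℝ, E) (1 : G)).symm a)
    (contMDiffAt_extChartAt' (by simpa using hs)) (h1.mul h2) ?_
  simp

/-- Local existence of a smooth curve with prescribed left logarithmic derivative. -/
lemma exists_logVel_eq {Z : ℝ → E} {t₀ : ℝ} (hZ : ∀ᶠ s in 𝓝 t₀, ContDiffAt ℝ ∞ Z s) :
    ∃ r : ℝ → G, r t₀ = 1 ∧ ∀ᶠ s in 𝓝 t₀, ContMDiffAt 𝓘(ℝ, ℝ) 𝓘(ℝ, E) ∞ r s ∧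
      logVel E r s = Z s := by
  set e := extChartAt 𝓘(ℝ, E) (1 : G) 1 with he
  -- The equation r' = r·Z(t) in the chart at `1`: ∂₂ of the multiplication is the left-invariant
  -- field.
  set f : ℝ × E → E := fun z => fderiv ℝ (chartMul E G) (z.2, e) (0, Z z.1)
  have htar := (isOpen_extChartAt_target (I := 𝓘(ℝ, E)) (1 : G)).mem_nhds
    (mem_extChartAt_target (I := 𝓘(ℝ, E)) (1 : G))
  have hf : ∀ᶠ z in 𝓝 (t₀, e), ContDiffAt ℝ ∞ f z := by
    filter_upwards [(continuous_fst.tendsto (t₀, e)).eventually hZ,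
      (continuous_snd.tendsto (t₀, e)).eventually htar] with z h1 h2
    have h3 : ContDiffAt ℝ ∞ (fun z : ℝ × E => fderiv ℝ (chartMul E G) (z.2, e)) z :=
      ContDiffAt.comp (f := fun z : ℝ × E => (z.2, e)) z
        ((contDiffAt_chartMul_left h2).fderiv_right (m := ∞) (by simp))
        (contDiffAt_snd.prodMk contDiffAt_const)
    have h4 : ContDiffAt ℝ ∞ (fun z : ℝ × E => Z z.1) z :=
      ContDiffAt.comp (f := Prod.fst) z h1 contDiffAt_fst
    exact h3.clm_apply (contDiffAt_const.prodMk h4)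
  obtain ⟨y, hy0, hy⟩ := exists_smooth_solution hf
  have hyc : ContinuousAt y t₀ := hy.self_of_nhds.1.continuousAt
  refine ⟨fun s => (extChartAt 𝓘(ℝ, E) (1 : G)).symm (y s), by simp [hy0, he], ?_⟩
  filter_upwards [hy, hyc.eventually (by rw [hy0]; exact htar)] with s h1 h2
  have hs := (extChartAt 𝓘(ℝ, E) (1 : G)).map_target h2
  have hsymm : ContMDiffAt 𝓘(ℝ, E) 𝓘(ℝ, E) ∞ (extChartAt 𝓘(ℝ, E) (1 : G)).symm (y s) :=
    (contMDiffOn_extChartAt_symm (1 : G)).contMDiffAt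
      ((isOpen_extChartAt_target (1 : G)).mem_nhds h2)
  have hr : ContMDiffAt 𝓘(ℝ, ℝ) 𝓘(ℝ, E) ∞
      (fun s => (extChartAt 𝓘(ℝ, E) (1 : G)).symm (y s)) s :=
    hsymm.comp s h1.2.contMDiffAt
  refine ⟨hr, ?_⟩
  rw [logVel_eq (hr.mdifferentiableAt (by simp)),
    der_comp_apply (g := (extChartAt 𝓘(ℝ, E) (1 : G)).symm) (f := y) (y := y s)
      (hsymm.mdifferentiableAt (by simp)) h1.1.differentiableAt.mdifferentiableAt rfl,
    h1.1.der_apply, one_smul]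
  change der E E _ _ (der E E _ _ (fderiv ℝ (chartMul E G) (y s, e) (0, Z s))) = _
  rw [fderiv_chartMul_snd h2 ((contDiffAt_chartMul_left h2).differentiableAt (by simp))]
  set g := (extChartAt 𝓘(ℝ, E) (1 : G)).symm (y s) with hg
  rw [← der_comp_apply (g := (extChartAt 𝓘(ℝ, E) (1 : G)).symm)
    (f := extChartAt 𝓘(ℝ, E) (1 : G)) (x := g) (y := y s)
    (hsymm.mdifferentiableAt (by simp)) (mdiff_chart hs)
    ((extChartAt 𝓘(ℝ, E) (1 : G)).right_inv h2), der_congr (f := fun z => (extChartAt 𝓘(ℝ, E) (1 : G)).symm (extChartAt 𝓘(ℝ, E) (1 : G) z))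
    (g := fun z => z), der_id]
  · rw [ContinuousLinearMap.id_apply, ← der_comp_apply (g := fun h : G => g⁻¹ * h)
      (f := fun h => g * h) (mdiff_mul_left _ _) (mdiff_mul_left _ _) (by simp)]
    simp only [inv_mul_cancel_left, der_id]
    rfl
  · filter_upwards [(isOpen_extChartAt_source (I := 𝓘(ℝ, E)) (1 : G)).mem_nhds hs] with h hh
    exact (extChartAt 𝓘(ℝ, E) (1 : G)).left_inv hh

end ODE

end CartanTractor
end

noncomputable section

namespace CartanTractor

/-! ### Local adapted lifts from a parallel subbundle. -/

namespace CartanGeometry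

variable {EG EP EM EB : Type*}
  [NormedAddCommGroup EG] [NormedSpace ℝ EG] [FiniteDimensional ℝ EG]
  [NormedAddCommGroup EP] [NormedSpace ℝ EP] [FiniteDimensional ℝ EP]
  [NormedAddCommGroup EM] [NormedSpace ℝ EM] [NormedAddCommGroup EB] [NormedSpace ℝ EB]
  {G : Type*} [TopologicalSpace G] [ChartedSpace EG G] [Group G] [LieGroup 𝓘(ℝ, EG) ∞ G]
  {P : Subgroup G} [ChartedSpace EP P] [LieGroup 𝓘(ℝ, EP) ∞ P]
  {M : Type*} [TopologicalSpace M] [ChartedSpace EM M] [IsManifold 𝓘(ℝ, EM) ∞ M]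
  {B : Type*} [TopologicalSpace B] [ChartedSpace EB B] [IsManifold 𝓘(ℝ, EB) ∞ B]
  (C : CartanGeometry EG EP EM EB P M B)
  {γ : ℝ → M} {𝔥 : Submodule ℝ EG}

/-- The curve `σ` in the Cartan bundle is, near `t`, a smooth lift of `γ`; at `t` the Cartan
connection takes a value in `𝔥` on its velocity, and `S` is given by `𝔥` in the frame `σ t`. -/
structure IsAdaptedAt (S : ∀ t : ℝ, Submodule ℝ (C.AdjointTractor (γ t))) (𝔥 : Submodule ℝ EG)
    (σ : ℝ → B) (t : ℝ) : Prop where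
  smooth : ContMDiffAt 𝓘(ℝ, ℝ) 𝓘(ℝ, EB) ∞ σ t
  proj_eq : ∀ᶠ s in 𝓝 t, C.proj (σ s) = γ s
  conn_mem : C.conn (σ t) (der ℝ EB σ t 1) ∈ 𝔥
  map_coord : ∀ u : C.Fiber (γ t), u.1 = σ t → (S t).map (C.coord u) = 𝔥

lemma exists_fiber_lift {J : Set ℝ} (hJ : IsOpen J) {t : ℝ} (ht : t ∈ J)
    (hγ : ContMDiffOn 𝓘(ℝ, ℝ) 𝓘(ℝ, EM) ∞ γ J) (w : C.Fiber (γ t)) :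
    ∃ u : ∀ s, C.Fiber (γ s), u t = w ∧ ∀ᶠ s in 𝓝 t, C.IsSmoothLiftAt u s := by
  classical
  obtain ⟨u₀, hu₀⟩ := C.exists_lift_near hJ ht hγ
  obtain ⟨p, hp⟩ := C.exists_act_eq (hu₀.self_of_nhds.1.trans w.2.symm)
  set u : ∀ s, C.Fiber (γ s) := fun s =>
    if h : C.proj (u₀ s) = γ s then ⟨C.act (u₀ s) p, (C.proj_act _ _).trans h⟩
    else Classical.arbitrary _ with hu
  have huv : ∀ s, C.proj (u₀ s) = γ s → (u s).1 = C.act (u₀ s) p := fun s hs => by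
    simp [hu, hs]
  refine ⟨u, Subtype.ext ((huv t hu₀.self_of_nhds.1).trans hp), ?_⟩
  filter_upwards [hu₀.eventually_nhds] with s hs
  have h1 : ContMDiffAt 𝓘(ℝ, ℝ) 𝓘(ℝ, EB) ∞ (fun s => C.act (u₀ s) p) s :=
    C.contMDiffAt_act_curve hs.self_of_nhds.2 contMDiffAt_const
  exact h1.congr_of_eventuallyEq (hs.mono fun r hr => huv r hr.1)

/-- Ad preserves brackets, so a fibre conjugate to the subalgebra 𝔥 is a subalgebra in every frame.
-/
lemma adMap_mem_map_coord (hLie : ∀ X ∈ 𝔥, ∀ Y ∈ 𝔥, adMap EG G X Y ∈ 𝔥) {x : M}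
    {S : Submodule ℝ (C.AdjointTractor x)} {w : C.Fiber x} (hw : S.map (C.coord w) = 𝔥)
    (v : C.Fiber x) {a b : C.AdjointTractor x} (ha : a ∈ S) (hb : b ∈ S) :
    adMap EG G (C.coord v a) (C.coord v b) ∈ S.map (C.coord v) := by
  obtain ⟨p, hp⟩ := C.exists_fiber_act w v
  have h1 : adMap EG G (C.coord w a) (C.coord w b) ∈ 𝔥 :=
    hLie _ (hw ▸ ⟨a, ha, rfl⟩) _ (hw ▸ ⟨b, hb, rfl⟩)
  rw [← hw] at h1
  obtain ⟨c, hc, hcw⟩ := h1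
  refine ⟨c, hc, ?_⟩
  rw [C.coord_of_act hp, C.coord_of_act hp, C.coord_of_act hp, hcw, adjointMap_adMap]

variable (hP : IsClosedLieSubgroup EG EP P)
include hP

/-- If `S` projects onto the tangent line of `γ`, then a multiple of a suitable section of `S`
differs from the velocity of a lift by a smooth curve in the Lie algebra of `P`. -/
lemma exists_smooth_correction {S : ∀ t : ℝ, Submodule ℝ (C.AdjointTractor (γ t))} {J : Set ℝ}
    (hJ : IsOpen J) {t₀ : ℝ} (ht₀ : t₀ ∈ J)
    (hγ' : velocity EM γ t₀ ≠ 0)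
    (hS : ∀ t ∈ J, ∀ u : C.Fiber (γ t),
      (S t).map (C.anchor u) = Submodule.span ℝ {velocity EM γ t})
    {k : ℕ} {e : Fin k → ∀ t : ℝ, C.AdjointTractor (γ t)}
    (he : ∀ i, C.IsSmoothSectionOn (e i) J)
    (hspan : ∀ t ∈ J, Submodule.span ℝ (range fun i => e i t) = S t)
    {u : ∀ s, C.Fiber (γ s)} (hu : ∀ᶠ s in 𝓝 t₀, C.IsSmoothLiftAt u s) :
    ∃ Z : ℝ → EP, ∀ᶠ s in 𝓝 t₀, ContDiffAt ℝ ∞ Z s ∧ ∃ a ∈ S s, C.coord (u s) a =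
      C.conn (u s).1 (der ℝ EB (fun s => (u s).1) s 1) + inclMap EG EP P (Z s) := by
  set ξ : ℝ → EG := fun s => C.conn (u s).1 (der ℝ EB (fun s => (u s).1) s 1) with hξ
  have hξs : ∀ᶠ s in 𝓝 t₀, ContDiffAt ℝ ∞ ξ s := by
    filter_upwards [hu.eventually_nhds] with s hs using C.contDiffAt_conn_velocity hs
  set D : ∀ s, EG → EM := fun s X => der EB EM C.proj (u s).1 (C.connInv (u s).1 X) with hD
  have hDξ : ∀ s, C.IsSmoothLiftAt u s → D s (ξ s) = velocity EM γ s := fun s hs => by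
    rw [hD, hξ]
    simp only [connInv_conn]
    exact C.der_proj_lift (u := fun s => (u s).1) (ContMDiffAt.mdifferentiableAt hs (by simp))
      (Eventually.of_forall fun s => (u s).2)
  have hker : ∀ s X, D s X = 0 → X ∈ subLie EG EP P := fun s X h => by
    have := C.conn_mem_of_der_proj_eq_zero (ξ := C.connInv (u s).1 X) h
    rwa [conn_connInv] at this
  have hDr : ∀ s ∈ J, ∀ a ∈ S s, ∃ r : ℝ, r • velocity EM γ s = D s (C.coord (u s) a) :=
    fun s hs a ha => by
      have h1 : C.anchor (u s) a ∈ (S s).map (C.anchor (u s)) := ⟨a, ha, rfl⟩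
      rw [hS s hs] at h1
      exact Submodule.mem_span_singleton.1 h1
  have heS : ∀ s ∈ J, ∀ i, e i s ∈ S s := fun s hs i => by
    rw [← hspan s hs]; exact Submodule.subset_span ⟨i, rfl⟩
  -- If the whole frame were in 𝔭, the projection would kill S at t₀, although its image contains
  -- the nonzero velocity.
  obtain ⟨i, hi⟩ : ∃ i, C.coord (u t₀) (e i t₀) ∉ subLie EG EP P := by
    by_contra! hcon
    have h1 : (S t₀).map (C.anchor (u t₀)) ≤ ⊥ := by
      rw [← hspan t₀ ht₀, Submodule.map_span, Submodule.span_le]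
      rintro _ ⟨_, ⟨i, rfl⟩, rfl⟩
      exact C.der_proj_connInv_eq_zero (u := (u t₀).1) (hcon i)
    rw [hS t₀ ht₀, le_bot_iff, Submodule.span_singleton_eq_bot] at h1
    exact hγ' h1
  set f : ℝ → EG := fun s => C.coord (u s) (e i s) with hf
  have hfs : ∀ᶠ s in 𝓝 t₀, ContDiffAt ℝ ∞ f s := by
    filter_upwards [hu, hJ.mem_nhds ht₀] with s hs hsJ using he i s hsJ u hs
  obtain ⟨φ, hφ, hφ0⟩ := exists_clm_of_notMem hi
  have hφf : ∀ᶠ s in 𝓝 t₀, φ (f s) ≠ 0 :=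
    (φ.continuous.continuousAt.comp hfs.self_of_nhds.continuousAt).eventually_ne hφ
  obtain ⟨L, hL⟩ := hP.exists_leftInverse
  -- Modulo 𝔭, f = rξ for some r. As φ vanishes on 𝔭, the ratio φ(ξ)/φ(f) is r⁻¹, now visibly smooth
  -- in `s`; `L` inverts the inclusion of 𝔭.
  refine ⟨fun s => L ((φ (ξ s) / φ (f s)) • f s - ξ s), ?_⟩
  filter_upwards [hu, hJ.mem_nhds ht₀, hξs, hfs, hφf] with s h1 h2 h3 h4 h5
  constructor
  · exact L.contDiff.contDiffAt.comp s ((((φ.contDiff.contDiffAt.comp s h3).div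
      (φ.contDiff.contDiffAt.comp s h4) h5).smul h4).sub h3)
  · refine ⟨(φ (ξ s) / φ (f s)) • e i s, (S s).smul_mem _ (heS s h2 i), ?_⟩
    obtain ⟨r, hr⟩ := hDr s h2 _ (heS s h2 i)
    have h6 : f s - r • ξ s ∈ subLie EG EP P := by
      apply hker s
      have : D s (f s - r • ξ s) = D s (f s) - r • D s (ξ s) := by
        simp only [hD, map_sub, map_smul]
      have hr' : D s (f s) = r • D s (ξ s) := by rw [hDξ s h1]; exact hr.symm
      rw [this, hr', sub_self]
    have h7 : φ (f s) = r * φ (ξ s) := by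
      have := hφ0 _ h6
      rw [map_sub, map_smul, smul_eq_mul] at this
      linarith
    have hr0 : r ≠ 0 := by rintro rfl; exact h5 (by rw [h7, zero_mul])
    have hξ0 : φ (ξ s) ≠ 0 := by intro h; exact h5 (by rw [h7, h, mul_zero])
    have h8 : (φ (ξ s) / φ (f s)) • f s - ξ s = r⁻¹ • (f s - r • ξ s) := by
      have : φ (ξ s) / φ (f s) = r⁻¹ := by rw [h7]; field_simp
      rw [this, smul_sub, inv_smul_smul₀ hr0]
    have h9 : (φ (ξ s) / φ (f s)) • f s - ξ s ∈ subLie EG EP P := by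
      rw [h8]; exact Submodule.smul_mem _ _ h6
    obtain ⟨W, hW⟩ := h9
    have h10 : inclMap EG EP P (L ((φ (ξ s) / φ (f s)) • f s - ξ s)) =
        (φ (ξ s) / φ (f s)) • f s - ξ s := by
      rw [← hW]
      exact congrArg (inclMap EG EP P) (hL W)
    change C.coord (u s) _ = ξ s + _
    rw [h10, map_smul]
    abel

lemma exists_isAdaptedAt_near (hLie : ∀ X ∈ 𝔥, ∀ Y ∈ 𝔥, adMap EG G X Y ∈ 𝔥)
    {S : ∀ t : ℝ, Submodule ℝ (C.AdjointTractor (γ t))} {J : Set ℝ}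
    (hγ : ContMDiffOn 𝓘(ℝ, ℝ) 𝓘(ℝ, EM) ∞ γ J) (hγ' : ∀ t ∈ J, velocity EM γ t ≠ 0)
    (h0 : C.IsSmoothSubbundle S J)
    (h1 : ∀ t ∈ J, ∃ u : C.Fiber (γ t), (S t).map (C.coord u) = 𝔥)
    (h2 : ∀ t ∈ J, ∀ u : C.Fiber (γ t),
      (S t).map (C.anchor u) = Submodule.span ℝ {velocity EM γ t})
    (h3 : C.IsPreserved S J) {t₀ : ℝ} (ht₀ : t₀ ∈ J) :
    ∃ σ : ℝ → B, ∀ᶠ t in 𝓝 t₀, C.IsAdaptedAt S 𝔥 σ t := by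
  obtain ⟨U, hU, htU, hUJ, k, e, he, heU⟩ := h0 t₀ ht₀
  obtain ⟨w, hw⟩ := h1 t₀ ht₀
  obtain ⟨u, huw, hu⟩ := C.exists_fiber_lift hU htU (hγ.mono hUJ) w
  obtain ⟨Z, hZ⟩ := C.exists_smooth_correction hP hU htU (hγ' t₀ ht₀)
    (fun t ht => h2 t (hUJ ht)) he (fun t ht => (heU t ht).2) hu
  -- For v = u r⁻¹ the gauge rule gives ω(v') = Ad(r)(ω(u') - r⁻¹r'), so r⁻¹r' = -Z produces
  -- Ad(r)(ω(u') + Z), an element of S in the frame v.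
  obtain ⟨r, hr0, hr⟩ := exists_logVel_eq (G := P) (Z := fun s => - Z s)
    (hZ.mono fun s hs => hs.1.neg)
  set v : ∀ s, C.Fiber (γ s) := fun s => C.fiberAct (u s) (r s)⁻¹ with hv
  have hvact : ∀ s, (v s).1 = C.act (u s).1 (r s)⁻¹ := fun s => rfl
  have hvs : ∀ᶠ s in 𝓝 t₀, C.IsSmoothLiftAt v s := by
    filter_upwards [hu, hr] with s hus hrs
    exact C.contMDiffAt_act_curve hus hrs.1.inv
  have hvel : ∀ᶠ s in 𝓝 t₀,
      C.conn (v s).1 (der ℝ EB (fun s => (v s).1) s 1) ∈ (S s).map (C.coord (v s)) := by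
    filter_upwards [hu, hr, hZ] with s hus hrs hZs
    obtain ⟨-, a, ha, haZ⟩ := hZs
    have hrm := hrs.1.mdifferentiableAt (n := ∞) (by simp)
    refine ⟨a, ha, ?_⟩
    rw [hvact]
    simp only [hvact]
    rw [C.conn_velocity_act (ContMDiffAt.mdifferentiableAt hus (by simp)) (mdiff_inv hrm),
      C.coord_of_act (hvact s), haZ, logVel_inv hrm, hrs.2]
    simp only [map_neg, neg_neg, map_add]
    rw [← hP.adjointMap_inclMap, Subgroup.coe_inv, inv_inv]
  set g : ℝ → Fin k → EG := fun s i => C.coord (v s) (e i s) with hg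
  have hgs : ∀ᶠ s in 𝓝 t₀, ContDiffAt ℝ ∞ g s := by
    filter_upwards [hvs, hU.mem_nhds htU] with s hs hsU
    exact contDiffAt_pi.2 fun i => he i s hsU v hs
  have hgspan : ∀ s ∈ U, Submodule.span ℝ (range (g s)) = (S s).map (C.coord (v s)) := by
    intro s hs
    rw [← (heU s hs).2, Submodule.map_span, ← range_comp]
    rfl
  have hgd : ∀ᶠ s in 𝓝 t₀, HasDerivAt g (deriv g s) s :=
    hgs.mono fun s hs => (hs.differentiableAt (by simp)).hasDerivAt
  have hgc : ContinuousAt (deriv g) t₀ := by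
    have h4 := (hgs.self_of_nhds.fderiv_right (m := 0) (by simp)).continuousAt
    have : deriv g = fun s => fderiv ℝ g s 1 := by ext; simp
    rw [this]
    exact h4.clm_apply continuousAt_const
  -- The ordinary derivative is the tractor derivative minus [ω(v'), ·]; both terms lie in S, which
  -- is a subalgebra containing ω(v') in this frame.
  have hgm : ∀ᶠ s in 𝓝 t₀, ∀ j, deriv g s j ∈ Submodule.span ℝ (range (g s)) := by
    filter_upwards [hgd, hvel, hvs, hU.mem_nhds htU] with s hd hve hvss hsU j
    have hej : ∀ t ∈ U, e j t ∈ S t := fun t ht => by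
      rw [← (heU t ht).2]; exact Submodule.subset_span ⟨j, rfl⟩
    obtain ⟨b, hb, hbd⟩ := h3 U hU hUJ (e j) (he j) hej s hsU
    have h5 : HasDerivAt (fun s => C.coord (v s) (e j s)) (C.coord (v s) b -
        adMap EG G (C.conn (v s).1 (der ℝ EB (fun s => (v s).1) s 1))
          (C.coord (v s) (e j s))) s := by
      rw [← lieBr_eq_adMap]
      exact hbd v hvss
    have h6 := (hasDerivAt_pi.1 hd j).unique h5
    rw [h6, hgspan s hsU]
    obtain ⟨w', hw'⟩ := h1 s (hUJ hsU)
    obtain ⟨a, ha, hav⟩ := hve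
    refine Submodule.sub_mem _ ⟨b, hb, rfl⟩ ?_
    rw [← hav]
    exact C.adMap_mem_map_coord hLie hw' (v s) ha (hej s hsU)
  have hgi : LinearIndependent ℝ (g t₀) :=
    (heU t₀ htU).1.map' (C.coord (v t₀)) (LinearMap.ker_eq_bot.2 (C.coord_injective _))
  have hconst := eventually_span_eq hgd hgc hgm hgi
  have hvt : v t₀ = w := by
    rw [← huw]
    refine Subtype.ext ?_
    rw [hvact, hr0, inv_one, C.act_one]
  have hmap : ∀ᶠ s in 𝓝 t₀, (S s).map (C.coord (v s)) = 𝔥 := by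
    filter_upwards [hconst, hU.mem_nhds htU] with s hs hsU
    rw [← hgspan s hsU, hs, hgspan t₀ htU, hvt, hw]
  refine ⟨fun s => (v s).1, ?_⟩
  filter_upwards [hvs, hvel, hmap] with s h4 h5 h6
  refine ⟨h4, Eventually.of_forall fun s => (v s).2, h6 ▸ h5, fun x hx => ?_⟩
  rw [show x = v s from Subtype.ext hx, h6]

end CartanGeometry

end CartanTractor
end

noncomputable section

namespace CartanTractor

/-! ### Gluing local solutions along an interval. -/

section Gluing

/-- A smooth map that is the identity near `c` and takes values in a given neighbourhood of `c`. -/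
lemma exists_smooth_contraction (c : ℝ) {ε : ℝ} (hε : 0 < ε) :
    ∃ φ : ℝ → ℝ, ContDiff ℝ ∞ φ ∧ (∀ᶠ t in 𝓝 c, φ t = t) ∧ ∀ t, φ t ∈ Ioo (c - ε) (c + ε) := by
  set f : ContDiffBump c := ⟨ε / 4, ε / 2, by linarith, by linarith⟩ with hf
  refine ⟨fun t => c + f t * (t - c),
    contDiff_const.add (f.contDiff.mul (contDiff_id.sub contDiff_const)), ?_, fun t => ?_⟩
  · filter_upwards [f.eventuallyEq_one] with t ht
    simp [ht]
  · have h : |f t * (t - c)| < ε := by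
      by_cases ht : ε / 2 ≤ dist t c
      · rw [f.zero_of_le_dist ht, zero_mul, abs_zero]; exact hε
      · rw [abs_mul, abs_of_nonneg f.nonneg]
        have h1 : |t - c| < ε / 2 := by rw [← Real.dist_eq]; exact not_le.1 ht
        nlinarith [f.le_one (x := t), f.nonneg (x := t), abs_nonneg (t - c)]
    rw [abs_lt] at h
    constructor <;> linarith

variable {B : Type*} {Q : (ℝ → B) → ℝ → Prop}

/-- Two functions that agree near `c` can be concatenated at `c`, for a property of germs. -/
lemma glue_at (hQ : ∀ σ τ t, σ =ᶠ[𝓝 t] τ → Q σ t → Q τ t) {σ τ : ℝ → B} {c : ℝ}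
    (h : σ =ᶠ[𝓝 c] τ) : ∃ ρ : ℝ → B, EqOn ρ σ (Iic c) ∧ EqOn ρ τ (Ici c) ∧
      (∀ t ≤ c, Q σ t → Q ρ t) ∧ ∀ t, c ≤ t → Q τ t → Q ρ t := by
  have hc : (fun t => if t ≤ c then σ t else τ t) =ᶠ[𝓝 c] σ := by
    filter_upwards [h] with t ht
    split_ifs
    exacts [rfl, ht.symm]
  refine ⟨fun t => if t ≤ c then σ t else τ t, fun t ht => if_pos ht, fun t ht => ?_,
    fun t ht hσ => ?_, fun t ht hτ => ?_⟩
  · rcases (show c ≤ t from ht).eq_or_lt with rfl | h'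
    · simp [h.self_of_nhds]
    · simp [h'.not_ge]
  · rcases ht.eq_or_lt with rfl | h'
    · exact hQ _ _ _ hc.symm hσ
    · refine hQ _ _ _ ?_ hσ
      filter_upwards [Iio_mem_nhds h'] with s hs
      exact (if_pos (le_of_lt hs)).symm
  · rcases ht.eq_or_lt with rfl | h'
    · exact hQ _ _ _ (hc.trans h).symm hτ
    · refine hQ _ _ _ ?_ hτ
      filter_upwards [Ioi_mem_nhds h'] with s hs
      exact (if_neg (not_le.2 hs)).symm

/-- The endpoints are the minimum and maximum of the first n + 1 terms of a dense sequence in J,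
which treats bounded and unbounded J alike. -/
lemma exists_Ioo_exhaustion {J : Set ℝ} (hJ : IsOpen J) (hne : J.Nonempty) :
    ∃ a b : ℕ → ℝ, Antitone a ∧ Monotone b ∧ (∀ n, a n ∈ J) ∧ (∀ n, b n ∈ J) ∧
      (∀ n, a n ≤ b n) ∧ ∀ t ∈ J, ∃ n, t ∈ Ioo (a n) (b n) := by
  have : Nonempty J := hne.to_subtype
  set d : ℕ → ℝ := fun n => (TopologicalSpace.denseSeq J n : ℝ) with hd
  have hdJ : ∀ n, d n ∈ J := fun n => (TopologicalSpace.denseSeq J n).2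
  have hex : ∀ U : Set ℝ, IsOpen U → (U ∩ J).Nonempty → ∃ n, d n ∈ U := by
    rintro U hU ⟨x, hxU, hxJ⟩
    obtain ⟨n, hn⟩ := (TopologicalSpace.denseRange_denseSeq J).exists_mem_open
      (hU.preimage continuous_subtype_val) ⟨⟨x, hxJ⟩, hxU⟩
    exact ⟨n, hn⟩
  have hN : ∀ n : ℕ, (Finset.range (n + 1)).Nonempty := fun n => ⟨0, by simp⟩
  refine ⟨fun n => (Finset.range (n + 1)).inf' (hN n) d, fun n => (Finset.range (n + 1)).sup' (hN n) d,
    fun m n h => ?_, fun m n h => ?_, fun n => ?_, fun n => ?_, fun n => ?_, fun t ht => ?_⟩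
  · exact Finset.inf'_mono d (Finset.range_mono (by omega)) _
  · exact Finset.sup'_mono d (Finset.range_mono (by omega)) _
  · obtain ⟨i, -, hi⟩ := Finset.exists_mem_eq_inf' (hN n) d
    simp only [hi]; exact hdJ i
  · obtain ⟨i, -, hi⟩ := Finset.exists_mem_eq_sup' (hN n) d
    simp only [hi]; exact hdJ i
  · exact (Finset.inf'_le d (Finset.mem_range.2 n.succ_pos)).trans
      (Finset.le_sup' d (Finset.mem_range.2 n.succ_pos))
  · obtain ⟨l, u, htlu, hsub⟩ := mem_nhds_iff_exists_Ioo_subset.1 (hJ.mem_nhds ht)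
    obtain ⟨x, hx1, hx2⟩ := exists_between htlu.1
    obtain ⟨y, hy1, hy2⟩ := exists_between htlu.2
    obtain ⟨i, hi⟩ := hex (Iio t) isOpen_Iio ⟨x, hx2, hsub ⟨hx1, hx2.trans htlu.2⟩⟩
    obtain ⟨j, hj⟩ := hex (Ioi t) isOpen_Ioi ⟨y, hy1, hsub ⟨htlu.1.trans hy1, hy2⟩⟩
    refine ⟨max i j, (Finset.inf'_le d (Finset.mem_range.2 ?_)).trans_lt hi,
      lt_of_lt_of_le hj (Finset.le_sup' d (Finset.mem_range.2 ?_))⟩ <;> omega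

/-- A property of germs of functions on an open interval that holds locally, and for which every
germ at a point can be prolonged to wherever some function with a germ at this point is defined,
holds globally for some function. -/
lemma exists_global (hQ : ∀ σ τ t, σ =ᶠ[𝓝 t] τ → Q σ t → Q τ t)
    (hext : ∀ σ τ c, Q σ c → Q τ c → ∃ ρ : ℝ → B, ρ =ᶠ[𝓝 c] σ ∧ ∀ t, Q τ t → Q ρ t)
    {J : Set ℝ} (hJ : IsOpen J) (hJc : J.OrdConnected) (hne : J.Nonempty)
    (hloc : ∀ t ∈ J, ∃ σ : ℝ → B, ∀ᶠ s in 𝓝 t, Q σ s) : ∃ σ : ℝ → B, ∀ t ∈ J, Q σ t := by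
  have hright : ∀ {σ τ : ℝ → B} {c : ℝ}, Q σ c → Q τ c → ∃ ρ : ℝ → B, EqOn ρ σ (Iic c) ∧
      (∀ t ≤ c, Q σ t → Q ρ t) ∧ ∀ t, c ≤ t → Q τ t → Q ρ t := by
    intro σ τ c h1 h2
    obtain ⟨τ', h3, h4⟩ := hext σ τ c h1 h2
    obtain ⟨ρ, h5, -, h6, h7⟩ := glue_at hQ h3.symm
    exact ⟨ρ, h5, h6, fun t ht h => h7 t ht (h4 t h)⟩
  have hleft : ∀ {σ τ : ℝ → B} {c : ℝ}, Q σ c → Q τ c → ∃ ρ : ℝ → B, EqOn ρ τ (Ici c) ∧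
      (∀ t ≤ c, Q σ t → Q ρ t) ∧ ∀ t, c ≤ t → Q τ t → Q ρ t := by
    intro σ τ c h1 h2
    obtain ⟨σ', h3, h4⟩ := hext τ σ c h2 h1
    obtain ⟨ρ, -, h5, h6, h7⟩ := glue_at hQ h3
    exact ⟨ρ, h5, fun t ht h => h6 t ht (h4 t h), h7⟩
  -- Having a common solution on the segment between two points is a local, symmetric and transitive
  -- relation, so connectedness gives it for all pairs. Concatenation is needed only when y lies
  -- between x and z.
  have hcomp : ∀ x ∈ J, ∀ y ∈ J, ∃ σ : ℝ → B, ∀ t ∈ uIcc x y, Q σ t := by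
    intro x hx y hy
    refine hJc.isPreconnected.induction₂ (fun x y => ∃ σ : ℝ → B, ∀ t ∈ uIcc x y, Q σ t)
      (fun x hx => ?_) ?_ ?_ hx hy
    · obtain ⟨σ, hσ⟩ := hloc x hx
      obtain ⟨l, u, hlu, hsub⟩ := mem_nhds_iff_exists_Ioo_subset.1 hσ
      refine mem_nhdsWithin_of_mem_nhds ?_
      filter_upwards [Ioo_mem_nhds hlu.1 hlu.2] with y hy
      exact ⟨σ, fun t ht => hsub (ordConnected_Ioo.uIcc_subset hlu hy ht)⟩
    · rintro x y z - - - ⟨σ, hσ⟩ ⟨τ, hτ⟩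
      by_cases h1 : z ∈ uIcc x y
      · exact ⟨σ, fun t ht => hσ t (uIcc_subset_uIcc_left h1 ht)⟩
      by_cases h2 : x ∈ uIcc y z
      · exact ⟨τ, fun t ht => hτ t (uIcc_subset_uIcc_right h2 ht)⟩
      rcases le_total x y with hxy | hxy
      · have hyz : y ≤ z := by
          rw [mem_uIcc] at h1 h2
          by_contra! h
          rcases le_total x z with h3 | h3
          · exact h1 (Or.inl ⟨h3, h.le⟩)
          · exact h2 (Or.inr ⟨h3, hxy⟩)
        obtain ⟨ρ, -, h3, h4⟩ := hright (hσ y right_mem_uIcc) (hτ y left_mem_uIcc)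
        rw [uIcc_of_le hxy] at hσ
        rw [uIcc_of_le hyz] at hτ
        rw [uIcc_of_le (hxy.trans hyz)]
        refine ⟨ρ, fun t ht => ?_⟩
        rcases le_total t y with h | h
        exacts [h3 t h (hσ t ⟨ht.1, h⟩), h4 t h (hτ t ⟨h, ht.2⟩)]
      · have hyz : z ≤ y := by
          rw [mem_uIcc] at h1 h2
          by_contra! h
          rcases le_total x z with h3 | h3
          · exact h2 (Or.inl ⟨hxy, h3⟩)
          · exact h1 (Or.inr ⟨h.le, h3⟩)
        obtain ⟨ρ, -, h3, h4⟩ := hright (hτ y left_mem_uIcc) (hσ y right_mem_uIcc)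
        rw [uIcc_of_ge hxy] at hσ
        rw [uIcc_of_ge hyz] at hτ
        rw [uIcc_of_ge (hyz.trans hxy)]
        refine ⟨ρ, fun t ht => ?_⟩
        rcases le_total t y with h | h
        exacts [h3 t h (hτ t ⟨ht.1, h⟩), h4 t h (hσ t ⟨h, ht.2⟩)]
    · rintro x y - - ⟨σ, hσ⟩
      exact ⟨σ, by rwa [uIcc_comm]⟩
  obtain ⟨a, b, ha, hb, haJ, hbJ, hab, hcov⟩ := exists_Ioo_exhaustion hJ hne
  have hstep : ∀ n (σ : {σ : ℝ → B // ∀ t ∈ Icc (a n) (b n), Q σ t}),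
      ∃ τ : {τ : ℝ → B // ∀ t ∈ Icc (a (n + 1)) (b (n + 1)), Q τ t},
        EqOn τ.1 σ.1 (Icc (a n) (b n)) := by
    rintro n ⟨σ, hσ⟩
    obtain ⟨τ₁, h1⟩ := hcomp _ (haJ (n + 1)) _ (haJ n)
    obtain ⟨τ₂, h2⟩ := hcomp _ (hbJ n) _ (hbJ (n + 1))
    rw [uIcc_of_le (ha n.le_succ)] at h1
    rw [uIcc_of_le (hb n.le_succ)] at h2
    obtain ⟨ρ, h3, h4, h5⟩ := hright (hσ (b n) ⟨hab n, le_rfl⟩) (h2 (b n) ⟨le_rfl, hb n.le_succ⟩)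
    obtain ⟨χ, h6, h7, h8⟩ := hleft (h1 (a n) ⟨ha n.le_succ, le_rfl⟩)
      (h4 (a n) (hab n) (hσ (a n) ⟨le_rfl, hab n⟩))
    refine ⟨⟨χ, fun t ht => ?_⟩, fun t ht => (h6 ht.1).trans (h3 ht.2)⟩
    rcases le_total t (a n) with h | h
    · exact h7 t h (h1 t ⟨ht.1, h⟩)
    · refine h8 t h ?_
      rcases le_total t (b n) with h' | h'
      exacts [h4 t h' (hσ t ⟨h, h'⟩), h5 t h' (h2 t ⟨h', ht.2⟩)]
  choose next hnext using hstep
  obtain ⟨σ₀, hσ₀⟩ := hcomp _ (haJ 0) _ (hbJ 0)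
  rw [uIcc_of_le (hab 0)] at hσ₀
  let s : ∀ n, {σ : ℝ → B // ∀ t ∈ Icc (a n) (b n), Q σ t} := fun n =>
    Nat.rec ⟨σ₀, hσ₀⟩ (fun n σ => next n σ) n
  have hs : ∀ n, EqOn (s (n + 1)).1 (s n).1 (Icc (a n) (b n)) := fun n => hnext n (s n)
  have hs' : ∀ m n, m ≤ n → EqOn (s n).1 (s m).1 (Icc (a m) (b m)) := by
    intro m n hmn
    induction n, hmn using Nat.le_induction with
    | base => exact fun _ _ => rfl
    | succ n hmn ih =>
      exact fun t ht => (hs n (Icc_subset_Icc (ha hmn) (hb hmn) ht)).trans (ih ht)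
  classical
  -- Each stage extends the earlier ones, so on the n-th open interval the value at the first
  -- admissible index agrees with the n-th solution.
  refine ⟨fun t => if h : ∃ n, t ∈ Ioo (a n) (b n) then (s (Nat.find h)).1 t else σ₀ t,
    fun t ht => ?_⟩
  obtain ⟨n, hn⟩ := hcov t ht
  refine hQ (s n).1 _ t ?_ ((s n).2 t (Ioo_subset_Icc_self hn))
  filter_upwards [Ioo_mem_nhds hn.1 hn.2] with r hr
  have h : ∃ n, r ∈ Ioo (a n) (b n) := ⟨n, hr⟩
  rw [dif_pos h]
  exact hs' _ _ (Nat.find_min' h hr) (Ioo_subset_Icc_self (Nat.find_spec h))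

end Gluing

/-! ### Prolonging adapted lifts and the converse direction. -/

namespace CartanGeometry

variable {EG EP EM EB : Type*}
  [NormedAddCommGroup EG] [NormedSpace ℝ EG] [FiniteDimensional ℝ EG]
  [NormedAddCommGroup EP] [NormedSpace ℝ EP] [FiniteDimensional ℝ EP]
  [NormedAddCommGroup EM] [NormedSpace ℝ EM] [NormedAddCommGroup EB] [NormedSpace ℝ EB]
  {G : Type*} [TopologicalSpace G] [ChartedSpace EG G] [Group G] [LieGroup 𝓘(ℝ, EG) ∞ G]
  {P : Subgroup G} [ChartedSpace EP P] [LieGroup 𝓘(ℝ, EP) ∞ P]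
  {M : Type*} [TopologicalSpace M] [ChartedSpace EM M] [IsManifold 𝓘(ℝ, EM) ∞ M]
  {B : Type*} [TopologicalSpace B] [ChartedSpace EB B] [IsManifold 𝓘(ℝ, EB) ∞ B]
  (C : CartanGeometry EG EP EM EB P M B)
  {γ : ℝ → M} {𝔥 : Submodule ℝ EG} {S : ∀ t : ℝ, Submodule ℝ (C.AdjointTractor (γ t))}

lemma map_coord_of_act {x : M} {u v : C.Fiber x} {p : P} (h : v.1 = C.act u.1 p)
    (T : Submodule ℝ (C.AdjointTractor x)) :
    T.map (C.coord v) = (T.map (C.coord u)).map (adjointMap EG (p : G)⁻¹).toLinearMap := by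
  rw [← Submodule.map_comp]
  congr 1
  ext a
  exact C.coord_of_act h a

lemma IsAdaptedAt.congr {σ τ : ℝ → B} {t : ℝ} (h : C.IsAdaptedAt S 𝔥 σ t) (hστ : σ =ᶠ[𝓝 t] τ) :
    C.IsAdaptedAt S 𝔥 τ t where
  smooth := h.smooth.congr_of_eventuallyEq hστ.symm
  proj_eq := by filter_upwards [hστ, h.proj_eq] with s h1 h2; rw [← h1, h2]
  conn_mem := by rw [← der_congr hστ, ← hστ.self_of_nhds]; exact h.conn_mem
  map_coord := fun u hu => h.map_coord u (hu.trans hστ.self_of_nhds.symm)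

/-- A germ of an adapted lift can be prolonged to wherever some adapted lift is defined. -/
lemma exists_prolongation {σ τ : ℝ → B} {c : ℝ} (hσ : ∀ᶠ t in 𝓝 c, C.IsAdaptedAt S 𝔥 σ t)
    (hτ : ∀ᶠ t in 𝓝 c, C.IsAdaptedAt S 𝔥 τ t) :
    ∃ ρ : ℝ → B, ρ =ᶠ[𝓝 c] σ ∧ ∀ t, C.IsAdaptedAt S 𝔥 τ t → C.IsAdaptedAt S 𝔥 ρ t := by
  obtain ⟨ε, hε, hball⟩ := Metric.eventually_nhds_iff_ball.1 (hσ.and hτ)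
  simp only [Real.ball_eq_Ioo] at hball
  obtain ⟨φ, hφ, hφc, hφI⟩ := exists_smooth_contraction c hε
  -- The default `1` outside the interval is never used, since `r` is only evaluated at values of φ.
  -- Inside, freeness of the action makes the pointwise choice agree with the smooth difference of
  -- the lifts.
  have hr : ∀ s, ∃ r : P, s ∈ Ioo (c - ε) (c + ε) → σ s = C.act (τ s) r := by
    intro s
    by_cases hs : s ∈ Ioo (c - ε) (c + ε)
    · obtain ⟨p, hp⟩ := C.exists_act_eq (u := τ s) (v := σ s)
        ((hball s hs).2.proj_eq.self_of_nhds.trans (hball s hs).1.proj_eq.self_of_nhds.symm)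
      exact ⟨p, fun _ => hp.symm⟩
    · exact ⟨1, fun h => absurd h hs⟩
  choose r hr using hr
  have hev : ∀ s ∈ Ioo (c - ε) (c + ε), σ =ᶠ[𝓝 s] fun s => C.act (τ s) (r s) := fun s hs => by
    filter_upwards [Ioo_mem_nhds hs.1 hs.2] with x hx using hr x hx
  have hrs : ∀ s ∈ Ioo (c - ε) (c + ε), ContMDiffAt 𝓘(ℝ, ℝ) 𝓘(ℝ, EP) ∞ r s := by
    intro s hs
    obtain ⟨p, hp, hpe⟩ := C.exists_difference (hball s hs).2.smooth (hball s hs).1.smooth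
      (by filter_upwards [(hball s hs).1.proj_eq, (hball s hs).2.proj_eq] with x h1 h2
          rw [h1, h2])
    refine hp.congr_of_eventuallyEq ?_
    filter_upwards [hpe, hev s hs] with x h1 h2
    exact C.act_right_injective (τ x) (h2.symm.trans h1)
  have hmap : ∀ s ∈ Ioo (c - ε) (c + ε),
      𝔥.map (adjointMap EG (r s : G)⁻¹).toLinearMap = 𝔥 := by
    intro s hs
    obtain ⟨h1, h2⟩ := hball s hs
    let u : C.Fiber (γ s) := ⟨τ s, h2.proj_eq.self_of_nhds⟩
    let v : C.Fiber (γ s) := ⟨σ s, h1.proj_eq.self_of_nhds⟩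
    have h3 := C.map_coord_of_act (u := u) (v := v) (hr s hs) (S s)
    rw [h1.map_coord v rfl, h2.map_coord u rfl] at h3
    exact h3.symm
  have hAd : ∀ s ∈ Ioo (c - ε) (c + ε), ∀ X ∈ 𝔥, adjointMap EG (r s : G)⁻¹ X ∈ 𝔥 :=
    fun s hs X hX => by
      have h : adjointMap EG (r s : G)⁻¹ X ∈ 𝔥.map (adjointMap EG (r s : G)⁻¹).toLinearMap :=
        ⟨X, hX, rfl⟩
      rwa [hmap s hs] at h
  -- By the gauge rule, r⁻¹r' = ω(σ') - Ad(r⁻¹)ω(τ'), a difference of elements of 𝔥.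
  have hlog : ∀ s ∈ Ioo (c - ε) (c + ε), inclMap EG EP P (logVel EP r s) ∈ 𝔥 := by
    intro s hs
    obtain ⟨h1, h2⟩ := hball s hs
    have h3 := C.conn_velocity_act (h2.smooth.mdifferentiableAt (by simp))
      ((hrs s hs).mdifferentiableAt (by simp))
    rw [← der_congr (hev s hs), ← hr s hs] at h3
    rw [← sub_eq_iff_eq_add'.2 h3]
    exact 𝔥.sub_mem h1.conn_mem (hAd s hs _ h2.conn_mem)
  -- Near `c`, φ is the identity and this is σ. Elsewhere the logarithmic derivative of r ∘ φ is φ'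
  -- times that of r, still in 𝔥, so τ·(r ∘ φ) is adapted wherever τ is.
  refine ⟨fun t => C.act (τ t) (r (φ t)), ?_, fun t ht => ?_⟩
  · filter_upwards [hφc, hev c ⟨by linarith, by linarith⟩] with s h1 h2
    rw [h1, h2]
  · have hrφ : ContMDiffAt 𝓘(ℝ, ℝ) 𝓘(ℝ, EP) ∞ (fun s => r (φ s)) t :=
      (hrs _ (hφI t)).comp t hφ.contMDiff.contMDiffAt
    refine ⟨C.contMDiffAt_act_curve ht.smooth hrφ, ?_, ?_, fun u hu => ?_⟩
    · filter_upwards [ht.proj_eq] with s hs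
      rw [C.proj_act, hs]
    · rw [C.conn_velocity_act (p := fun s => r (φ s)) (ht.smooth.mdifferentiableAt (by simp))
        (hrφ.mdifferentiableAt (by simp)),
        logVel_comp ((hrs _ (hφI t)).mdifferentiableAt (by simp))
          (hφ.contDiffAt.differentiableAt (by simp)), map_smul]
      exact 𝔥.add_mem (hAd _ (hφI t) _ ht.conn_mem) (𝔥.smul_mem _ (hlog _ (hφI t)))
    · let v : C.Fiber (γ t) := ⟨τ t, ht.proj_eq.self_of_nhds⟩
      rw [C.map_coord_of_act (u := v) hu, ht.map_coord v rfl, hmap _ (hφI t)]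

lemma isDistinguished_of_exists_isAdaptedAt {J : Set ℝ} (hJ : IsOpen J) (hJc : J.OrdConnected)
    (h : ∀ t ∈ J, ∃ σ : ℝ → B, ∀ᶠ s in 𝓝 t, C.IsAdaptedAt S 𝔥 σ s) :
    C.IsDistinguished 𝔥 γ J := by
  rcases J.eq_empty_or_nonempty with rfl | hne
  · exact ⟨fun t => (Classical.arbitrary (C.Fiber (γ t))).1, fun t ht => ht.elim,
      fun t ht => ht.elim⟩
  · obtain ⟨σ, hσ⟩ := exists_global (Q := fun σ t => ∀ᶠ s in 𝓝 t, C.IsAdaptedAt S 𝔥 σ s)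
      (fun σ τ t hστ h => by
        filter_upwards [hστ.eventuallyEq_nhds, h] with s h1 h2 using h2.congr C h1)
      (fun σ τ c h1 h2 => by
        obtain ⟨ρ, h3, h4⟩ := C.exists_prolongation h1 h2
        exact ⟨ρ, h3, fun t ht => ht.mono h4⟩)
      hJ hJc hne (fun t ht => by
        obtain ⟨σ, hσ⟩ := h t ht
        exact ⟨σ, hσ.eventually_nhds⟩)
    exact ⟨σ, fun t ht => (hσ t ht).self_of_nhds.smooth.contMDiffWithinAt, fun t ht =>
      ⟨(hσ t ht).self_of_nhds.proj_eq.self_of_nhds, (hσ t ht).self_of_nhds.conn_mem⟩⟩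

end CartanGeometry

end CartanTractor
end

theorem mainTheorem7
    {EG EP EM EB : Type*}
    [NormedAddCommGroup EG] [NormedSpace ℝ EG] [FiniteDimensional ℝ EG]
    [NormedAddCommGroup EP] [NormedSpace ℝ EP] [FiniteDimensional ℝ EP]
    [NormedAddCommGroup EM] [NormedSpace ℝ EM] [FiniteDimensional ℝ EM]
    [NormedAddCommGroup EB] [NormedSpace ℝ EB] [FiniteDimensional ℝ EB]
    {G : Type*} [TopologicalSpace G] [T2Space G] [SecondCountableTopology G]
    [ChartedSpace EG G] [Group G] [LieGroup 𝓘(ℝ, EG) ∞ G]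
    (P : Subgroup G) [ChartedSpace EP P] [LieGroup 𝓘(ℝ, EP) ∞ P]
    (hP : CartanTractor.IsClosedLieSubgroup EG EP P)
    {M : Type*} [TopologicalSpace M] [T2Space M] [SecondCountableTopology M]
    [ChartedSpace EM M] [IsManifold 𝓘(ℝ, EM) ∞ M]
    {B : Type*} [TopologicalSpace B] [T2Space B] [SecondCountableTopology B]
    [ChartedSpace EB B] [IsManifold 𝓘(ℝ, EB) ∞ B]
    (C : CartanTractor.CartanGeometry EG EP EM EB P M B)
    (ℓ : ℝ → G ⧸ P) (K : Set ℝ) (hℓ : CartanTractor.IsRegularModelCurve EG EP P ℓ K)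
    (hbase : ∃ t ∈ K, ℓ t = QuotientGroup.mk (1 : G))
    (γ : ℝ → M) (J : Set ℝ) (hJ : IsOpen J) (hJc : J.OrdConnected)
    (hγ : ContMDiffOn 𝓘(ℝ, ℝ) 𝓘(ℝ, EM) ∞ γ J)
    (hγ' : ∀ t ∈ J, CartanTractor.velocity EM γ t ≠ 0) :
    C.IsDistinguished (CartanTractor.symmetryAlgebra EG EP P ℓ K) γ J ↔
      ∃ S : ∀ t : ℝ, Submodule ℝ (C.AdjointTractor (γ t)),
        C.IsSmoothSubbundle S J ∧
        (∀ t ∈ J, ∃ u : C.Fiber (γ t),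
          (S t).map (C.frame u) = CartanTractor.symmetryAlgebra EG EP P ℓ K) ∧
        (∀ t ∈ J, ∀ u : C.Fiber (γ t),
          (S t).map (C.anchor u) = Submodule.span ℝ {CartanTractor.velocity EM γ t}) ∧
        C.IsPreserved S J := by
  have hLie := fun X hX Y hY =>
    CartanTractor.adMap_mem_symmetryAlgebra (EG := EG) (EP := EP) (X := X) (Y := Y) hP hℓ hX hY
  constructor
  · exact C.exists_subbundle_of_isDistinguished hP hLie
      (CartanTractor.exists_symmetryAlgebra_le hP hℓ hbase) hJ hγ'
  · rintro ⟨S, h0, h1, h2, h3⟩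
    exact C.isDistinguished_of_exists_isAdaptedAt hJ hJc fun t ht =>
      C.exists_isAdaptedAt_near hP hLie hγ hγ' h0 h1 h2 h3 ht
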